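/- Let $q,n\ge 1$ be integers, $\mathbb S^q\subset\mathbb R^{q+1}$ the unit sphere with surface measure $\sigma_q$, uniform distribution $\nu_q$ and area $\omega_q=2\pi^{(q+1)/2}/\Gamma((q+1)/2)$. Let $\psi_1(\theta)=\exp(\kappa(\cos\theta-1))$ with $\kappa>0$ and $\psi_2(\theta)=(1-\rho^2)/(1-2\rho\cos\theta+\rho^2)^{(q+1)/2}$ with $0<\rho<1$. For $\ell=1,2$ and $\mathbf X_1,\dots,\mathbf X_n$ in $\mathbb S^q$ with $\theta_{ij}=\cos^{-1}(\mathbf X_i'\mathbf X_j)$, put $$T_{n,\ell}=\frac2n\sum_{1\le i<j\le n}\big(\psi_\ell(\theta_{ij})-\mathbb E_{\mathcal H_0}[\psi_\ell(\theta_{12})]\big),$$ where $\mathbb E_{\mathcal H_0}$ is the expectation for two independent points with distribution $\nu_q$. Let $P_{k,1}=T_k$ be the Chebyshev polynomials of the first kind and, for $q\ge2$, $P_{k,q}=C_k^{(q-1)/2}$ the Gegenbauer polynomials. Let $c_{k,1}=(1+\delta_{k,0})\pi/2$ and $c_{k,q}=\frac{\omega_q}{\omega_{q-1}}\big(1+\frac{2k}{q-1}\big)^{-2}\frac{2k+q-1}{q-1}C_k^{(q-1)/2}(1)$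 for $q\ge2$. For a function $h$ on $[-1,1]$ its Gegenbauer (Chebyshev, if $q=1$) coefficients are $c_{k,q}^{-1}\int_{-1}^1h(x)P_{k,q}(x)(1-x^2)^{q/2-1}\,dx$, $k\ge0$; $b_{k,q}(\psi)$ are those of $x\mapsto\psi(\cos^{-1}x)$. Let $$\tau_{k,q}=\begin{cases}(1+\delta_{k,0})^2/4,&q=1,\\(1+2k/(q-1))^{-2}\,(q-1)_k/k!,&q\ge2,\end{cases}\qquad \zeta_{k_1,k_2,q}=\begin{cases}(1+\delta_{k_1,0})(1+\delta_{k_2,0})/2,&q=1,\\ \omega_{q-1}(1+2k_1/(q-1))^{-1}(1+2k_2/(q-1))^{-1},&q\ge2,\end{cases}$$ with $(a)_k=a(a+1)\cdots(a+k-1)$, and $$t_{k_1,k_2,k_3;q}=\int_{-1}^1P_{k_1,q}(x)P_{k_2,q}(x)P_{k_3,q}(x)(1-x^2)^{q/2-1}\,dx.$$ Let $\boldsymbol\mu\in\mathbb S^q$, let $g$ be square-integrable on $[-1,1]$ with respect to the weight $(1-x^2)^{q/2-1}$, let $f_1(\mathbf x)=g(\mathbf x'\boldsymbol\mu)$ be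 a probability density with respect to $\sigma_q$, and let $e_{k,q}$ be the Gegenbauer (Chebyshev) coefficients of $g$. If $\mathbf X_1,\dots,\mathbf X_n$ are independent with density $f_1$ (hypothesis $\mathcal H_1$), then $T_{n,\ell}$ is square-integrable, the series below converge absolutely, and $$\mathrm{Var}_{\mathcal H_1}[T_{n,\ell}]=\frac{2(n-1)}n\big(2(n-2)\,\eta_{1,\ell}+\eta_{2,\ell}\big),\qquad \eta_{i,\ell}=\alpha_{i,\ell}-\beta_\ell^2,\quad i=1,2,$$ where $$\alpha_{1,\ell}=\omega_q^2\sum_{k_1,k_2,k_3=0}^\infty\zeta_{k_1,k_2,q}\,b_{k_1,q}(\psi_\ell)\,b_{k_2,q}(\psi_\ell)\,e_{k_1,q}\,e_{k_2,q}\,e_{k_3,q}\,t_{k_1,k_2,k_3;q},$$ $$\alpha_{2,\ell}=\omega_q^2\sum_{k=0}^\infty\tau_{k,q}\,b_{k,q}(\psi_\ell^2)\,e_{k,q}^2,\qquad \beta_\ell=\omega_q^2\sum_{k=0}^\infty\tau_{k,q}\,b_{k,q}(\psi_\ell)\,e_{k,q}^2.$$ Moreover, for $k_3\ge k_2\ge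 k_1\ge0$: if $q\ge2$, then $t_{k_1,k_2,k_3;q}=0$ when $k_1+k_2+k_3$ is odd or $k_3>k_1+k_2$, and otherwise $t_{k_1,k_2,k_3;q}=a_{(k_1+k_2-k_3)/2,\,k_1,\,k_2,\,(q-1)/2}\;c_{k_3,q}$ with $$a_{l,k_1,k_2,\lambda}=\frac{k_1+k_2+\lambda-2l}{l!\,(k_1+k_2+\lambda-l)}\binom{k_1+k_2-2l}{k_2-l}\frac{\Gamma(\lambda+l)\,\mathrm B(\lambda+k_1-l,\lambda+k_2-l)}{\Gamma(\lambda)\,\mathrm B(\lambda+k_1+k_2-l,\lambda)},$$ where $\mathrm B$ is Euler's beta function; if $q=1$, then $t_{k_1,k_2,k_3;1}=\frac{1+\delta_{k_1,0}}2c_{k_3,1}$ when $k_3=k_2\pm k_1$, and $t_{k_1,k_2,k_3;1}=0$ otherwise. -/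

import Mathlib

open MeasureTheory ProbabilityTheory
open scoped ENNReal

noncomputable section

namespace SphereUniformity

/-- The ambient Euclidean space `ℝ^(q+1)`. -/
abbrev Ambient (q : ℕ) : Type := EuclideanSpace ℝ (Fin (q + 1))

/-- The unit sphere `𝕊^q` of `ℝ^(q+1)`. -/
abbrev Sphere (q : ℕ) : Type := Metric.sphere (0 : Ambient q) 1

/-- The inner product `x'y` of two points of the sphere, computed in `ℝ^(q+1)`. -/
def dot {q : ℕ} (x y : Sphere q) : ℝ := inner ℝ (x : Ambient q) (y : Ambient q)

/-- The angle `cos⁻¹(x'y)` between two points of the sphere. -/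
def angle {q : ℕ} (x y : Sphere q) : ℝ := Real.arccos (dot x y)

/-- The (non-normalised) surface measure on `𝕊^q`. -/
def surface (q : ℕ) : Measure (Sphere q) := (volume : Measure (Ambient q)).toSphere

/-- The uniform probability measure on `𝕊^q`. -/
def uniform (q : ℕ) : Measure (Sphere q) := (surface q Set.univ)⁻¹ • surface q

/-- The surface area of `𝕊^q`. -/
def area (q : ℕ) : ℝ := 2 * Real.pi ^ (((q : ℝ) + 1) / 2) / Real.Gamma (((q : ℝ) + 1) / 2)

/-- The Gegenbauer polynomials of parameter `a`, through the three-term recurrence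
`(k+2) C_{k+2} = 2 (k+1+a) x C_{k+1} - (k+2a) C_k`. -/
def gegenbauer (a : ℝ) : ℕ → Polynomial ℝ
  | 0 => 1
  | 1 => Polynomial.C (2 * a) * Polynomial.X
  | (k + 2) =>
      Polynomial.C (2 * ((k : ℝ) + 1 + a) / ((k : ℝ) + 2)) * Polynomial.X * gegenbauer a (k + 1)
        - Polynomial.C (((k : ℝ) + 2 * a) / ((k : ℝ) + 2)) * gegenbauer a k

/-- The orthogonal polynomial of degree `k` attached to `𝕊^q`: Chebyshev `T_k` for `q = 1` and
Gegenbauer `C_k^((q-1)/2)` for `q ≥ 2`. -/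
def basisPoly (q k : ℕ) : Polynomial ℝ :=
  if q = 1 then Polynomial.Chebyshev.T ℝ (k : ℤ) else gegenbauer (((q : ℝ) - 1) / 2) k

/-- The weight `(1 - x²)^(q/2 - 1)`. -/
def weight (q : ℕ) (x : ℝ) : ℝ := (1 - x ^ 2) ^ ((q : ℝ) / 2 - 1)

/-- The weighted Lebesgue measure on `[-1, 1]`. -/
def weightMeasure (q : ℕ) : Measure ℝ :=
  (volume.restrict (Set.Icc (-1 : ℝ) 1)).withDensity (fun x => ENNReal.ofReal (weight q x))

/-- The squared norms `c_{k,q}` of the orthogonal polynomials. -/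
def normConst (q k : ℕ) : ℝ :=
  if q = 1 then (1 + if k = 0 then 1 else 0) * Real.pi / 2
  else area q / area (q - 1) * ((1 + 2 * (k : ℝ) / ((q : ℝ) - 1)) ^ 2)⁻¹ *
    ((2 * (k : ℝ) + (q : ℝ) - 1) / ((q : ℝ) - 1) * (basisPoly q k).eval 1)

/-- The `k`-th Gegenbauer (Chebyshev, if `q = 1`) coefficient of a function on `[-1, 1]`. -/
def coeff (q : ℕ) (h : ℝ → ℝ) (k : ℕ) : ℝ :=
  (normConst q k)⁻¹ * ∫ x in (-1 : ℝ)..1, h x * (basisPoly q k).eval x * weight q x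

/-- The coefficients `b_{k,q}(ψ)` of a kernel `ψ(θ)`, `θ ∈ [0, π]`: those of
`x ↦ ψ(cos⁻¹ x)`. -/
def kernelCoeff (q : ℕ) (ψ : ℝ → ℝ) (k : ℕ) : ℝ := coeff q (fun x => ψ (Real.arccos x)) k

/-- The smooth maximum kernel. -/
def smoothMaxKernel (κ : ℝ) (θ : ℝ) : ℝ := Real.exp (κ * (Real.cos θ - 1))

/-- The Poisson kernel. -/
def poissonKernel (q : ℕ) (ρ : ℝ) (θ : ℝ) : ℝ :=
  (1 - ρ ^ 2) / (1 - 2 * ρ * Real.cos θ + ρ ^ 2) ^ (((q : ℝ) + 1) / 2)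

/-- The two families of kernels. -/
def IsTestKernel (q : ℕ) (ψ : ℝ → ℝ) : Prop :=
  (∃ κ : ℝ, 0 < κ ∧ ψ = smoothMaxKernel κ) ∨ (∃ ρ : ℝ, 0 < ρ ∧ ρ < 1 ∧ ψ = poissonKernel q ρ)

/-- The expectation of `ψ(θ₁₂)` for two independent uniform points of `𝕊^q`. -/
def nullMean (q : ℕ) (ψ : ℝ → ℝ) : ℝ :=
  ∫ p : Sphere q × Sphere q, ψ (angle p.1 p.2) ∂((uniform q).prod (uniform q))

/-- The statistic `T_n` of a sample `x`. -/
def statistic {q n : ℕ} (ψ : ℝ → ℝ) (x : Fin n → Sphere q) : ℝ :=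
  2 / (n : ℝ) * ∑ i : Fin n, ∑ j ∈ Finset.Ioi i, (ψ (angle (x i) (x j)) - nullMean q ψ)

/-- The law on `𝕊^q` with density `x ↦ g(x'μ)` with respect to the surface measure. -/
def rotSymLaw {q : ℕ} (m : Sphere q) (g : ℝ → ℝ) : Measure (Sphere q) :=
  (surface q).withDensity (fun x => ENNReal.ofReal (g (dot x m)))

/-- The constants `τ_{k,q}`. -/
def tau (q k : ℕ) : ℝ :=
  if q = 1 then (1 + if k = 0 then 1 else 0) ^ 2 / 4
  else ((1 + 2 * (k : ℝ) / ((q : ℝ) - 1)) ^ 2)⁻¹ *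
    ((ascPochhammer ℝ k).eval ((q : ℝ) - 1) / (k.factorial : ℝ))

/-- The constants `ζ_{k₁,k₂,q}`. -/
def zeta (q k₁ k₂ : ℕ) : ℝ :=
  if q = 1 then (1 + if k₁ = 0 then 1 else 0) * (1 + if k₂ = 0 then 1 else 0) / 2
  else area (q - 1) * (1 + 2 * (k₁ : ℝ) / ((q : ℝ) - 1))⁻¹ *
    (1 + 2 * (k₂ : ℝ) / ((q : ℝ) - 1))⁻¹

/-- The triple-product integrals `t_{k₁,k₂,k₃;q}`. -/
def triple (q k₁ k₂ k₃ : ℕ) : ℝ :=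
  ∫ x in (-1 : ℝ)..1, (basisPoly q k₁).eval x * (basisPoly q k₂).eval x *
    (basisPoly q k₃).eval x * weight q x

/-- The coefficients of the linearization formula for products of Gegenbauer polynomials of
parameter `a`; `ProbabilityTheory.beta` is Euler's beta function. It is used for
`l ≤ min k₁ k₂` only. -/
def linCoeff (l k₁ k₂ : ℕ) (a : ℝ) : ℝ :=
  ((k₁ : ℝ) + k₂ + a - 2 * l) / ((l.factorial : ℝ) * ((k₁ : ℝ) + k₂ + a - l)) *
    (Nat.choose (k₁ + k₂ - 2 * l) (k₂ - l) : ℝ) *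
    (Real.Gamma (a + l) * ProbabilityTheory.beta (a + k₁ - l) (a + k₂ - l) /
      (Real.Gamma a * ProbabilityTheory.beta (a + k₁ + k₂ - l) a))

/-- The terms of the series for `α₁`. -/
def alphaOneTerm (q : ℕ) (ψ g : ℝ → ℝ) (k : ℕ × ℕ × ℕ) : ℝ :=
  zeta q k.1 k.2.1 * kernelCoeff q ψ k.1 * kernelCoeff q ψ k.2.1 *
    coeff q g k.1 * coeff q g k.2.1 * coeff q g k.2.2 * triple q k.1 k.2.1 k.2.2

/-- The terms of the series for `β`; at `ψ²` in place of `ψ`, those of the series for `α₂`. -/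
def betaTerm (q : ℕ) (ψ g : ℝ → ℝ) (k : ℕ) : ℝ :=
  tau q k * kernelCoeff q ψ k * coeff q g k ^ 2

/-- `α₁`. -/
def alphaOne (q : ℕ) (ψ g : ℝ → ℝ) : ℝ := area q ^ 2 * ∑' k, alphaOneTerm q ψ g k

/-- `α₂`. -/
def alphaTwo (q : ℕ) (ψ g : ℝ → ℝ) : ℝ := area q ^ 2 * ∑' k, betaTerm q (fun θ => ψ θ ^ 2) g k

/-- `β`. -/
def betaConst (q : ℕ) (ψ g : ℝ → ℝ) : ℝ := area q ^ 2 * ∑' k, betaTerm q ψ g k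

/-- `η₁ = α₁ - β²`. -/
def etaOne (q : ℕ) (ψ g : ℝ → ℝ) : ℝ := alphaOne q ψ g - betaConst q ψ g ^ 2

/-- `η₂ = α₂ - β²`. -/
def etaTwo (q : ℕ) (ψ g : ℝ → ℝ) : ℝ := alphaTwo q ψ g - betaConst q ψ g ^ 2

end SphereUniformity

end

noncomputable section

namespace SphereUniformity

open Polynomial

/-! Up to an additive constant and a factor, `T_n` is a U-statistic with the symmetric kernel h(x,y)
= ψ(cos⁻¹ x'y). The covariance of h(X_i,X_j) and h(X_k,X_l) depends only on how many indices the two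
pairs share: zero, one or two shared indices give 0, η₁, η₂ (`covariance_offDiag`). Counting pairs
gives the variance, with α₁ = E[(E[h(X₁,X₂)|X₁])²], α₂ = E[h²] and β = E[h]. It remains to expand
these three expectations.

Both kernels, as functions of the cosine, extend holomorphically to a disc of radius larger than 1.
Their coefficients therefore decay geometrically, and their Gegenbauer series converge absolutely
and uniformly on [-1,1] (`ExtendsAnalytically.hasSum`). The Funk–Hecke formula `funk_hecke` shows
that integrating P_k(x'y) against the law of y returns a multiple of e_k P_k(x'μ). Integrating once
more against the law gives β, and α₂ after replacing ψ by ψ². Squaring before the last integration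
leaves the integrals of P_{k₁}P_{k₂}g, which are finite sums of the e_{k₃} t_{k₁,k₂,k₃} because
P_{k₁}P_{k₂} is a polynomial. Hence the series for α₁.

Funk–Hecke is proved first for polynomials. Gaussian integrals give the mixed moments of the sphere
in two orthogonal directions, hence an operator `sliceMean` on polynomials that does not raise
degrees. Exchanging the two poles makes it symmetric, so it is diagonal in the orthogonal basis.
Equality of moments on a compact interval then identifies image measures, which carries the formula
to integrable g.

The triple integrals use only Pearson's equation for the weight and the three-term recurrence.
Multiplying by x and absorbing it into either of two factors gives a recurrence in the indices, and
the explicit product of Pochhammer ratios `tripleValue` solves the same recurrence with the same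
initial values. For q = 1 the product formula for `T_k` suffices. -/

/-! ### Moments of the weight on [-1,1] -/

lemma weight_nonneg {q : ℕ} {x : ℝ} (hx : x ∈ Set.Icc (-1 : ℝ) 1) : 0 ≤ weight q x := by
  apply Real.rpow_nonneg
  nlinarith [hx.1, hx.2]

@[fun_prop]
lemma measurable_weight (q : ℕ) : Measurable (weight q) := by
  unfold weight; fun_prop

lemma integral_weightMeasure (q : ℕ) (φ : ℝ → ℝ) :
    ∫ x, φ x ∂(weightMeasure q) = ∫ x in Set.Icc (-1 : ℝ) 1, φ x * weight q x := by
  unfold weightMeasure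
  rw [integral_withDensity_eq_integral_toReal_smul (by fun_prop) (by simp)]
  refine setIntegral_congr_fun measurableSet_Icc fun x hx => ?_
  simp [ENNReal.toReal_ofReal (weight_nonneg hx), mul_comm]

lemma intervalIntegral_mul_weight (q : ℕ) (φ : ℝ → ℝ) :
    ∫ x in (-1 : ℝ)..1, φ x * weight q x = ∫ x, φ x ∂(weightMeasure q) := by
  rw [integral_weightMeasure, intervalIntegral.integral_of_le (by norm_num),
    integral_Icc_eq_integral_Ioc]

lemma weightMeasure_compl (q : ℕ) : weightMeasure q (Set.Icc (-1 : ℝ) 1)ᶜ = 0 := by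
  apply withDensity_absolutelyContinuous
  rw [Measure.restrict_apply measurableSet_Icc.compl]
  simp

lemma ae_mem_Icc_weightMeasure (q : ℕ) : ∀ᵐ x ∂(weightMeasure q), x ∈ Set.Icc (-1 : ℝ) 1 :=
  weightMeasure_compl q

lemma integral_betaPDFReal {α β : ℝ} (hα : 0 < α) (hβ : 0 < β) :
    ∫ x in Set.Ioi (0 : ℝ), betaPDFReal α β x = 1 := by
  have h0 : ∀ x, 0 ≤ betaPDFReal α β x := by
    intro x
    by_cases hx : 0 < x ∧ x < 1
    · exact (betaPDFReal_pos hx.1 hx.2 hα hβ).le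
    · simp [betaPDFReal, hx]
  have h1 : ∫ x, betaPDFReal α β x = 1 := by
    rw [integral_eq_lintegral_of_nonneg_ae (.of_forall h0) (by fun_prop)]
    have := lintegral_betaPDF_eq_one hα hβ
    simp only [betaPDF] at this
    rw [this]; simp
  rw [← h1]
  refine setIntegral_eq_integral_of_forall_compl_eq_zero fun x hx => ?_
  have : ¬ (0 < x ∧ x < 1) := fun h => hx h.1
  simp [betaPDFReal, this]

/-- The value of `∫ x^a (1-x²)^(b+q/2-1)` for even `a`. -/
def betaMoment (q a b : ℕ) : ℝ := ProbabilityTheory.beta (((a : ℝ) + 1) / 2) (b + (q : ℝ) / 2)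

lemma betaMoment_pos {q : ℕ} (hq : 1 ≤ q) (a b : ℕ) : 0 < betaMoment q a b := by
  have : (1 : ℝ) ≤ q := by exact_mod_cast hq
  exact beta_pos (by positivity) (by positivity)

/-- By evenness the integral is twice the one over x > 0, where the substitution u = x² turns the
integrand into an unnormalised beta density of total mass `beta α β`. -/
lemma weightMeasure_moment_even {q : ℕ} (hq : 1 ≤ q) (a b : ℕ) (ha : Even a) :
    ∫ x, x ^ a * (1 - x ^ 2) ^ b ∂(weightMeasure q) = betaMoment q a b := by
  have hq' : (1 : ℝ) ≤ q := by exact_mod_cast hq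
  set α : ℝ := ((a : ℝ) + 1) / 2 with hα
  set β : ℝ := b + (q : ℝ) / 2 with hβ
  have hα0 : 0 < α := by positivity
  have hβ0 : 0 < β := by positivity
  rw [integral_weightMeasure, ← integral_indicator measurableSet_Icc]
  -- The cutoff is strict so that it matches the support of the beta density on (0,1); the endpoints
  -- ±1 that it loses form a null set.
  set F : ℝ → ℝ := Set.indicator (Set.Iio 1) (fun x => x ^ a * (1 - x ^ 2) ^ b * weight q x) with hF
  have h1 : (Set.indicator (Set.Icc (-1 : ℝ) 1) fun x => x ^ a * (1 - x ^ 2) ^ b * weight q x)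
      =ᵐ[volume] fun x => F |x| := by
    have : ∀ᵐ x : ℝ, x ∉ ({1, -1} : Set ℝ) :=
      measure_eq_zero_iff_ae_notMem.1 ((Set.toFinite {1, -1}).measure_zero volume)
    filter_upwards [this] with x hx
    simp only [Set.mem_insert_iff, Set.mem_singleton_iff, not_or] at hx
    by_cases h : |x| < 1
    · have : x ∈ Set.Icc (-1 : ℝ) 1 := by
        rw [abs_lt] at h; exact ⟨h.1.le, h.2.le⟩
      simp only [hF, Set.indicator_of_mem this, Set.indicator_of_mem (Set.mem_Iio.2 h), weight,
        sq_abs, ha.pow_abs]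
    · have : x ∉ Set.Icc (-1 : ℝ) 1 := by
        rintro ⟨h3, h4⟩
        exact h (abs_lt.2 ⟨lt_of_le_of_ne h3 (Ne.symm hx.2), lt_of_le_of_ne h4 hx.1⟩)
      simp only [hF, Set.indicator_of_notMem this,
        Set.indicator_of_notMem (show |x| ∉ Set.Iio (1 : ℝ) from h)]
  rw [integral_congr_ae h1, integral_comp_abs (f := F)]
  have h2 := integral_comp_rpow_Ioi_of_pos (g := betaPDFReal α β) (p := 2) (by norm_num)
  rw [integral_betaPDFReal hα0 hβ0] at h2
  have h3 : ∀ x ∈ Set.Ioi (0 : ℝ), (2 * x ^ ((2 : ℝ) - 1)) • betaPDFReal α β (x ^ (2 : ℝ))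
      = (2 / beta α β) * F x := by
    intro x hx
    have hx : 0 < x := hx
    rw [show (2 : ℝ) - 1 = 1 by norm_num, Real.rpow_one, Real.rpow_two]
    by_cases h : x < 1
    · have hx2 : 0 < 1 - x ^ 2 := by nlinarith
      have : 0 < x ^ 2 ∧ x ^ 2 < 1 := ⟨by positivity, by linarith⟩
      simp only [hF, Set.indicator_of_mem (Set.mem_Iio.2 h), betaPDFReal, this, and_self, if_true,
        smul_eq_mul, weight]
      rw [← Real.rpow_two x, ← Real.rpow_mul hx.le, Real.rpow_two, ← Real.rpow_natCast _ b,
        mul_assoc (x ^ a), ← Real.rpow_add hx2, ← Real.rpow_natCast x a,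
        show (a : ℝ) = 1 + 2 * (α - 1) by rw [hα]; ring, Real.rpow_add hx, Real.rpow_one,
        show (b : ℝ) + ((q : ℝ) / 2 - 1) = β - 1 by rw [hβ]; ring]
      ring
    · have : ¬ (0 < x ^ 2 ∧ x ^ 2 < 1) := by
        push Not at h ⊢
        intro; nlinarith
      rw [betaPDFReal, if_neg this]
      simp [hF, h]
  rw [setIntegral_congr_fun measurableSet_Ioi h3, integral_const_mul] at h2
  have hB := beta_pos hα0 hβ0
  rw [betaMoment, ← hα, ← hβ]
  field_simp at h2
  linarith

instance weightMeasure_finite (q : ℕ) [Fact (1 ≤ q)] : IsFiniteMeasure (weightMeasure q) := by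
  have h := weightMeasure_moment_even (q := q) Fact.out 0 0 (by simp)
  have h1 : Integrable (fun _ : ℝ => (1 : ℝ)) (weightMeasure q) := by
    -- A non-integrable constant would have integral 0 by convention, but this integral is a
    -- positive beta value.
    by_contra hc
    have := integral_undef hc
    simp only [pow_zero, mul_one] at h
    rw [h] at this
    exact (betaMoment_pos Fact.out 0 0).ne' this
  exact (integrable_const_iff.1 h1).resolve_left one_ne_zero

lemma weightMeasure_moment_odd (q : ℕ) (a b : ℕ) (ha : Odd a) :
    ∫ x, x ^ a * (1 - x ^ 2) ^ b ∂(weightMeasure q) = 0 := by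
  rw [integral_weightMeasure, ← integral_indicator measurableSet_Icc]
  set G := Set.indicator (Set.Icc (-1 : ℝ) 1) fun x => x ^ a * (1 - x ^ 2) ^ b * weight q x with hG
  have h := integral_neg_eq_self G volume
  have h2 : ∀ x, G (-x) = - G x := by
    intro x
    by_cases hx : x ∈ Set.Icc (-1 : ℝ) 1
    · have hx' : -x ∈ Set.Icc (-1 : ℝ) 1 := ⟨by linarith [hx.2], by linarith [hx.1]⟩
      simp only [hG, Set.indicator_of_mem hx, Set.indicator_of_mem hx', ha.neg_pow, weight]
      simp
    · have hx' : -x ∉ Set.Icc (-1 : ℝ) 1 := fun h => hx ⟨by linarith [h.2], by linarith [h.1]⟩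
      simp [hG, Set.indicator_of_notMem hx, Set.indicator_of_notMem hx']
  simp_rw [h2, integral_neg] at h
  linarith

lemma integrable_of_continuous (q : ℕ) [Fact (1 ≤ q)] {f : ℝ → ℝ} (hf : Continuous f) :
    Integrable f (weightMeasure q) := by
  obtain ⟨C, hC⟩ := isCompact_Icc.exists_bound_of_continuousOn (s := Set.Icc (-1 : ℝ) 1)
    hf.continuousOn
  refine Integrable.of_bound hf.aestronglyMeasurable C ?_
  filter_upwards [ae_mem_Icc_weightMeasure q] with x hx using hC x hx

/-- Integration of polynomials against the weight. -/
def wInt (q : ℕ) [Fact (1 ≤ q)] : ℝ[X] →ₗ[ℝ] ℝ where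
  toFun p := ∫ x, p.eval x ∂(weightMeasure q)
  map_add' p r := by
    simp only [eval_add]
    exact integral_add (integrable_of_continuous q p.continuous)
      (integrable_of_continuous q r.continuous)
  map_smul' c p := by simp [integral_const_mul]

lemma wInt_apply (q : ℕ) [Fact (1 ≤ q)] (p : ℝ[X]) :
    wInt q p = ∫ x, p.eval x ∂(weightMeasure q) := rfl

lemma wInt_monomial_even (q : ℕ) [Fact (1 ≤ q)] (a b : ℕ) (ha : Even a) :
    wInt q (X ^ a * (1 - X ^ 2) ^ b) = betaMoment q a b := by
  rw [wInt_apply, ← weightMeasure_moment_even Fact.out a b ha]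
  simp

lemma wInt_monomial_odd (q : ℕ) [Fact (1 ≤ q)] (a b : ℕ) (ha : Odd a) :
    wInt q (X ^ a * (1 - X ^ 2) ^ b) = 0 := by
  rw [wInt_apply, ← weightMeasure_moment_odd q a b ha]
  simp

lemma betaMoment_zero (q : ℕ) (hq : 1 ≤ q) : betaMoment q 0 0 = area q / area (q - 1) := by
  have : (1 : ℝ) ≤ q := by exact_mod_cast hq
  simp only [betaMoment, beta, area]
  rw [Nat.cast_sub hq]
  have h1 := (Real.Gamma_pos_of_pos (show (0 : ℝ) < q / 2 by positivity)).ne'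
  have h2 := (Real.Gamma_pos_of_pos (show (0 : ℝ) < (q + 1) / 2 by positivity)).ne'
  have h3 : (0 : ℝ) < Real.pi ^ ((q : ℝ) / 2) := by positivity
  simp only [Nat.cast_zero, Nat.cast_one, zero_add, sub_add_cancel, Real.Gamma_one_half_eq]
  rw [show (1 : ℝ) / 2 + (q : ℝ) / 2 = (q + 1) / 2 by ring, show ((q : ℝ) + 1) / 2 = q / 2 + 1 / 2 by ring,
    Real.rpow_add Real.pi_pos, ← Real.sqrt_eq_rpow]
  rw [show ((q : ℝ) + 1) / 2 = q / 2 + 1 / 2 by ring] at h2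
  field_simp

/-! ### Moments of the sphere from Gaussian integrals -/

instance surface_finite (q : ℕ) : IsFiniteMeasure (surface q) := by
  unfold surface; infer_instance

lemma integral_pow_mul_exp_even (a : ℕ) (ha : Even a) :
    ∫ t : ℝ, t ^ a * Real.exp (-t ^ 2) = Real.Gamma (((a : ℝ) + 1) / 2) := by
  have h := integral_comp_abs (f := fun t : ℝ => t ^ a * Real.exp (-t ^ 2))
  simp only [sq_abs, ha.pow_abs] at h
  rw [h]
  have := integral_rpow_mul_exp_neg_rpow (p := 2) (q := a) (by norm_num)
    (by linarith [Nat.cast_nonneg (α := ℝ) a])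
  simp only [Real.rpow_natCast, Real.rpow_ofNat] at this
  rw [this]; ring

lemma integral_pow_mul_exp_odd (a : ℕ) (ha : Odd a) :
    ∫ t : ℝ, t ^ a * Real.exp (-t ^ 2) = 0 := by
  have h := integral_neg_eq_self (fun t : ℝ => t ^ a * Real.exp (-t ^ 2)) volume
  simp only [ha.neg_pow, even_two.neg_pow, neg_mul, integral_neg] at h
  linarith

/-- In polar coordinates a homogeneous function splits into its restriction to the sphere and a
power of the radius, and the radial factor integrates to a Gamma value. Spherical moments are thus
read off from Gaussian moments. -/
lemma integral_homogeneous_mul_exp (q d : ℕ) (h : Ambient q → ℝ)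
    (hh : ∀ (r : ℝ) (z : Ambient q), 0 < r → h (r • z) = r ^ d * h z) :
    ∫ z, h z * Real.exp (-‖z‖ ^ 2) =
      (∫ y : Sphere q, h y ∂(surface q)) * (Real.Gamma (((d : ℝ) + q + 1) / 2) / 2) := by
  have hd : Module.finrank ℝ (Ambient q) - 1 = q := by simp
  calc
    ∫ z, h z * Real.exp (-‖z‖ ^ 2)
      = ∫ z : ({(0)}ᶜ : Set (Ambient q)), h z * Real.exp (-‖(z : Ambient q)‖ ^ 2)
          ∂((volume : Measure (Ambient q)).comap (↑)) := by
        rw [integral_subtype_comap (measurableSet_singleton _).compl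
          fun z : Ambient q => h z * Real.exp (-‖z‖ ^ 2), restrict_compl_singleton]
    _ = ∫ p : Sphere q × Set.Ioi (0 : ℝ), h p.1 * ((p.2 : ℝ) ^ d * Real.exp (-(p.2 : ℝ) ^ 2))
          ∂((volume : Measure (Ambient q)).toSphere.prod (.volumeIoiPow q)) := by
        have := (volume : Measure (Ambient q)).measurePreserving_homeomorphUnitSphereProd.integral_comp
          (Homeomorph.measurableEmbedding _)
          (fun p : Sphere q × Set.Ioi (0 : ℝ) =>
            h p.1 * ((p.2 : ℝ) ^ d * Real.exp (-(p.2 : ℝ) ^ 2)))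
        rw [hd] at this
        rw [← this]
        congr 1
        funext z
        have hz : (0 : ℝ) < ‖(z : Ambient q)‖ := norm_pos_iff.2 z.2
        simp only [homeomorphUnitSphereProd_apply_snd_coe, homeomorphUnitSphereProd_apply_fst_coe]
        rw [hh _ _ (inv_pos.2 hz)]
        have : (‖(z : Ambient q)‖⁻¹) ^ d * ‖(z : Ambient q)‖ ^ d = 1 := by
          rw [← mul_pow, inv_mul_cancel₀ hz.ne', one_pow]
        linear_combination (-h z * Real.exp (-‖(z : Ambient q)‖ ^ 2)) * this
    _ = (∫ y : Sphere q, h y ∂(surface q)) *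
          ∫ r : Set.Ioi (0 : ℝ), ((r : ℝ) ^ d * Real.exp (-(r : ℝ) ^ 2))
            ∂(.volumeIoiPow q) :=
        integral_prod_mul (fun y : Sphere q => h y)
          (fun r : Set.Ioi (0 : ℝ) => (r : ℝ) ^ d * Real.exp (-(r : ℝ) ^ 2))
    _ = _ := by
        congr 1
        simp only [Measure.volumeIoiPow, ENNReal.ofReal]
        rw [integral_withDensity_eq_integral_smul,
          integral_subtype_comap measurableSet_Ioi
            fun a : ℝ => Real.toNNReal (a ^ q) • (a ^ d * Real.exp (-a ^ 2)),
          setIntegral_congr_fun (g := fun x : ℝ => x ^ ((d : ℝ) + q) * Real.exp (-x ^ (2 : ℝ)))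
            measurableSet_Ioi fun x hx => ?_]
        · rw [integral_rpow_mul_exp_neg_rpow (by norm_num) (by positivity |> lt_of_lt_of_le (by norm_num : (-1 : ℝ) < 0))]
          ring
        · have hx : 0 < x := hx
          simp only [NNReal.smul_def, Real.coe_toNNReal _ (pow_nonneg hx.le _), smul_eq_mul]
          rw [Real.rpow_add hx, Real.rpow_natCast, Real.rpow_natCast, Real.rpow_two]
          ring
        · exact (measurable_subtype_coe.pow_const _).real_toNNReal

/-- The orthonormal pair extends to an orthonormal basis; in these coordinates the
rotation-invariant Gaussian factors into q + 2 one-dimensional integrals, q of them without a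
monomial. -/
lemma integral_gaussian_two_directions (q : ℕ) (x v : Ambient (q + 1)) (hx : ‖x‖ = 1)
    (hv : ‖v‖ = 1) (hxv : inner ℝ x v = 0) (a b : ℕ) :
    ∫ z : Ambient (q + 1), (inner ℝ x z ^ a * inner ℝ v z ^ b) * Real.exp (-‖z‖ ^ 2) =
      (∫ t : ℝ, t ^ a * Real.exp (-t ^ 2)) * (∫ t : ℝ, t ^ b * Real.exp (-t ^ 2)) *
        (∫ t : ℝ, Real.exp (-t ^ 2)) ^ q := by
  have hv' : inner ℝ v x = 0 := by rw [real_inner_comm]; exact hxv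
  obtain ⟨B, hB⟩ : ∃ B : OrthonormalBasis (Fin (q + 2)) ℝ (Ambient (q + 1)), B 0 = x ∧ B 1 = v := by
    have h01 : (0 : Fin (q + 2)) ≠ 1 := by simp
    obtain ⟨B, hB⟩ := Orthonormal.exists_orthonormalBasis_extension_of_card_eq (𝕜 := ℝ)
      (E := Ambient (q + 1)) (ι := Fin (q + 2)) (by simp)
      (v := fun i => if i = 0 then x else v) (s := {0, 1}) (by
        rw [orthonormal_iff_ite]
        rintro ⟨i, hi⟩ ⟨j, hj⟩
        simp only [Set.mem_insert_iff, Set.mem_singleton_iff] at hi hj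
        rcases hi with rfl | rfl <;> rcases hj with rfl | rfl <;>
          simp [hx, hv, hxv, hv'])
    exact ⟨B, by simpa using hB 0 (by simp), by simpa using hB 1 (by simp)⟩
  obtain ⟨rfl, rfl⟩ := hB
  let f : Fin (q + 2) → ℝ → ℝ := Fin.cons (fun t => t ^ a * Real.exp (-t ^ 2))
    (Fin.cons (fun t => t ^ b * Real.exp (-t ^ 2)) fun _ t => Real.exp (-t ^ 2))
  have h1 := B.measurePreserving_repr.integral_comp
    B.repr.toHomeomorph.measurableEmbedding
    (fun w : EuclideanSpace ℝ (Fin (q + 2)) => (w 0 ^ a * w 1 ^ b) * Real.exp (-‖w‖ ^ 2))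
  simp only [OrthonormalBasis.repr_apply_apply, LinearIsometryEquiv.norm_map] at h1
  rw [h1]
  have h2 := (PiLp.volume_preserving_toLp (Fin (q + 2))).integral_comp
    (MeasurableEquiv.toLp 2 (Fin (q + 2) → ℝ)).measurableEmbedding
    (fun w : EuclideanSpace ℝ (Fin (q + 2)) => (w 0 ^ a * w 1 ^ b) * Real.exp (-‖w‖ ^ 2))
  rw [← h2]
  have h3 := integral_fintype_prod_volume_eq_prod f
  rw [Fin.prod_univ_succ, Fin.prod_univ_succ] at h3
  simp only [f, Fin.cons_zero, Fin.cons_succ, Finset.prod_const, Finset.card_univ,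
    Fintype.card_fin] at h3
  rw [mul_assoc, ← h3]
  congr 1
  funext w
  rw [Fin.prod_univ_succ, Fin.prod_univ_succ]
  simp only [f, Fin.cons_zero, Fin.cons_succ, EuclideanSpace.norm_sq_eq, Real.norm_eq_abs, sq_abs]
  rw [← Real.exp_sum, Fin.sum_univ_succ, Fin.sum_univ_succ, neg_add, neg_add, Real.exp_add,
    Real.exp_add, Finset.sum_neg_distrib]
  simp only [Fin.succ_zero_eq_one]
  ring

/-- The normalised moments of a coordinate of a uniform point of the sphere orthogonal to a
given direction. -/
def slice (q j : ℕ) : ℝ :=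
  Real.Gamma ((j : ℝ) + 1 / 2) * Real.Gamma ((q : ℝ) / 2) /
    (Real.Gamma (1 / 2) * Real.Gamma ((j : ℝ) + (q : ℝ) / 2))

lemma slice_zero (q : ℕ) (hq : 1 ≤ q) : slice q 0 = 1 := by
  have : (1 : ℝ) ≤ q := by exact_mod_cast hq
  have h1 := (Real.Gamma_pos_of_pos (show (0 : ℝ) < q / 2 by positivity)).ne'
  have h2 := (Real.Gamma_pos_of_pos (show (0 : ℝ) < 1 / 2 by norm_num)).ne'
  simp only [slice, Nat.cast_zero, zero_add]
  field_simp

lemma sphere_moment_aux (q : ℕ) (x v : Ambient (q + 1)) (hx : ‖x‖ = 1)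
    (hv : ‖v‖ = 1) (hxv : inner ℝ x v = 0) (a b : ℕ) :
    (∫ y : Sphere (q + 1), inner ℝ x (y : Ambient (q + 1)) ^ a * inner ℝ v (y : Ambient (q + 1)) ^ b
      ∂(surface (q + 1))) * (Real.Gamma (((a + b : ℕ) + (q + 1 : ℕ) + 1) / 2) / 2) =
      (∫ t : ℝ, t ^ a * Real.exp (-t ^ 2)) * (∫ t : ℝ, t ^ b * Real.exp (-t ^ 2)) *
        (∫ t : ℝ, Real.exp (-t ^ 2)) ^ q := by
  rw [← integral_gaussian_two_directions q x v hx hv hxv a b,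
    integral_homogeneous_mul_exp (q + 1) (a + b)
      (fun z => inner ℝ x z ^ a * inner ℝ v z ^ b)]
  intro r z hr
  simp only [inner_smul_right]
  ring

lemma area_pos (q : ℕ) : 0 < area q := by
  unfold area
  have := Real.Gamma_pos_of_pos (show (0 : ℝ) < ((q : ℝ) + 1) / 2 by positivity)
  positivity

/-- Mixed moments of the sphere in two orthogonal directions. -/
lemma sphere_moment (q : ℕ) [hq : Fact (1 ≤ q)] (x v : Sphere q) (hxv : dot x v = 0) (a b : ℕ) :
    ∫ y : Sphere q, dot x y ^ a * dot v y ^ b ∂(surface q) =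
      if Even b then area (q - 1) * slice q (b / 2) * wInt q (X ^ a * (1 - X ^ 2) ^ (b / 2))
      else 0 := by
  have hq1 := hq.out
  obtain ⟨r, rfl⟩ : ∃ r, q = r + 1 := ⟨q - 1, by omega⟩
  have hx : ‖(x : Ambient (r + 1))‖ = 1 := by simpa using x.2
  have hv : ‖(v : Ambient (r + 1))‖ = 1 := by simpa using v.2
  have h := sphere_moment_aux r x v hx hv hxv a b
  have hG : 0 < Real.Gamma (((a + b : ℕ) + (r + 1 : ℕ) + 1 : ℝ) / 2) :=
    Real.Gamma_pos_of_pos (by positivity)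
  simp only [dot] at h ⊢
  rcases Nat.even_or_odd b with hb | hb
  · rw [if_pos hb]
    rcases Nat.even_or_odd a with ha | ha
    · rw [wInt_monomial_even _ _ _ ha]
      rw [integral_pow_mul_exp_even a ha, integral_pow_mul_exp_even b hb] at h
      have h0 := integral_pow_mul_exp_even 0 (by simp)
      simp only [pow_zero, one_mul, Nat.cast_zero, zero_add, Real.Gamma_one_half_eq] at h0
      rw [h0] at h
      obtain ⟨c, rfl⟩ := hb
      have e1 : (c + c) / 2 = c := by omega
      rw [e1]
      refine mul_right_cancel₀ (b := Real.Gamma (((a + (c + c) : ℕ) + (r + 1 : ℕ) + 1 : ℝ) / 2) / 2)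
        (by positivity) (h.trans ?_)
      simp only [slice, betaMoment, beta, area, Nat.add_sub_cancel, Real.Gamma_one_half_eq]
      have g1 : 0 < Real.Gamma ((c : ℝ) + ((r + 1 : ℕ) : ℝ) / 2) :=
        Real.Gamma_pos_of_pos (by positivity)
      have g2 : 0 < Real.Gamma (((r + 1 : ℕ) : ℝ) / 2) := Real.Gamma_pos_of_pos (by positivity)
      have e2 : ((c + c : ℕ) + 1 : ℝ) / 2 = c + 1 / 2 := by push_cast; ring
      have e3 : ((a : ℝ) + 1) / 2 + (c + ((r + 1 : ℕ) : ℝ) / 2)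
        = ((a + (c + c) : ℕ) + (r + 1 : ℕ) + 1 : ℝ) / 2 := by push_cast; ring
      have e4 : ((r : ℝ) + 1) / 2 = ((r + 1 : ℕ) : ℝ) / 2 := by push_cast; ring
      have e5 : Real.pi ^ (((r + 1 : ℕ) : ℝ) / 2) = √Real.pi ^ r * √Real.pi := by
        rw [← pow_succ, Real.sqrt_eq_rpow, ← Real.rpow_natCast, ← Real.rpow_mul Real.pi_pos.le]
        congr 1; push_cast; ring
      rw [e2, e3, e4, e5]
      have : 0 < √Real.pi := by positivity
      field_simp
    · rw [wInt_monomial_odd _ _ _ ha, mul_zero]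
      rw [integral_pow_mul_exp_odd a ha, zero_mul, zero_mul] at h
      exact (mul_eq_zero.1 h).resolve_right (by positivity)
  · rw [if_neg (Nat.not_even_iff_odd.2 hb)]
    rw [integral_pow_mul_exp_odd b hb, mul_zero, zero_mul] at h
    exact (mul_eq_zero.1 h).resolve_right (by positivity)

/-- Pearson's equation for the weight `(1-x²)^(q/2-1)`. -/
lemma wInt_pearson (q : ℕ) [hq : Fact (1 ≤ q)] (p : ℝ[X]) :
    wInt q ((1 - X ^ 2) * derivative p) = q * wInt q (X * p) := by
  have hq1 : (1 : ℝ) ≤ q := by exact_mod_cast hq.out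
  induction p using Polynomial.induction_on' with
  | add p r hp hr => simp only [mul_add, map_add, hp, hr]
  | monomial n c =>
    have key : wInt q ((1 - X ^ 2) * derivative (X ^ n)) = q * wInt q (X * X ^ n) := by
      rw [← pow_succ']
      have e : (X : ℝ[X]) ^ (n + 1) = X ^ (n + 1) * (1 - X ^ 2) ^ 0 := by simp
      rw [e]
      cases n with
      | zero => rw [wInt_monomial_odd _ _ _ (by simp)]; simp
      | succ c =>
        have e2 : (1 - X ^ 2) * derivative (X ^ (c + 1)) =
            ((c : ℝ) + 1) • (X ^ c * (1 - X ^ 2) ^ 1 : ℝ[X]) := by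
          rw [derivative_X_pow, smul_eq_C_mul]; simp; ring
        rw [e2, map_smul, smul_eq_mul]
        rcases Nat.even_or_odd c with hc | hc
        · rw [wInt_monomial_even _ _ _ hc, wInt_monomial_even _ _ _ (by
            rw [add_assoc]; exact hc.add (by decide))]
          simp only [betaMoment, beta]
          have e3 : ((c + 1 + 1 : ℕ) + 1 : ℝ) / 2 = ((c : ℝ) + 1) / 2 + 1 := by push_cast; ring
          have e4 : ((1 : ℕ) : ℝ) + (q : ℝ) / 2 = q / 2 + 1 := by push_cast; ring
          have e5 : ((0 : ℕ) : ℝ) + (q : ℝ) / 2 = q / 2 := by push_cast; ring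
          rw [e3, e4, e5, Real.Gamma_add_one (by positivity), Real.Gamma_add_one (by positivity)]
          rw [show ((c : ℝ) + 1) / 2 + (q / 2 + 1) = ((c : ℝ) + 1) / 2 + 1 + q / 2 by ring]
          ring
        · rw [wInt_monomial_odd _ _ _ hc, wInt_monomial_odd _ _ _ (by
            rw [add_assoc]; exact hc.add_even (by decide))]
          simp
    rw [← C_mul_X_pow_eq_monomial, derivative_C_mul, mul_left_comm, ← smul_eq_C_mul, map_smul, key,
      mul_left_comm X, ← smul_eq_C_mul, map_smul]
    simp only [smul_eq_mul]; ring

/-! ### Gegenbauer polynomials and integrals of their triple products -/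

section Gegenbauer

variable (a : ℝ)

/-- The value at `k - 1`, and `0` at `k = 0`. -/
def shiftDown {M : Type*} [Zero M] (f : ℕ → M) : ℕ → M
  | 0 => 0
  | k + 1 => f k

lemma gegenbauer_add_two (k : ℕ) :
    C ((k : ℝ) + 2) * gegenbauer a (k + 2) =
      C (2 * ((k : ℝ) + 1 + a)) * X * gegenbauer a (k + 1) - C ((k : ℝ) + 2 * a) * gegenbauer a k := by
  have hk : (k : ℝ) + 2 ≠ 0 := by positivity
  simp only [gegenbauer]
  rw [mul_sub, ← mul_assoc, ← mul_assoc, ← mul_assoc, ← C_mul, ← C_mul, mul_div_cancel₀ _ hk,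
    mul_div_cancel₀ _ hk]

lemma X_mul_gegenbauer (k : ℕ) :
    C (2 * ((k : ℝ) + a)) * (X * gegenbauer a k) =
      C ((k : ℝ) + 1) * gegenbauer a (k + 1) +
        C ((k : ℝ) + 2 * a - 1) * shiftDown (gegenbauer a) k := by
  cases k with
  | zero => simp [gegenbauer, shiftDown]
  | succ k =>
    have h := gegenbauer_add_two a k
    simp only [shiftDown]
    push_cast
    rw [show ((k : ℝ) + 1 + 1) = k + 2 by ring, h, show (k : ℝ) + 1 + 2 * a - 1 = k + 2 * a by ring]
    ring

/-- Differentiating the three-term recurrence propagates this relation by two-step induction. It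
turns Pearson's equation into a relation between the integrals of neighbouring Gegenbauer
polynomials. -/
lemma derivative_gegenbauer (k : ℕ) :
    (1 - X ^ 2) * derivative (gegenbauer a k) =
      - C (k : ℝ) * (X * gegenbauer a k) +
        C ((k : ℝ) + 2 * a - 1) * shiftDown (gegenbauer a) k := by
  induction k using Nat.twoStepInduction with
  | zero => simp [gegenbauer, shiftDown]
  | one => simp [gegenbauer, shiftDown]; ring
  | more k h0 h1 =>
    have r1 := gegenbauer_add_two a k
    have r0 := X_mul_gegenbauer a k
    have d1 := congrArg derivative r1
    simp only [derivative_sub, derivative_mul, derivative_C, derivative_X, zero_mul, zero_add,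
      mul_one] at d1
    have hk : (C ((k : ℝ) + 2) : ℝ[X]) ≠ 0 := by rw [Ne, C_eq_zero]; positivity
    refine mul_left_cancel₀ hk ?_
    simp only [shiftDown] at *
    push_cast at *
    generalize shiftDown (gegenbauer a) k = U at *
    generalize gegenbauer a (k + 2) = K at *
    generalize gegenbauer a (k + 1) = H at *
    generalize gegenbauer a k = G at *
    simp only [C_add, C_mul, C_sub, C_1] at *
    rw [show (C 2 : ℝ[X]) = 2 from rfl] at *
    generalize (C (k : ℝ) : ℝ[X]) = c at *
    generalize (C a : ℝ[X]) = b at *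
    linear_combination (1 - X ^ 2) * d1 + 2 * (c + 1 + b) * X * h1 - (c + 2 * b) * h0
      + (c + 2) * X * r1 + (c + 2 * b) * r0

lemma natDegree_gegenbauer_le (k : ℕ) : (gegenbauer a k).natDegree ≤ k := by
  induction k using Nat.twoStepInduction with
  | zero => simp [gegenbauer]
  | one => exact (natDegree_C_mul_le _ _).trans (by simp)
  | more k h0 h1 =>
    simp only [gegenbauer]
    refine (natDegree_sub_le _ _).trans (max_le ?_ ((natDegree_C_mul_le _ _).trans (by omega)))
    refine natDegree_mul_le.trans ?_
    have := (natDegree_C_mul_le (2 * ((k : ℝ) + 1 + a) / ((k : ℝ) + 2)) (X : ℝ[X]))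
    simp only [natDegree_X] at this
    omega

/-- The Pochhammer symbol `(a)_n`. -/
def poch (a : ℝ) (n : ℕ) : ℝ := (ascPochhammer ℝ n).eval a

@[simp] lemma poch_zero : poch a 0 = 1 := by simp [poch]

lemma poch_succ (n : ℕ) : poch a (n + 1) = poch a n * (a + n) := ascPochhammer_succ_eval n a

lemma poch_pos {a : ℝ} (ha : 0 < a) (n : ℕ) : 0 < poch a n := ascPochhammer_pos n a ha

lemma gegenbauer_eval_one (k : ℕ) : (gegenbauer a k).eval 1 = poch (2 * a) k / k.factorial := by
  induction k using Nat.twoStepInduction with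
  | zero => simp [gegenbauer]
  | one => simp [gegenbauer, poch_succ]
  | more k h0 h1 =>
    have h := congrArg (eval 1) (gegenbauer_add_two a k)
    simp only [eval_mul, eval_sub, eval_C, eval_X, h0, h1, poch_succ, Nat.factorial_succ,
      mul_one] at h ⊢
    have hk : (k : ℝ) + 2 ≠ 0 := by positivity
    have hf : (k.factorial : ℝ) ≠ 0 := by positivity
    have hk1 : (k : ℝ) + 1 ≠ 0 := by positivity
    rw [← mul_right_inj' hk, h]
    push_cast
    rw [show (k : ℝ) + 1 + 1 = k + 2 by ring]
    field_simp
    ring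

/-- `(a)_i / i!`, extended by zero to negative `i`. -/
def pochRatio (i : ℤ) : ℝ := if i < 0 then 0 else poch a i.toNat / i.toNat.factorial

lemma pochRatio_natCast (i : ℕ) : pochRatio a i = poch a i / i.factorial := by
  simp [pochRatio]

lemma pochRatio_of_neg {i : ℤ} (hi : i < 0) : pochRatio a i = 0 := if_pos hi

/-- The extension by zero keeps this relation valid for every integer: at i = -1 the left factor
vanishes together with the right side. Recurrences for `tripleValue` then need no boundary
conditions on the indices. -/
lemma pochRatio_succ (i : ℤ) : ((i : ℝ) + 1) * pochRatio a (i + 1) = (a + i) * pochRatio a i := by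
  rcases lt_trichotomy i (-1) with h | rfl | h
  · rw [pochRatio_of_neg a (by omega), pochRatio_of_neg a (by omega)]; simp
  · rw [pochRatio_of_neg a (show (-1 : ℤ) < 0 by omega)]; simp
  · obtain ⟨n, rfl⟩ := Int.eq_ofNat_of_zero_le (show 0 ≤ i by omega)
    have : ((n : ℤ) + 1) = ((n + 1 : ℕ) : ℤ) := by simp
    rw [this, pochRatio_natCast, pochRatio_natCast, poch_succ, Nat.factorial_succ]
    push_cast
    have hf : (n.factorial : ℝ) ≠ 0 := by positivity
    field_simp

/-- `(2a)_s / (a)_{s+1}`. -/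
def pochQuot (s : ℕ) : ℝ := poch (2 * a) s / poch a (s + 1)

lemma pochQuot_succ {a : ℝ} (ha : 0 < a) (s : ℕ) :
    (a + s + 1) * pochQuot a (s + 1) = (2 * a + s) * pochQuot a s := by
  have h1 := poch_pos ha (s + 1)
  simp only [pochQuot, poch_succ a (s + 1), poch_succ (2 * a) s]
  push_cast
  have : a + (s + 1) ≠ 0 := by positivity
  field_simp
  ring

/-- The normalised integral of a product of three Gegenbauer polynomials. -/
def tripleValue (m n k : ℤ) : ℝ :=
  if Even (m + n + k) then
    a * pochQuot a ((m + n + k) / 2).toNat * pochRatio a ((m + n + k) / 2 - m) *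
      pochRatio a ((m + n + k) / 2 - n) * pochRatio a ((m + n + k) / 2 - k)
  else 0

lemma tripleValue_of_sum (s m n k : ℤ) (h : m + n + k = 2 * s) :
    tripleValue a m n k =
      a * pochQuot a s.toNat * pochRatio a (s - m) * pochRatio a (s - n) * pochRatio a (s - k) := by
  have : (m + n + k) / 2 = s := by omega
  rw [tripleValue, if_pos (by rw [h]; simp), this]

lemma tripleValue_of_odd {m n k : ℤ} (h : ¬ Even (m + n + k)) : tripleValue a m n k = 0 := if_neg h

lemma tripleValue_swap (m n k : ℤ) : tripleValue a m n k = tripleValue a n m k := by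
  simp only [tripleValue, add_comm m n]
  split_ifs <;> ring

/-- If n + k - 1 = 2s, then s - n and s - k add up to -1, so one of them is negative and its ratio
vanishes. This agrees with the convention of `shiftDown` at index 0. -/
lemma tripleValue_neg_one_left (n k : ℕ) : tripleValue a (-1) n k = 0 := by
  by_cases h : Even ((-1 : ℤ) + n + k)
  · obtain ⟨s, hs⟩ := h
    rw [tripleValue_of_sum a s _ _ _ (by omega)]
    rcases lt_or_ge (s - n) 0 with h1 | h1
    · rw [pochRatio_of_neg a h1]; ring
    · rw [pochRatio_of_neg a (show s - k < 0 by omega)]; ring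
  · exact tripleValue_of_odd a h

lemma tripleValue_neg_one_right (m n : ℕ) : tripleValue a m n (-1) = 0 := by
  by_cases h : Even ((m : ℤ) + n + (-1))
  · obtain ⟨s, hs⟩ := h
    rw [tripleValue_of_sum a s _ _ _ (by omega)]
    rcases lt_or_ge (s - n) 0 with h1 | h1
    · rw [pochRatio_of_neg a h1]; ring
    · rw [pochRatio_of_neg a (show s - m < 0 by omega)]; ring
  · exact tripleValue_of_odd a h

/-- This is the relation that the integral of x C_m C_n C_k forces when x is absorbed into C_m or
into C_k. With 2t + 1 = m + n + k, everything becomes a rational identity in A = t - m, B = t - n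
and D = t - k. -/
lemma tripleValue_recurrence {a : ℝ} (ha : 0 < a) (m n k : ℕ) :
    ((k : ℝ) + a) * (((m : ℝ) + 1) * tripleValue a (m + 1) n k +
        ((m : ℝ) + 2 * a - 1) * tripleValue a (m - 1) n k) =
      ((m : ℝ) + a) * (((k : ℝ) + 1) * tripleValue a m n (k + 1) +
        ((k : ℝ) + 2 * a - 1) * tripleValue a m n (k - 1)) := by
  by_cases h : Even ((m : ℤ) + n + k + 1)
  · obtain ⟨s, hs⟩ := h
    obtain ⟨t, rfl⟩ : ∃ t : ℕ, s = t + 1 := ⟨(s - 1).toNat, by omega⟩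
    rw [tripleValue_of_sum a (t + 1) (m + 1) n k (by omega),
      tripleValue_of_sum a t (m - 1) n k (by omega),
      tripleValue_of_sum a (t + 1) m n (k + 1) (by omega),
      tripleValue_of_sum a t m n (k - 1) (by omega)]
    obtain ⟨A, hA⟩ : ∃ A : ℤ, A = t - m := ⟨_, rfl⟩
    obtain ⟨B, hB⟩ : ∃ B : ℤ, B = t - n := ⟨_, rfl⟩
    obtain ⟨D, hD⟩ : ∃ D : ℤ, D = t - k := ⟨_, rfl⟩
    rw [show (t : ℤ) + 1 - (m + 1) = A by omega, show (t : ℤ) + 1 - n = B + 1 by omega,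
      show (t : ℤ) + 1 - k = D + 1 by omega, show (t : ℤ) - (m - 1) = A + 1 by omega,
      show (t : ℤ) - n = B by omega, show (t : ℤ) - k = D by omega,
      show (t : ℤ) + 1 - m = A + 1 by omega, show (t : ℤ) + 1 - (k + 1) = D by omega,
      show (t : ℤ) - m = A by omega, show (t : ℤ) - (k - 1) = D + 1 by omega]
    have e1 : ((t : ℤ) + 1).toNat = t + 1 := by omega
    rw [e1, Int.toNat_natCast]
    have hW := pochQuot_succ ha t
    have uA := pochRatio_succ a A
    have uB := pochRatio_succ a B
    have uD := pochRatio_succ a D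
    have hm : (m : ℝ) = B + D + 1 := by
      have : (m : ℤ) = B + D + 1 := by omega
      exact_mod_cast this
    have hk : (k : ℝ) = A + B + 1 := by
      have : (k : ℤ) = A + B + 1 := by omega
      exact_mod_cast this
    have ht : (t : ℝ) = A + B + D + 1 := by
      have : (t : ℤ) = A + B + D + 1 := by omega
      exact_mod_cast this
    have ht' : a + t + 1 ≠ 0 := by positivity
    generalize pochQuot a (t + 1) = W' at *
    generalize pochQuot a t = W at *
    generalize hx' : pochRatio a (A + 1) = x' at *
    generalize hx : pochRatio a A = x at *
    generalize hy' : pochRatio a (B + 1) = y' at *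
    generalize hy : pochRatio a B = y at *
    generalize hz' : pochRatio a (D + 1) = z' at *
    generalize hz : pochRatio a D = z at *
    refine mul_left_cancel₀ ht' ?_
    -- What is left once W' and the products of two raised ratios are eliminated. The ratios x', y',
    -- z' are multiples of x, y, z except when A, D or B is -1; there the lower ratio is zero and
    -- the surviving terms cancel.
    have key : (a * W) * (x * y * z' * ((k + a) * (2 * a + t) * (a + B)
          - (m + a) * (k + 2 * a - 1) * (a + t + 1))
        + x * y' * z * ((2 * a + t) * ((k + a) * (a + D) - (m + a) * (a + A)))
        + x' * y * z * ((k + a) * (m + 2 * a - 1) * (a + t + 1)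
          - (m + a) * (2 * a + t) * (a + B))) = 0 := by
      by_cases hA1 : A = -1
      · have : x = 0 := by rw [← hx, hA1]; exact pochRatio_of_neg a (by omega)
        rw [this, hk, hm, ht, hA1]; push_cast; ring
      by_cases hD1 : D = -1
      · have : z = 0 := by rw [← hz, hD1]; exact pochRatio_of_neg a (by omega)
        rw [this, hk, hm, ht, hD1]; push_cast; ring
      by_cases hB1 : B = -1
      · have : y = 0 := by rw [← hy, hB1]; exact pochRatio_of_neg a (by omega)
        rw [this, hk, hm, ht, hB1]; push_cast; ring
      have hA2 : (A : ℝ) + 1 ≠ 0 := by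
        have : A + 1 ≠ 0 := by omega
        exact_mod_cast this
      have hB2 : (B : ℝ) + 1 ≠ 0 := by
        have : B + 1 ≠ 0 := by omega
        exact_mod_cast this
      have hD2 : (D : ℝ) + 1 ≠ 0 := by
        have : D + 1 ≠ 0 := by omega
        exact_mod_cast this
      have ex : x' = (a + A) * x / (A + 1) := by rw [eq_div_iff hA2]; linarith
      have ey : y' = (a + B) * y / (B + 1) := by rw [eq_div_iff hB2]; linarith
      have ez : z' = (a + D) * z / (D + 1) := by rw [eq_div_iff hD2]; linarith
      rw [ex, ey, ez, hk, hm, ht]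
      field_simp
      ring
    have em : (m : ℝ) + 1 = (B + 1) + (D + 1) := by linarith
    have ek : (k : ℝ) + 1 = (A + 1) + (B + 1) := by linarith
    rw [em, ek]
    linear_combination key + a * ((k + a) * (x * (y' * z' * ((B + 1) + (D + 1))))
      - (m + a) * (x' * y' * z * ((A + 1) + (B + 1)))) * hW
      + a * (2 * a + t) * W * ((k + a) * x * (z' * uB + y' * uD)
        - (m + a) * z * (y' * uA + x' * uB))
  · rw [tripleValue_of_odd a (by rw [Int.even_iff] at h ⊢; omega),
      tripleValue_of_odd a (by rw [Int.even_iff] at h ⊢; omega),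
      tripleValue_of_odd a (by rw [Int.even_iff] at h ⊢; omega),
      tripleValue_of_odd a (by rw [Int.even_iff] at h ⊢; omega)]
    ring

/-- A solution of the recurrence is determined by its values at `m = 0`. -/
lemma eq_of_recurrence {a : ℝ} (ha : 0 < a) {S T : ℕ → ℕ → ℝ}
    (hS : ∀ m k : ℕ, ((k : ℝ) + a) * (((m : ℝ) + 1) * S (m + 1) k +
        ((m : ℝ) + 2 * a - 1) * shiftDown (fun j => S j k) m) =
      ((m : ℝ) + a) * (((k : ℝ) + 1) * S m (k + 1) + ((k : ℝ) + 2 * a - 1) * shiftDown (S m) k))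
    (hT : ∀ m k : ℕ, ((k : ℝ) + a) * (((m : ℝ) + 1) * T (m + 1) k +
        ((m : ℝ) + 2 * a - 1) * shiftDown (fun j => T j k) m) =
      ((m : ℝ) + a) * (((k : ℝ) + 1) * T m (k + 1) + ((k : ℝ) + 2 * a - 1) * shiftDown (T m) k))
    (h0 : ∀ k, S 0 k = T 0 k) (m k : ℕ) : S m k = T m k := by
  induction m using Nat.strong_induction_on generalizing k with
  | _ m ih =>
    cases m with
    | zero => exact h0 k
    | succ m =>
      have hm : S m = T m := funext (ih m (by omega))
      have hd : shiftDown (fun j => S j k) m = shiftDown (fun j => T j k) m := by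
        cases m with
        | zero => rfl
        | succ m => exact ih m (by omega) k
      have h := hS m k
      rw [hm, hd, ← hT m k] at h
      have hk : (k : ℝ) + a ≠ 0 := by positivity
      have hm1 : (m : ℝ) + 1 ≠ 0 := by positivity
      exact mul_left_cancel₀ hm1 (add_right_cancel (mul_left_cancel₀ hk h))

lemma tripleValue_shiftDown_recurrence {a : ℝ} (ha : 0 < a) (n m k : ℕ) :
    ((k : ℝ) + a) * (((m : ℝ) + 1) * tripleValue a (m + 1 : ℕ) n k +
        ((m : ℝ) + 2 * a - 1) * shiftDown (fun j : ℕ => tripleValue a j n k) m) =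
      ((m : ℝ) + a) * (((k : ℝ) + 1) * tripleValue a m n (k + 1 : ℕ) +
        ((k : ℝ) + 2 * a - 1) * shiftDown (fun j : ℕ => tripleValue a m n j) k) := by
  have h := tripleValue_recurrence ha m n k
  have e1 : shiftDown (fun j : ℕ => tripleValue a j n k) m = tripleValue a (m - 1) n k := by
    cases m with
    | zero => simpa [shiftDown] using (tripleValue_neg_one_left a n k).symm
    | succ m => simp [shiftDown]
  have e2 : shiftDown (fun j : ℕ => tripleValue a m n j) k = tripleValue a m n (k - 1) := by
    cases k with
    | zero => simpa [shiftDown] using (tripleValue_neg_one_right a m n).symm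
    | succ m => simp [shiftDown]
  rw [e1, e2]
  exact_mod_cast h

/-- Both sides equal the value of V at 2(m+a)(k+a) x C_m r C_k, the factor x being absorbed into C_m
on the left and into C_k on the right. -/
lemma gegenbauer_functional_recurrence (V : ℝ[X] →ₗ[ℝ] ℝ) (r : ℝ[X]) (m k : ℕ) :
    ((k : ℝ) + a) * (((m : ℝ) + 1) * V (gegenbauer a (m + 1) * r * gegenbauer a k) +
        ((m : ℝ) + 2 * a - 1) *
          shiftDown (fun j => V (gegenbauer a j * r * gegenbauer a k)) m) =
      ((m : ℝ) + a) * (((k : ℝ) + 1) * V (gegenbauer a m * r * gegenbauer a (k + 1)) +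
        ((k : ℝ) + 2 * a - 1) *
          shiftDown (fun j => V (gegenbauer a m * r * gegenbauer a j)) k) := by
  have h1 := X_mul_gegenbauer a m
  have h2 := X_mul_gegenbauer a k
  have e1 : shiftDown (fun j => V (gegenbauer a j * r * gegenbauer a k)) m =
      V (shiftDown (gegenbauer a) m * r * gegenbauer a k) := by
    cases m <;> simp [shiftDown]
  have e2 : shiftDown (fun j => V (gegenbauer a m * r * gegenbauer a j)) k =
      V (gegenbauer a m * r * shiftDown (gegenbauer a) k) := by
    cases k <;> simp [shiftDown]
  rw [e1, e2]
  simp only [← smul_eq_mul (a := (_ : ℝ)), ← map_smul, ← map_add]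
  congr 1
  simp only [smul_eq_C_mul]
  generalize shiftDown (gegenbauer a) m = Um at *
  generalize shiftDown (gegenbauer a) k = Uk at *
  have e3 : (C (2 * ((m : ℝ) + a)) : ℝ[X]) = 2 * C ((m : ℝ) + a) := by rw [C_mul]; rfl
  have e4 : (C (2 * ((k : ℝ) + a)) : ℝ[X]) = 2 * C ((k : ℝ) + a) := by rw [C_mul]; rfl
  rw [e3] at h1
  rw [e4] at h2
  linear_combination (-C ((k : ℝ) + a) * r * gegenbauer a k) * h1
    + (C ((m : ℝ) + a) * r * gegenbauer a m) * h2

/-- A functional satisfying Pearson's equation annihilates the nonconstant Gegenbauer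
polynomials. -/
lemma gegenbauer_functional_succ {a : ℝ} (ha : 0 < a) (V : ℝ[X] →ₗ[ℝ] ℝ)
    (hV : ∀ p, V ((1 - X ^ 2) * derivative p) = (2 * a + 1) * V (X * p)) (k : ℕ) :
    V (gegenbauer a (k + 1)) = 0 := by
  -- Pearson's equation at C_k and the three-term recurrence, with V(x C_k) eliminated. At k = 1 the
  -- factor k - 1 removes V(C_0), so odd and even indices both start from zero.
  have step : ∀ k : ℕ, ((k : ℝ) + 2 * a + 1) * ((k : ℝ) + 1) * V (gegenbauer a (k + 1)) =
      ((k : ℝ) + 2 * a - 1) * ((k : ℝ) - 1) * V (shiftDown (gegenbauer a) k) := by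
    intro k
    have h1 := hV (gegenbauer a k)
    have h2 := congrArg V (X_mul_gegenbauer a k)
    rw [derivative_gegenbauer, neg_mul] at h1
    simp only [← smul_eq_C_mul] at h1 h2
    simp only [map_add, map_neg, map_smul, smul_eq_mul] at h1 h2
    linear_combination (-2 * ((k : ℝ) + a)) * h1 - ((k : ℝ) + 2 * a + 1) * h2
  induction k using Nat.twoStepInduction with
  | zero =>
    have h := step 0
    simp only [shiftDown, map_zero, mul_zero] at h
    refine (mul_eq_zero.1 h).resolve_left ?_
    positivity
  | one =>
    have h := step 1
    simp only [Nat.cast_one, sub_self, mul_zero, zero_mul] at h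
    refine (mul_eq_zero.1 h).resolve_left ?_
    positivity
  | more k h0 _ =>
    have h := step (k + 2)
    simp only [shiftDown, h0, mul_zero] at h
    refine (mul_eq_zero.1 h).resolve_left ?_
    positivity

lemma tripleValue_zero_zero {a : ℝ} (ha : 0 < a) (k : ℕ) :
    tripleValue a 0 0 k = if k = 0 then 1 else 0 := by
  by_cases hk : k = 0
  · subst hk
    rw [tripleValue_of_sum a 0 _ _ _ (by simp)]
    have := pochRatio_natCast a 0
    simp at this
    simp [this, pochQuot, poch_succ, ha.ne']
  · rw [if_neg hk]
    by_cases h : Even ((0 : ℤ) + 0 + k)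
    · obtain ⟨s, hs⟩ := h
      rw [tripleValue_of_sum a s _ _ _ (by omega), pochRatio_of_neg a (show s - k < 0 by omega),
        mul_zero]
    · exact tripleValue_of_odd a h

/-- The integrals of products of three Gegenbauer polynomials. -/
theorem gegenbauer_functional_triple {a : ℝ} (ha : 0 < a) (V : ℝ[X] →ₗ[ℝ] ℝ)
    (hV : ∀ p, V ((1 - X ^ 2) * derivative p) = (2 * a + 1) * V (X * p)) (m n k : ℕ) :
    V (gegenbauer a m * gegenbauer a n * gegenbauer a k) = V 1 * tripleValue a m n k := by
  -- For fixed n, the values at m = 0 decide everything. They are first known for n = 0, where they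
  -- are the integrals of single polynomials; exchanging m and n then supplies them for every n.
  have from_zero : ∀ n : ℕ, (∀ k, V (gegenbauer a 0 * gegenbauer a n * gegenbauer a k) =
      V 1 * tripleValue a (0 : ℕ) n k) → ∀ m k,
      V (gegenbauer a m * gegenbauer a n * gegenbauer a k) = V 1 * tripleValue a m n k := by
    intro n h0
    refine eq_of_recurrence ha (fun m k => gegenbauer_functional_recurrence a V _ m k) ?_ h0
    intro m k
    have h := tripleValue_shiftDown_recurrence ha n m k
    have e1 : shiftDown (fun j : ℕ => V 1 * tripleValue a j n k) m =
        V 1 * shiftDown (fun j : ℕ => tripleValue a j n k) m := by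
      cases m <;> simp [shiftDown]
    have e2 : shiftDown (fun j : ℕ => V 1 * tripleValue a m n j) k =
        V 1 * shiftDown (fun j : ℕ => tripleValue a m n j) k := by
      cases k <;> simp [shiftDown]
    rw [e1, e2]
    linear_combination V 1 * h
  have base : ∀ m k, V (gegenbauer a m * gegenbauer a 0 * gegenbauer a k) =
      V 1 * tripleValue a m (0 : ℕ) k := by
    refine from_zero 0 fun k => ?_
    have := tripleValue_zero_zero ha k
    push_cast
    rw [this]
    cases k with
    | zero => simp [gegenbauer]
    | succ k => simpa [gegenbauer] using gegenbauer_functional_succ ha V hV k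
  refine from_zero n (fun k => ?_) m k
  rw [tripleValue_swap, ← base n k]
  congr 1
  ring

end Gegenbauer

/-! ### The orthogonal basis for all q -/

lemma basisPoly_one (k : ℕ) : basisPoly 1 k = Chebyshev.T ℝ k := by simp [basisPoly]

lemma basisPoly_of_ne {q : ℕ} (hq : q ≠ 1) (k : ℕ) :
    basisPoly q k = gegenbauer (((q : ℝ) - 1) / 2) k := by simp [basisPoly, hq]

lemma basisPoly_zero (q : ℕ) : basisPoly q 0 = 1 := by
  by_cases hq : q = 1
  · subst hq; simp [basisPoly_one]
  · simp [basisPoly_of_ne hq, gegenbauer]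

lemma natDegree_basisPoly_le (q k : ℕ) : (basisPoly q k).natDegree ≤ k := by
  by_cases hq : q = 1
  · subst hq
    rw [basisPoly_one]
    exact natDegree_le_iff_degree_le.2 (by simp)
  · rw [basisPoly_of_ne hq]; exact natDegree_gegenbauer_le _ k

lemma half_pos_of_ne {q : ℕ} [h : Fact (1 ≤ q)] (hq : q ≠ 1) : 0 < ((q : ℝ) - 1) / 2 := by
  have : 2 ≤ q := by have := h.out; omega
  have : (2 : ℝ) ≤ q := by exact_mod_cast this
  linarith

lemma X_mul_basisPoly (q : ℕ) [Fact (1 ≤ q)] (k : ℕ) :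
    ∃ α β : ℝ, X * basisPoly q k = C α * basisPoly q (k + 1) + C β * shiftDown (basisPoly q) k := by
  by_cases hq : q = 1
  · subst hq
    cases k with
    | zero => exact ⟨1, 0, by simp [basisPoly_one]⟩
    | succ k =>
      refine ⟨1 / 2, 1 / 2, ?_⟩
      simp only [basisPoly_one, shiftDown]
      have h := Chebyshev.T_add_two ℝ k
      have e : (C (1 / 2) : ℝ[X]) * 2 = 1 := by
        rw [show (2 : ℝ[X]) = C 2 from rfl, ← C_mul]; norm_num
      push_cast
      rw [show (k : ℤ) + 1 + 1 = k + 2 by ring, h]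
      linear_combination (-(X * Chebyshev.T ℝ (k + 1))) * e
  · have ha := half_pos_of_ne hq
    have hk : 2 * ((k : ℝ) + ((q : ℝ) - 1) / 2) ≠ 0 := by positivity
    refine ⟨(2 * ((k : ℝ) + ((q : ℝ) - 1) / 2))⁻¹ * ((k : ℝ) + 1),
      (2 * ((k : ℝ) + ((q : ℝ) - 1) / 2))⁻¹ * ((k : ℝ) + 2 * (((q : ℝ) - 1) / 2) - 1), ?_⟩
    have h := X_mul_gegenbauer (((q : ℝ) - 1) / 2) k
    have e : basisPoly q = gegenbauer (((q : ℝ) - 1) / 2) := funext (basisPoly_of_ne hq)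
    rw [e, C_mul (b := (k : ℝ) + 1), C_mul (b := (k : ℝ) + 2 * (((q : ℝ) - 1) / 2) - 1), mul_assoc,
      mul_assoc, ← mul_add, ← h, ← mul_assoc, ← C_mul, inv_mul_cancel₀ hk, C_1, one_mul]

/-- The span of the first `N + 1` basis polynomials. -/
def basisSpan (q N : ℕ) : Submodule ℝ ℝ[X] := Submodule.span ℝ (basisPoly q '' Set.Iic N)

lemma basisPoly_mem_span (q : ℕ) {k N : ℕ} (h : k ≤ N) : basisPoly q k ∈ basisSpan q N :=
  Submodule.subset_span ⟨k, h, rfl⟩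

lemma X_pow_mem_basisSpan (q : ℕ) [Fact (1 ≤ q)] (i : ℕ) : (X : ℝ[X]) ^ i ∈ basisSpan q i := by
  induction i with
  | zero => rw [pow_zero, ← basisPoly_zero q]; exact basisPoly_mem_span q le_rfl
  | succ i ih =>
    rw [pow_succ']
    have : basisSpan q i ≤ (basisSpan q (i + 1)).comap (LinearMap.mulLeft ℝ X) := by
      refine Submodule.span_le.2 ?_
      rintro _ ⟨k, hk, rfl⟩
      have hk : k ≤ i := hk
      obtain ⟨α, β, h⟩ := X_mul_basisPoly q k
      simp only [SetLike.mem_coe, Submodule.mem_comap, LinearMap.mulLeft_apply, h, ← smul_eq_C_mul]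
      refine Submodule.add_mem _ (Submodule.smul_mem _ _ (basisPoly_mem_span q (by omega)))
        (Submodule.smul_mem _ _ ?_)
      cases k with
      | zero => simp [shiftDown]
      | succ k => exact basisPoly_mem_span q (by omega)
    exact this ih

lemma basisSpan_mono (q : ℕ) {M N : ℕ} (h : M ≤ N) : basisSpan q M ≤ basisSpan q N :=
  Submodule.span_mono (Set.image_mono (Set.Iic_subset_Iic.2 h))

lemma mem_basisSpan (q : ℕ) [Fact (1 ≤ q)] {p : ℝ[X]} {N : ℕ} (hp : p.natDegree ≤ N) :
    p ∈ basisSpan q N := by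
  rw [p.as_sum_range_C_mul_X_pow' (n := N + 1) (by omega)]
  refine Submodule.sum_mem _ fun i hi => ?_
  rw [← smul_eq_C_mul]
  exact Submodule.smul_mem _ _ (basisSpan_mono q (by simpa [Nat.lt_succ_iff] using hi)
    (X_pow_mem_basisSpan q i))

instance fact_one_le_one : Fact (1 ≤ 1) := ⟨le_rfl⟩

lemma wInt_one_one : wInt 1 1 = Real.pi := by
  have h := wInt_monomial_even 1 0 0 (by simp)
  simp only [pow_zero, mul_one] at h
  rw [h, betaMoment, beta]
  norm_num [← sq, Real.Gamma_one_half_eq, Real.Gamma_one]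
  exact Real.sq_sqrt Real.pi_pos.le

lemma wInt_chebyshev (k : ℤ) : wInt 1 (Chebyshev.T ℝ k) = if k = 0 then Real.pi else 0 := by
  rw [← Chebyshev.T_natAbs]
  have e0 : k = 0 ↔ k.natAbs = 0 := by simp
  simp only [e0]
  generalize k.natAbs = n
  -- As for Gegenbauer polynomials: Pearson's equation at T_n, with the integral of x T_n eliminated
  -- by the recurrence.
  have step : ∀ n : ℕ, ((n : ℝ) + 1) * wInt 1 (Chebyshev.T ℝ (n + 1)) =
      ((n : ℝ) - 1) * wInt 1 (Chebyshev.T ℝ (n - 1)) := by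
    intro n
    have h := wInt_pearson 1 (Chebyshev.T ℝ n)
    have e0 := Chebyshev.one_sub_X_sq_mul_derivative_T_eq_poly_in_T (R := ℝ) ((n : ℤ) - 1)
    rw [sub_add_cancel] at e0
    have e1 : (1 - X ^ 2) * derivative (Chebyshev.T ℝ n) =
        (n : ℝ) • (Chebyshev.T ℝ (n - 1) - X * Chebyshev.T ℝ n) := by
      rw [e0, smul_eq_C_mul]
      push_cast
      simp
    have e2 : wInt 1 (Chebyshev.T ℝ (n + 1)) =
        2 * wInt 1 (X * Chebyshev.T ℝ n) - wInt 1 (Chebyshev.T ℝ (n - 1)) := by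
      rw [Chebyshev.T_add_one, map_sub, ← smul_eq_mul (2 : ℝ), ← map_smul, smul_eq_C_mul,
        mul_assoc]
      rfl
    rw [e1, map_smul, map_sub, smul_eq_mul] at h
    rw [e2]
    push_cast at h
    linear_combination (-2) * h
  induction n using Nat.twoStepInduction with
  | zero => simpa using wInt_one_one
  | one =>
    have h := wInt_monomial_odd 1 1 0 (by decide)
    simpa using h
  | more n h0 _ =>
    have h := step (n + 1)
    push_cast at h ⊢
    rw [show (n : ℤ) + 1 + 1 = n + 2 by ring, show (n : ℤ) + 1 - 1 = n by ring, h0] at h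
    have h1 : ((n : ℝ) + 1 + 1) * wInt 1 (Chebyshev.T ℝ (n + 2)) = 0 := by
      -- The integral of T_0 is π, but its coefficient is n = 0.
      rw [h]; cases n <;> simp
    simpa using (mul_eq_zero.1 h1).resolve_left (by positivity)

/-- The product formula for T_j T_k, applied twice, leaves four Chebyshev polynomials, of which only
those of index 0 have a nonzero integral. Integer indices avoid any ordering of the k's. -/
lemma wInt_chebyshev_triple (k₁ k₂ k₃ : ℤ) :
    wInt 1 (Chebyshev.T ℝ k₁ * Chebyshev.T ℝ k₂ * Chebyshev.T ℝ k₃) =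
      ((if k₁ + k₂ + k₃ = 0 then Real.pi else 0) + (if k₁ + k₂ - k₃ = 0 then Real.pi else 0) +
        (if k₁ - k₂ + k₃ = 0 then Real.pi else 0) + (if k₁ - k₂ - k₃ = 0 then Real.pi else 0)) / 4 := by
  have e : Chebyshev.T ℝ k₁ * Chebyshev.T ℝ k₂ * Chebyshev.T ℝ k₃ =
      (1 / 4 : ℝ) • (Chebyshev.T ℝ (k₁ + k₂ + k₃) + Chebyshev.T ℝ (k₁ + k₂ - k₃) +
        (Chebyshev.T ℝ (k₁ - k₂ + k₃) + Chebyshev.T ℝ (k₁ - k₂ - k₃))) := by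
    rw [← Chebyshev.T_mul_T, ← Chebyshev.T_mul_T, smul_eq_C_mul]
    have e : (C (1 / 4) : ℝ[X]) * 4 = 1 := by
      rw [show (4 : ℝ[X]) = C 4 from rfl, ← C_mul]; norm_num
    have h := Chebyshev.T_mul_T ℝ k₁ k₂
    linear_combination (-(Chebyshev.T ℝ k₁ * Chebyshev.T ℝ k₂ * Chebyshev.T ℝ k₃)) * e
      + C (1 / 4) * 2 * Chebyshev.T ℝ k₃ * h
  rw [e, map_smul, map_add, map_add, map_add, wInt_chebyshev, wInt_chebyshev, wInt_chebyshev,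
    wInt_chebyshev, smul_eq_mul]
  ring

lemma wInt_one (q : ℕ) [Fact (1 ≤ q)] : wInt q 1 = area q / area (q - 1) := by
  have h := wInt_monomial_even q 0 0 (by simp)
  simp only [pow_zero, mul_one] at h
  rw [h, betaMoment_zero q Fact.out]

lemma wInt_one_pos (q : ℕ) [Fact (1 ≤ q)] : 0 < wInt q 1 := by
  rw [wInt_one]; exact div_pos (area_pos q) (area_pos _)

lemma wInt_gegenbauer_triple {q : ℕ} [Fact (1 ≤ q)] (hq : q ≠ 1) (k₁ k₂ k₃ : ℕ) :
    wInt q (basisPoly q k₁ * basisPoly q k₂ * basisPoly q k₃) =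
      area q / area (q - 1) * tripleValue (((q : ℝ) - 1) / 2) k₁ k₂ k₃ := by
  simp only [basisPoly_of_ne hq]
  rw [gegenbauer_functional_triple (half_pos_of_ne hq) (wInt q), wInt_one]
  intro p
  rw [wInt_pearson]
  ring

lemma basisPoly_eval_one_of_ne {q : ℕ} (hq : q ≠ 1) (k : ℕ) :
    (basisPoly q k).eval 1 = poch ((q : ℝ) - 1) k / k.factorial := by
  rw [basisPoly_of_ne hq, gegenbauer_eval_one]
  congr 2
  ring

lemma basisPoly_eval_one_pos (q : ℕ) [Fact (1 ≤ q)] (k : ℕ) : 0 < (basisPoly q k).eval 1 := by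
  by_cases hq : q = 1
  · subst hq; simp [basisPoly_one]
  · have := half_pos_of_ne hq
    have := poch_pos (a := (q : ℝ) - 1) (by linarith) k
    rw [basisPoly_eval_one_of_ne hq]
    positivity

lemma normConst_of_ne {q : ℕ} [Fact (1 ≤ q)] (hq : q ≠ 1) (k : ℕ) :
    normConst q k = area q / area (q - 1) *
      ((((q : ℝ) - 1) / 2) / (k + ((q : ℝ) - 1) / 2) * (basisPoly q k).eval 1) := by
  have ha := half_pos_of_ne hq
  obtain ⟨a, haq⟩ : ∃ a, a = ((q : ℝ) - 1) / 2 := ⟨_, rfl⟩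
  rw [← haq] at ha
  rw [normConst, if_neg hq, ← haq, show (q : ℝ) - 1 = 2 * a by rw [haq]; ring,
    show 2 * (k : ℝ) + q - 1 = 2 * (k + a) by rw [haq]; ring,
    show 1 + 2 * (k : ℝ) / (2 * a) = (k + a) / a by field_simp; ring]
  have : (k : ℝ) + a ≠ 0 := by positivity
  field_simp

lemma normConst_one (k : ℕ) :
    normConst 1 k = (1 + if k = 0 then 1 else 0) * Real.pi / 2 := by simp [normConst]

lemma normConst_pos (q : ℕ) [Fact (1 ≤ q)] (k : ℕ) : 0 < normConst q k := by
  by_cases hq : q = 1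
  · subst hq
    rw [normConst_one]
    have := Real.pi_pos
    split_ifs <;> positivity
  · rw [normConst_of_ne hq]
    have := half_pos_of_ne hq
    have := basisPoly_eval_one_pos q k
    have := area_pos q
    have := area_pos (q - 1)
    positivity

/-- Orthogonality of the basis polynomials. -/
lemma wInt_basisPoly_mul (q : ℕ) [Fact (1 ≤ q)] (j k : ℕ) :
    wInt q (basisPoly q j * basisPoly q k) = if j = k then normConst q k else 0 := by
  by_cases hq : q = 1
  · subst hq
    -- Orthogonality is the case of a triple product with one index 0, here and for Gegenbauer
    -- polynomials.
    have h := wInt_chebyshev_triple 0 j k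
    simp only [Chebyshev.T_zero, one_mul] at h
    rw [basisPoly_one, basisPoly_one, h, normConst_one]
    split_ifs <;> first | omega | ring
  · have h := wInt_gegenbauer_triple hq 0 j k
    rw [basisPoly_zero, one_mul] at h
    rw [h]
    have ha := half_pos_of_ne hq
    split_ifs with hjk
    · subst hjk
      rw [normConst_of_ne hq, basisPoly_of_ne hq, gegenbauer_eval_one,
        tripleValue_of_sum _ j _ _ _ (by push_cast; ring)]
      have e0 : pochRatio (((q : ℝ) - 1) / 2) ((j : ℤ) - j) = 1 := by
        have := pochRatio_natCast (((q : ℝ) - 1) / 2) 0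
        simp at this
        simp [this]
      rw [e0, Nat.cast_zero, sub_zero, pochRatio_natCast, Int.toNat_natCast, pochQuot, poch_succ]
      have h1 := (poch_pos ha j).ne'
      have h2 : (((q : ℝ) - 1) / 2) + j ≠ 0 := by positivity
      have h3 : (j : ℝ) + ((q : ℝ) - 1) / 2 ≠ 0 := by positivity
      generalize ((q : ℝ) - 1) / 2 = a at *
      field_simp
      ring
    · by_cases he : Even (((0 : ℕ) : ℤ) + j + k)
      · obtain ⟨s, hs⟩ := he
        rw [tripleValue_of_sum _ s _ _ _ (by omega)]
        rcases lt_or_gt_of_ne hjk with h1 | h1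
        · rw [pochRatio_of_neg _ (show s - k < 0 by omega)]; ring
        · rw [pochRatio_of_neg _ (show s - j < 0 by omega)]; ring
      · rw [tripleValue_of_odd _ he, mul_zero]

/-! ### Values of the triple-product integrals -/

lemma triple_eq_wInt (q : ℕ) [Fact (1 ≤ q)] (k₁ k₂ k₃ : ℕ) :
    triple q k₁ k₂ k₃ = wInt q (basisPoly q k₁ * basisPoly q k₂ * basisPoly q k₃) := by
  rw [triple, intervalIntegral_mul_weight, wInt_apply]
  simp

lemma Gamma_add_natCast {a : ℝ} (ha : 0 < a) (n : ℕ) :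
    Real.Gamma (a + n) = poch a n * Real.Gamma a := by
  induction n with
  | zero => simp
  | succ n ih =>
    push_cast
    rw [← add_assoc, Real.Gamma_add_one (by positivity), ih, poch_succ]
    ring

/-- With k₁ = l + i, k₂ = l + j, k₃ = i + j, the half-sum is l + i + j and its differences with the
indices are j, i, l. All Gamma and beta values then become Pochhammer symbols. The second factor on
the left is the squared norm c_{k₃,q} without the ratio of areas. -/
lemma linCoeff_eq {a : ℝ} (ha : 0 < a) (l i j : ℕ) :
    linCoeff l (l + i) (l + j) a * (a / ((i + j : ℕ) + a) * (poch (2 * a) (i + j) / (i + j).factorial)) =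
      tripleValue a (l + i : ℕ) (l + j : ℕ) (i + j : ℕ) := by
  rw [tripleValue_of_sum a (l + i + j : ℕ) _ _ _ (by push_cast; ring)]
  rw [show ((l + i + j : ℕ) : ℤ) - (l + i : ℕ) = (j : ℕ) by push_cast; ring,
    show ((l + i + j : ℕ) : ℤ) - (l + j : ℕ) = (i : ℕ) by push_cast; ring,
    show ((l + i + j : ℕ) : ℤ) - (i + j : ℕ) = (l : ℕ) by push_cast; ring,
    pochRatio_natCast, pochRatio_natCast, pochRatio_natCast, Int.toNat_natCast, pochQuot, poch_succ]
  have hc : ((Nat.choose (l + i + (l + j) - 2 * l) (l + j - l) : ℕ) : ℝ) =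
      (i + j).factorial / (i.factorial * j.factorial) := by
    rw [show l + i + (l + j) - 2 * l = i + j by omega, show l + j - l = j by omega,
      Nat.cast_choose ℝ (by omega), show i + j - j = i by omega, mul_comm (j.factorial : ℝ)]
  have G := Real.Gamma_pos_of_pos ha
  have G2 := Real.Gamma_pos_of_pos (show 0 < 2 * a by positivity)
  rw [linCoeff, hc]
  simp only [beta]
  push_cast
  rw [show a + (l + i) - l = a + (i : ℝ) by ring, show a + (l + j) - l = a + (j : ℝ) by ring,
    show a + ((l : ℝ) + i) + (l + j) - l = a + (l + i + j : ℕ) by push_cast; ring,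
    show a + (i : ℝ) + (a + j) = 2 * a + (i + j : ℕ) by push_cast; ring,
    show a + (l + i + j : ℕ) + a = 2 * a + (l + i + j : ℕ) by ring,
    Gamma_add_natCast ha, Gamma_add_natCast ha, Gamma_add_natCast ha, Gamma_add_natCast ha,
    Gamma_add_natCast (by positivity), Gamma_add_natCast (by positivity)]
  have p1 := (poch_pos ha (l + i + j)).ne'
  have p2 := (poch_pos (show 0 < 2 * a by positivity) (i + j)).ne'
  have p3 := (poch_pos (show 0 < 2 * a by positivity) (l + i + j)).ne'
  have d1 : (l : ℝ) + i + (l + j) + a - l ≠ 0 := by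
    rw [show (l : ℝ) + i + (l + j) + a - l = l + i + j + a by ring]; positivity
  have d2 : a + ((l : ℝ) + i + j) ≠ 0 := by positivity
  have d3 : (i : ℝ) + j + a ≠ 0 := by positivity
  rw [show (l : ℝ) + i + (l + j) + a - l = a + (l + i + j) by ring,
    show (l : ℝ) + i + (l + j) + a - 2 * l = i + j + a by ring]
  generalize poch (2 * a) (i + j) = P1 at *
  generalize poch (2 * a) (l + i + j) = P2 at *
  field_simp

/-- The values of the triple-product integrals. -/
theorem triple_eq (q : ℕ) [Fact (1 ≤ q)] (k₁ k₂ k₃ : ℕ) (h12 : k₁ ≤ k₂) (h23 : k₂ ≤ k₃) :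
    triple q k₁ k₂ k₃ =
      if q = 1 then
        (if k₃ = k₂ + k₁ ∨ k₃ = k₂ - k₁ then
          (1 + if k₁ = 0 then 1 else 0) / 2 * normConst 1 k₃ else 0)
      else
        (if Odd (k₁ + k₂ + k₃) ∨ k₁ + k₂ < k₃ then 0 else
          linCoeff ((k₁ + k₂ - k₃) / 2) k₁ k₂ (((q : ℝ) - 1) / 2) * normConst q k₃) := by
  rw [triple_eq_wInt]
  split_ifs with hq hk h0 hk
  · subst hq
    -- For ordered indices the active conditions are k₃ = k₂ ± k₁. They coincide when k₁ = 0, which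
    -- doubles the value; the all-zero case is doubled again by the norm.
    rw [basisPoly_one, basisPoly_one, basisPoly_one, wInt_chebyshev_triple, normConst_one]
    split_ifs <;> first | omega | ring
  · subst hq
    rw [basisPoly_one, basisPoly_one, basisPoly_one, wInt_chebyshev_triple, normConst_one]
    split_ifs <;> first | omega | ring
  · subst hq
    rw [basisPoly_one, basisPoly_one, basisPoly_one, wInt_chebyshev_triple]
    split_ifs <;> first | omega | ring
  · rw [wInt_gegenbauer_triple hq]
    rcases hk with hk | hk
    · rw [tripleValue_of_odd, mul_zero]
      intro h
      have : Even (k₁ + k₂ + k₃) := by exact_mod_cast h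
      exact (Nat.not_even_iff_odd.2 hk) this
    · by_cases he : Even ((k₁ : ℤ) + k₂ + k₃)
      · obtain ⟨s, hs⟩ := he
        rw [tripleValue_of_sum _ s _ _ _ (by omega),
          pochRatio_of_neg _ (show s - k₃ < 0 by omega)]
        ring
      · rw [tripleValue_of_odd _ he, mul_zero]
  · rw [not_or, Nat.not_odd_iff_even, not_lt] at hk
    obtain ⟨⟨s, hs⟩, hk⟩ := hk
    obtain ⟨l, hl⟩ : ∃ l, l = (k₁ + k₂ - k₃) / 2 := ⟨_, rfl⟩
    obtain ⟨i, hi⟩ : ∃ i, i = k₁ - l := ⟨_, rfl⟩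
    obtain ⟨j, hj⟩ : ∃ j, j = k₂ - l := ⟨_, rfl⟩
    obtain rfl : k₁ = l + i := by omega
    obtain rfl : k₂ = l + j := by omega
    obtain rfl : k₃ = i + j := by omega
    rw [wInt_gegenbauer_triple hq, ← hl, normConst_of_ne hq, basisPoly_of_ne hq, gegenbauer_eval_one,
      ← linCoeff_eq (half_pos_of_ne hq)]
    ring

/-- The eigenvalue-like constants of the Funk–Hecke formula. -/
def hecke (q k : ℕ) : ℝ := area (q - 1) * normConst q k / (basisPoly q k).eval 1

/-! ### Funk–Hecke constants and growth bounds -/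

lemma area_zero : area 0 = 2 := by
  have := Real.pi_pos
  simp only [area, Nat.cast_zero, zero_add, Real.Gamma_one_half_eq, Real.sqrt_eq_rpow]
  field_simp

lemma hecke_one (k : ℕ) : hecke 1 k = (1 + if k = 0 then 1 else 0) * Real.pi := by
  simp [hecke, area_zero, normConst_one, basisPoly_one]
  ring

lemma hecke_of_ne {q : ℕ} [Fact (1 ≤ q)] (hq : q ≠ 1) (k : ℕ) :
    hecke q k = area q * (1 + 2 * (k : ℝ) / ((q : ℝ) - 1))⁻¹ := by
  have ha := half_pos_of_ne hq
  have h1 := (basisPoly_eval_one_pos q k).ne'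
  have h2 := (area_pos (q - 1)).ne'
  have h3 : (q : ℝ) - 1 ≠ 0 := by linarith
  have h5 : (k : ℝ) + ((q : ℝ) - 1) / 2 ≠ 0 := by positivity
  have h4 : 1 + 2 * (k : ℝ) / ((q : ℝ) - 1) = 2 * (k + ((q : ℝ) - 1) / 2) / ((q : ℝ) - 1) := by
    field_simp; ring
  rw [hecke, normConst_of_ne hq, h4]
  field_simp

lemma area_one : area 1 = 2 * Real.pi := by
  simp [area]

/-- In α₁ each inner integral contributes one Funk–Hecke constant, and the outer zonal integral
contributes the area of the slice sphere. -/
lemma area_sq_mul_zeta (q : ℕ) [Fact (1 ≤ q)] (k₁ k₂ : ℕ) :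
    area q ^ 2 * zeta q k₁ k₂ = hecke q k₁ * hecke q k₂ * area (q - 1) := by
  by_cases hq : q = 1
  · subst hq
    simp only [hecke_one, zeta, area_one, if_true, Nat.sub_self, area_zero]
    ring
  · rw [hecke_of_ne hq, hecke_of_ne hq, zeta, if_neg hq]
    ring

/-- In β the inner integral contributes the Funk–Hecke constant; the outer one, the integral of P_k
g, contributes the slice area and the squared norm. -/
lemma area_sq_mul_tau (q : ℕ) [Fact (1 ≤ q)] (k : ℕ) :
    area q ^ 2 * tau q k = hecke q k * (area (q - 1) * normConst q k) := by
  have h : area (q - 1) * normConst q k = hecke q k * (basisPoly q k).eval 1 := by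
    rw [hecke, div_mul_cancel₀ _ (basisPoly_eval_one_pos q k).ne']
  rw [h]
  by_cases hq : q = 1
  · subst hq
    simp only [hecke_one, tau, area_one, if_true, basisPoly_one, Chebyshev.T_eval_one]
    ring
  · rw [hecke_of_ne hq, tau, if_neg hq, basisPoly_eval_one_of_ne hq, poch, ← inv_pow]
    ring

lemma basisPoly_eval_one_le (q : ℕ) [hq1 : Fact (1 ≤ q)] (k : ℕ) :
    (basisPoly q k).eval 1 ≤ ((k : ℝ) + 1) ^ q := by
  by_cases hq : q = 1
  · subst hq; simp [basisPoly_one]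
  · rw [basisPoly_eval_one_of_ne hq]
    have ha := half_pos_of_ne hq
    induction k with
    | zero => simp
    | succ k ih =>
      have hk : (0 : ℝ) < k + 1 := by positivity
      have h1 : poch ((q : ℝ) - 1) (k + 1) / (k + 1).factorial =
          poch ((q : ℝ) - 1) k / k.factorial * (((q : ℝ) - 1 + k) / (k + 1)) := by
        rw [poch_succ, Nat.factorial_succ]
        push_cast
        field_simp
      -- The ratio of consecutive values at 1 is at most 1 + q/(k+1), hence at most the q-th power
      -- of (k+2)/(k+1) by Bernoulli's inequality; the product telescopes.
      have h2 : ((q : ℝ) - 1 + k) / (k + 1) ≤ (1 + 1 / ((k : ℝ) + 1)) ^ q := by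
        refine le_trans ?_ (one_add_mul_le_pow (by
          have : (0 : ℝ) ≤ 1 / ((k : ℝ) + 1) := by positivity
          linarith) q)
        rw [div_le_iff₀ hk]
        field_simp
        linarith
      rw [h1]
      calc _ ≤ ((k : ℝ) + 1) ^ q * (1 + 1 / ((k : ℝ) + 1)) ^ q := by
            refine mul_le_mul ih h2 ?_ (by positivity)
            apply div_nonneg _ hk.le
            have : (0 : ℝ) ≤ k := by positivity
            linarith
        _ = _ := by
            rw [← mul_pow]; congr 1; push_cast; field_simp

lemma exists_eval_one_div_normConst_le (q : ℕ) [hq1 : Fact (1 ≤ q)] :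
    ∃ A : ℝ, 0 ≤ A ∧ ∀ k, (basisPoly q k).eval 1 / normConst q k ≤ A * ((k : ℝ) + 1) := by
  by_cases hq : q = 1
  · subst hq
    refine ⟨1, zero_le_one, fun k => ?_⟩
    have := Real.pi_gt_three
    have hk : (0 : ℝ) ≤ k := by positivity
    rw [div_le_iff₀ (normConst_pos 1 k), basisPoly_one, normConst_one, Chebyshev.T_eval_one]
    split_ifs <;> nlinarith
  · have ha := half_pos_of_ne hq
    have h1 := area_pos q
    have h2 := area_pos (q - 1)
    refine ⟨area (q - 1) / area q * ((1 + ((q : ℝ) - 1) / 2) / (((q : ℝ) - 1) / 2)), by positivity,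
      fun k => ?_⟩
    have h3 := basisPoly_eval_one_pos q k
    rw [normConst_of_ne hq]
    have h5 : (0 : ℝ) < (k : ℝ) + ((q : ℝ) - 1) / 2 := by positivity
    generalize ((q : ℝ) - 1) / 2 = a at *
    have e : eval 1 (basisPoly q k) / (area q / area (q - 1) * (a / (k + a) * eval 1 (basisPoly q k)))
        = area (q - 1) / area q * ((k + a) / a) := by field_simp
    rw [e, mul_assoc]
    gcongr
    rw [div_mul_eq_mul_div]
    gcongr
    have : (0 : ℝ) ≤ k := by positivity
    nlinarith

/-! ### Geometry of the sphere -/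

lemma dot_comm {q : ℕ} (x y : Sphere q) : dot x y = dot y x := real_inner_comm _ _

lemma norm_coe {q : ℕ} (x : Sphere q) : ‖(x : Ambient q)‖ = 1 := by simp

lemma dot_self {q : ℕ} (x : Sphere q) : dot x x = 1 := by
  rw [dot, real_inner_self_eq_norm_sq, norm_coe, one_pow]

lemma dot_mem_Icc {q : ℕ} (x y : Sphere q) : dot x y ∈ Set.Icc (-1 : ℝ) 1 := by
  have h := abs_real_inner_le_norm (x : Ambient q) (y : Ambient q)
  rw [norm_coe, norm_coe, mul_one, abs_le] at h
  exact h

lemma continuous_dot {q : ℕ} : Continuous fun p : Sphere q × Sphere q => dot p.1 p.2 := by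
  unfold dot; fun_prop

@[fun_prop]
lemma continuous_dot_right {q : ℕ} (x : Sphere q) : Continuous fun y => dot x y := by
  unfold dot; fun_prop

lemma exists_unit_orthogonal {q : ℕ} [hq : Fact (1 ≤ q)] (x : Sphere q) :
    ∃ v : Sphere q, dot x v = 0 := by
  have h : Module.finrank ℝ ((ℝ ∙ (x : Ambient q))ᗮ) = q := by
    have : Fact (Module.finrank ℝ (Ambient q) = q + 1) := ⟨by simp⟩
    exact Submodule.finrank_orthogonal_span_singleton (by
      intro h; have := norm_coe x; simp [h] at this)
  have hne : ((ℝ ∙ (x : Ambient q))ᗮ) ≠ ⊥ := by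
    intro h0
    rw [h0, finrank_bot] at h
    have := hq.out
    omega
  obtain ⟨w, hw, hw0⟩ := Submodule.exists_mem_ne_zero_of_ne_bot hne
  rw [Submodule.mem_orthogonal_singleton_iff_inner_right] at hw
  have hn : ‖w‖ ≠ 0 := norm_ne_zero_iff.2 hw0
  refine ⟨⟨‖w‖⁻¹ • w, by simp [norm_smul, hn]⟩, ?_⟩
  simp [dot, inner_smul_right, hw]

/-- Decomposition of a unit vector along another one. -/
lemma exists_decomposition {q : ℕ} [hq : Fact (1 ≤ q)] (x m : Sphere q) :
    ∃ v : Sphere q, dot x v = 0 ∧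
      (m : Ambient q) = dot x m • (x : Ambient q) + √(1 - dot x m ^ 2) • (v : Ambient q) := by
  set s := dot x m with hs
  set w : Ambient q := m - s • (x : Ambient q) with hw
  have hxx : inner ℝ (x : Ambient q) (x : Ambient q) = 1 := dot_self x
  have hmm : inner ℝ (m : Ambient q) (m : Ambient q) = 1 := dot_self m
  have hxm : inner ℝ (x : Ambient q) (m : Ambient q) = s := rfl
  have hmx : inner ℝ (m : Ambient q) (x : Ambient q) = s := dot_comm m x
  have hxw : inner ℝ (x : Ambient q) w = 0 := by
    rw [hw, inner_sub_right, inner_smul_right, hxx, hxm]; ring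
  have hnw : ‖w‖ = √(1 - s ^ 2) := by
    rw [← Real.sqrt_sq (norm_nonneg w), ← real_inner_self_eq_norm_sq]
    congr 1
    rw [hw, inner_sub_sub_self, inner_smul_right, inner_smul_right, inner_smul_left,
      inner_smul_left, hxx, hmm, hxm, hmx]
    simp; ring
  -- When m = ±x the orthogonal part is zero and any orthogonal unit vector serves.
  by_cases h0 : w = 0
  · obtain ⟨v, hv⟩ := exists_unit_orthogonal x
    refine ⟨v, hv, ?_⟩
    rw [← hnw, h0, norm_zero, zero_smul, add_zero]
    exact sub_eq_zero.1 h0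
  · have hn : ‖w‖ ≠ 0 := norm_ne_zero_iff.2 h0
    refine ⟨⟨‖w‖⁻¹ • w, by simp [norm_smul, hn]⟩, ?_, ?_⟩
    · simp [dot, inner_smul_right, hxw]
    · rw [← hnw, smul_smul, mul_inv_cancel₀ hn, one_smul, hw]
      abel

lemma exists_dot_eq {q : ℕ} [Fact (1 ≤ q)] (x : Sphere q) {t : ℝ} (ht : t ∈ Set.Icc (-1 : ℝ) 1) :
    ∃ m : Sphere q, dot x m = t := by
  obtain ⟨v, hv⟩ := exists_unit_orthogonal x
  have hxx : inner ℝ (x : Ambient q) (x : Ambient q) = 1 := dot_self x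
  have hvv : inner ℝ (v : Ambient q) (v : Ambient q) = 1 := dot_self v
  have hxv : inner ℝ (x : Ambient q) (v : Ambient q) = 0 := hv
  have hvx : inner ℝ (v : Ambient q) (x : Ambient q) = 0 := (dot_comm v x).trans hv
  have h1 : 0 ≤ 1 - t ^ 2 := by nlinarith [ht.1, ht.2]
  have hn : ‖t • (x : Ambient q) + √(1 - t ^ 2) • (v : Ambient q)‖ = 1 := by
    rw [← Real.sqrt_sq (norm_nonneg _), ← real_inner_self_eq_norm_sq]
    simp only [inner_add_left, inner_add_right, inner_smul_left, inner_smul_right, hxx, hvv, hxv,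
      hvx, conj_trivial]
    rw [Real.sqrt_eq_one]
    linear_combination Real.mul_self_sqrt h1
  refine ⟨⟨t • (x : Ambient q) + √(1 - t ^ 2) • (v : Ambient q), by simp [hn]⟩, ?_⟩
  simp only [dot, inner_add_right, inner_smul_right, hxx, hxv]
  ring

lemma integrable_surface_of_continuous {q : ℕ} {f : Sphere q → ℝ} (hf : Continuous f) :
    Integrable f (surface q) :=
  hf.integrable_of_hasCompactSupport (HasCompactSupport.of_compactSpace f)

/-! ### Slice averages and the Funk–Hecke formula for polynomials -/

/-- The average of `X ^ i` over the slices of the sphere, for poles at cosine `s`. -/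
def sliceMono (q : ℕ) (s : ℝ) (i : ℕ) : ℝ[X] :=
  ∑ b ∈ Finset.range (i + 1), if Even b then
    C (Nat.choose i b * slice q (b / 2) * (1 - s ^ 2) ^ (b / 2) * s ^ (i - b)) *
      (X ^ (i - b) * (1 - X ^ 2) ^ (b / 2)) else 0

/-- The averages of polynomials over the slices of the sphere, for poles at cosine `s`. -/
def sliceMean (q : ℕ) (s : ℝ) : ℝ[X] →ₗ[ℝ] ℝ[X] :=
  Polynomial.lsum fun i => LinearMap.toSpanSingleton ℝ ℝ[X] (sliceMono q s i)

lemma sliceMean_monomial (q : ℕ) (s : ℝ) (i : ℕ) (c : ℝ) :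
    sliceMean q s (monomial i c) = c • sliceMono q s i := by
  simp [sliceMean, Polynomial.lsum_apply, Polynomial.sum_monomial_index]

lemma natDegree_sliceMono_le (q : ℕ) (s : ℝ) (i : ℕ) : (sliceMono q s i).natDegree ≤ i := by
  refine natDegree_sum_le_of_forall_le _ _ fun b hb => ?_
  split_ifs with h
  · refine (natDegree_C_mul_le _ _).trans (natDegree_mul_le.trans ?_)
    have h1 : ((1 - X ^ 2 : ℝ[X]) ^ (b / 2)).natDegree ≤ b / 2 * 2 := by
      refine natDegree_pow_le_of_le _ ?_
      refine (natDegree_sub_le _ _).trans ?_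
      simp
    rw [natDegree_X_pow]
    have : b ≤ i := by simpa [Nat.lt_succ_iff] using hb
    omega
  · simp

lemma natDegree_sliceMean_le (q : ℕ) (s : ℝ) (f : ℝ[X]) :
    (sliceMean q s f).natDegree ≤ f.natDegree := by
  conv_lhs => rw [f.as_sum_range]
  rw [map_sum]
  refine natDegree_sum_le_of_forall_le _ _ fun i hi => ?_
  rw [sliceMean_monomial]
  refine (natDegree_smul_le _ _).trans ((natDegree_sliceMono_le q s i).trans ?_)
  simpa [Nat.lt_succ_iff] using hi

/-- At cosine 1 the slice shrinks to the pole: every term with b > 0 carries a factor 1 - X². This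
evaluation determines the eigenvalues of the slice average. -/
lemma sliceMean_eval_one (q : ℕ) [hq : Fact (1 ≤ q)] (s : ℝ) (f : ℝ[X]) :
    (sliceMean q s f).eval 1 = f.eval s := by
  induction f using Polynomial.induction_on' with
  | add p r hp hr => simp [hp, hr]
  | monomial i c =>
    rw [sliceMean_monomial, eval_smul, eval_monomial, smul_eq_mul, sliceMono, eval_finsetSum,
      Finset.sum_eq_single 0]
    · simp [slice_zero q hq.out]
    · intro b _ hb
      split_ifs with h
      · have : b / 2 ≠ 0 := by
          obtain ⟨c, rfl⟩ := h
          omega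
        simp [this]
      · simp
    · simp

lemma sliceMean_one (q : ℕ) [hq : Fact (1 ≤ q)] (s : ℝ) : sliceMean q s 1 = 1 := by
  rw [← monomial_zero_one, sliceMean_monomial]
  simp [sliceMono, slice_zero q hq.out]

/-- Writing m = s x + √(1 - s²) v with v orthogonal to x, a power of m'y expands binomially in x'y
and v'y, whose mixed moments are known. Odd powers of v'y vanish and even ones leave powers of 1 -
s², so the result is polynomial in s. -/
lemma integral_poly_mul_poly (q : ℕ) [hq : Fact (1 ≤ q)] (x m : Sphere q) (p f : ℝ[X]) :
    ∫ y, p.eval (dot x y) * f.eval (dot m y) ∂(surface q) =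
      area (q - 1) * wInt q (p * sliceMean q (dot x m) f) := by
  have hi : ∀ p f : ℝ[X], Integrable (fun y => p.eval (dot x y) * f.eval (dot m y)) (surface q) :=
    fun p f => integrable_surface_of_continuous (by fun_prop)
  induction f using Polynomial.induction_on' with
  | add f r hf hr =>
    simp only [eval_add, mul_add, map_add]
    rw [integral_add (hi p f) (hi p r), hf, hr]
  | monomial i c =>
    induction p using Polynomial.induction_on' with
    | add p r hp hr =>
      simp only [eval_add, add_mul, map_add]
      rw [integral_add (hi p _) (hi r _), hp, hr, mul_add]
    | monomial a d =>
      obtain ⟨v, hv, hm⟩ := exists_decomposition x m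
      set s := dot x m with hs
      have hs1 : 0 ≤ 1 - s ^ 2 := by nlinarith [(dot_mem_Icc x m).1, (dot_mem_Icc x m).2]
      have hdot : ∀ y : Sphere q, dot m y = s * dot x y + √(1 - s ^ 2) * dot v y := by
        intro y
        simp only [dot]
        conv_lhs => rw [hm]
        rw [inner_add_left, inner_smul_left, inner_smul_left]
        rfl
      have e1 : ∀ y : Sphere q, (monomial a d).eval (dot x y) * (monomial i c).eval (dot m y) =
          ∑ b ∈ Finset.range (i + 1), (d * c * Nat.choose i b * √(1 - s ^ 2) ^ b * s ^ (i - b)) *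
            (dot x y ^ (a + (i - b)) * dot v y ^ b) := by
        intro y
        rw [eval_monomial, eval_monomial, hdot y, add_comm, add_pow, Finset.mul_sum, Finset.mul_sum]
        refine Finset.sum_congr rfl fun b _ => ?_
        rw [mul_pow, mul_pow, pow_add]
        ring
      simp_rw [e1]
      rw [integral_finsetSum _ fun b _ => (integrable_surface_of_continuous (by fun_prop))]
      rw [sliceMean_monomial, sliceMono, Finset.smul_sum, Finset.mul_sum, map_sum, Finset.mul_sum]
      refine Finset.sum_congr rfl fun b _ => ?_
      rw [integral_const_mul, sphere_moment q x v hv]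
      split_ifs with hb
      · have e2 : (monomial a d : ℝ[X]) * c • (C (Nat.choose i b * slice q (b / 2) *
            (1 - s ^ 2) ^ (b / 2) * s ^ (i - b)) * (X ^ (i - b) * (1 - X ^ 2) ^ (b / 2))) =
            (d * c * (Nat.choose i b * slice q (b / 2) * (1 - s ^ 2) ^ (b / 2) * s ^ (i - b))) •
              (X ^ (a + (i - b)) * (1 - X ^ 2) ^ (b / 2)) := by
          rw [← C_mul_X_pow_eq_monomial, smul_eq_C_mul, smul_eq_C_mul, pow_add]
          simp only [C_mul]
          ring
        rw [e2, map_smul, smul_eq_mul]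
        obtain ⟨e, rfl⟩ := hb
        have e3 : (e + e) / 2 = e := by omega
        rw [e3, ← two_mul, pow_mul (√(1 - s ^ 2)), Real.sq_sqrt hs1]
        ring
      · simp

/-- Expansion of a polynomial in the orthogonal basis. -/
lemma eq_sum_basisPoly (q : ℕ) [Fact (1 ≤ q)] {p : ℝ[X]} {N : ℕ} (hp : p.natDegree ≤ N) :
    p = ∑ j ∈ Finset.range (N + 1), (wInt q (p * basisPoly q j) / normConst q j) • basisPoly q j := by
  have h := mem_basisSpan q hp
  clear hp
  induction h using Submodule.span_induction with
  | mem p hp =>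
    obtain ⟨k, hk, rfl⟩ := hp
    rw [Finset.sum_eq_single k]
    · rw [wInt_basisPoly_mul, if_pos rfl, div_self (normConst_pos q k).ne', one_smul]
    · intro j _ hj
      rw [wInt_basisPoly_mul, if_neg hj.symm, zero_div, zero_smul]
    · intro h
      exact absurd (Finset.mem_range.2 (Nat.lt_succ_of_le hk)) h
  | zero => simp
  | add p r _ _ hp hr =>
    conv_lhs => rw [hp, hr]
    rw [← Finset.sum_add_distrib]
    refine Finset.sum_congr rfl fun j _ => ?_
    rw [add_mul, map_add, add_div, add_smul]
  | smul c p _ hp =>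
    conv_lhs => rw [hp]
    rw [Finset.smul_sum]
    refine Finset.sum_congr rfl fun j _ => ?_
    rw [smul_mul_assoc, map_smul, smul_eq_mul, smul_smul, mul_div_assoc]

lemma wInt_mul_basisPoly_of_lt (q : ℕ) [Fact (1 ≤ q)] {p : ℝ[X]} {k : ℕ} (hp : p.natDegree < k) :
    wInt q (p * basisPoly q k) = 0 := by
  rw [eq_sum_basisPoly q (le_refl p.natDegree), Finset.sum_mul, map_sum]
  refine Finset.sum_eq_zero fun j hj => ?_
  have : j ≠ k := by have := Finset.mem_range.1 hj; omega
  rw [smul_mul_assoc, map_smul, wInt_basisPoly_mul, if_neg this, smul_zero]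

/-- The slice average preserves the degree bound and is symmetric under exchange of the two poles.
Paired with P_j, j < k, it can be moved onto P_j, whose image still has degree below k; so the image
of P_k is orthogonal to all lower P_j and is a multiple of P_k. The value at 1 gives the multiple.
-/
lemma sliceMean_basisPoly (q : ℕ) [Fact (1 ≤ q)] (x m : Sphere q) (k : ℕ) :
    sliceMean q (dot x m) (basisPoly q k) =
      ((basisPoly q k).eval (dot x m) / (basisPoly q k).eval 1) • basisPoly q k := by
  set K := sliceMean q (dot x m) (basisPoly q k) with hK
  have hdeg : K.natDegree ≤ k := (natDegree_sliceMean_le q _ _).trans (natDegree_basisPoly_le q k)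
  have hA := (area_pos (q - 1)).ne'
  have horth : ∀ j, j < k → wInt q (K * basisPoly q j) = 0 := by
    intro j hj
    have h1 := integral_poly_mul_poly q x m (basisPoly q j) (basisPoly q k)
    have h2 := integral_poly_mul_poly q m x (basisPoly q k) (basisPoly q j)
    rw [mul_comm (basisPoly q k), wInt_mul_basisPoly_of_lt q
      (lt_of_le_of_lt ((natDegree_sliceMean_le q _ _).trans (natDegree_basisPoly_le q j)) hj),
      mul_zero] at h2
    simp_rw [mul_comm (eval _ (basisPoly q k))] at h2
    rw [h2] at h1
    rw [mul_comm]
    exact (mul_eq_zero.1 h1.symm).resolve_left hA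
  have h := eq_sum_basisPoly q hdeg
  rw [Finset.sum_range_succ, Finset.sum_eq_zero (fun j hj => by
    rw [horth j (Finset.mem_range.1 hj), zero_div, zero_smul]), zero_add] at h
  have h1 := congrArg (eval 1) h
  rw [hK, sliceMean_eval_one, eval_smul, smul_eq_mul, ← hK] at h1
  rw [h1, mul_div_cancel_right₀ _ (basisPoly_eval_one_pos q k).ne']
  exact h

/-- The Funk–Hecke formula for polynomials. -/
lemma funk_hecke_poly (q : ℕ) [Fact (1 ≤ q)] (x m : Sphere q) (k : ℕ) (f : ℝ[X]) :
    ∫ y, (basisPoly q k).eval (dot x y) * f.eval (dot m y) ∂(surface q) =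
      area (q - 1) / (basisPoly q k).eval 1 * (basisPoly q k).eval (dot x m) *
        wInt q (f * basisPoly q k) := by
  have h := integral_poly_mul_poly q m x f (basisPoly q k)
  simp_rw [mul_comm (eval _ f)] at h
  rw [h, sliceMean_basisPoly, mul_smul_comm, map_smul, smul_eq_mul, dot_comm m x]
  ring

/-- Funk–Hecke applied to P_k itself makes P_k(x'm)/P_k(1) a normalised inner product of y ↦
P_k(x'y) and y ↦ P_k(m'y). These two functions have equal norm, so the bound 2|uv| ≤ u² + v² gives
the Cauchy–Schwarz estimate. -/
lemma abs_eval_basisPoly_le (q : ℕ) [Fact (1 ≤ q)] (k : ℕ) {t : ℝ} (ht : t ∈ Set.Icc (-1 : ℝ) 1) :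
    |(basisPoly q k).eval t| ≤ (basisPoly q k).eval 1 := by
  obtain ⟨x⟩ : Nonempty (Sphere q) := ⟨⟨EuclideanSpace.single 0 1, by simp⟩⟩
  obtain ⟨m, rfl⟩ := exists_dot_eq x ht
  have hself : ∀ z : Sphere q, ∫ y, (basisPoly q k).eval (dot z y) ^ 2 ∂(surface q) =
      area (q - 1) * normConst q k := by
    intro z
    have h := funk_hecke_poly q z z k (basisPoly q k)
    rw [wInt_basisPoly_mul, if_pos rfl, dot_self,
      div_mul_cancel₀ _ (basisPoly_eval_one_pos q k).ne'] at h
    simpa only [sq] using h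
  have hpos : 0 < area (q - 1) * normConst q k := mul_pos (area_pos _) (normConst_pos q k)
  have h := funk_hecke_poly q x m k (basisPoly q k)
  rw [wInt_basisPoly_mul, if_pos rfl] at h
  have hi : ∀ z : Sphere q, Integrable (fun y => (basisPoly q k).eval (dot z y) ^ 2) (surface q) :=
    fun z => integrable_surface_of_continuous (by fun_prop)
  have hle : |∫ y, (basisPoly q k).eval (dot x y) * (basisPoly q k).eval (dot m y) ∂(surface q)| ≤
      area (q - 1) * normConst q k := by
    refine abs_integral_le_integral_abs.trans ?_
    calc _ ≤ ∫ y, ((basisPoly q k).eval (dot x y) ^ 2 + (basisPoly q k).eval (dot m y) ^ 2) / 2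
          ∂(surface q) := by
          refine integral_mono (integrable_surface_of_continuous (by fun_prop))
            (((hi x).add (hi m)).div_const 2) fun y => ?_
          simp only [abs_mul]
          nlinarith [sq_nonneg (|(basisPoly q k).eval (dot x y)| - |(basisPoly q k).eval (dot m y)|),
            sq_abs ((basisPoly q k).eval (dot x y)), sq_abs ((basisPoly q k).eval (dot m y))]
      _ = _ := by
          rw [integral_div, integral_add (hi x) (hi m), hself, hself]
          ring
  have h1 := basisPoly_eval_one_pos q k
  rw [h, show area (q - 1) / eval 1 (basisPoly q k) * eval (dot x m) (basisPoly q k) * normConst q k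
    = area (q - 1) * normConst q k * (eval (dot x m) (basisPoly q k) / eval 1 (basisPoly q k)) by
      ring, abs_mul, abs_of_pos hpos, abs_div, abs_of_pos h1] at hle
  have := (mul_le_iff_le_one_right hpos).1 hle
  rwa [div_le_one h1] at this

/-! ### The Funk–Hecke formula for integrable profiles -/

/-- Finite measures on `[-1, 1]` are determined by the integrals of polynomials. -/
lemma measure_ext_of_polynomial {μ₁ μ₂ : Measure ℝ} [IsFiniteMeasure μ₁] [IsFiniteMeasure μ₂]
    (h₁ : ∀ᵐ x ∂μ₁, x ∈ Set.Icc (-1 : ℝ) 1) (h₂ : ∀ᵐ x ∂μ₂, x ∈ Set.Icc (-1 : ℝ) 1)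
    (h : ∀ p : ℝ[X], ∫ x, p.eval x ∂μ₁ = ∫ x, p.eval x ∂μ₂) : μ₁ = μ₂ := by
  refine ext_of_forall_integral_eq_of_IsFiniteMeasure fun f => ?_
  have bound : ∀ μ : Measure ℝ, IsFiniteMeasure μ → (∀ᵐ x ∂μ, x ∈ Set.Icc (-1 : ℝ) 1) →
      ∀ ε > 0, ∀ p : ℝ[X], (∀ x ∈ Set.Icc (-1 : ℝ) 1, |p.eval x - f x| < ε) →
      |∫ x, p.eval x ∂μ - ∫ x, f x ∂μ| ≤ ε * μ.real Set.univ := by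
    intro μ _ hμ ε hε p hp
    have hip : Integrable (fun x => p.eval x) μ := by
      obtain ⟨D, hD⟩ := isCompact_Icc.exists_bound_of_continuousOn (s := Set.Icc (-1 : ℝ) 1)
        p.continuous.continuousOn
      exact Integrable.of_bound p.continuous.aestronglyMeasurable D (hμ.mono hD)
    rw [← integral_sub hip (f.integrable μ), ← Real.norm_eq_abs]
    exact norm_integral_le_of_norm_le_const (hμ.mono fun x hx => (hp x hx).le)
  by_contra hne
  set d := |∫ x, f x ∂μ₁ - ∫ x, f x ∂μ₂| with hd
  have hd0 : 0 < d := abs_pos.2 (sub_ne_zero.2 hne)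
  -- The extra 1 makes the total error of a (d/M)-approximation at most d - d/M, strictly below d.
  set M := μ₁.real Set.univ + μ₂.real Set.univ + 1 with hM
  have hM0 : 0 < M := by positivity
  obtain ⟨p, hp⟩ := exists_polynomial_near_of_continuousOn (-1) 1 f f.continuous.continuousOn
    (d / M) (by positivity)
  have b1 := bound μ₁ inferInstance h₁ _ (by positivity) p hp
  have b2 := bound μ₂ inferInstance h₂ _ (by positivity) p hp
  rw [h p] at b1
  have : d ≤ d / M * (M - 1) := by
    calc d = |(∫ x, p.eval x ∂μ₂ - ∫ x, f x ∂μ₂) - (∫ x, p.eval x ∂μ₂ - ∫ x, f x ∂μ₁)| := by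
          rw [hd]; congr 1; ring
      _ ≤ _ := (abs_sub _ _).trans (add_le_add b2 b1)
      _ = _ := by rw [hM]; ring
  have e : d / M * (M - 1) = d - d / M := by field_simp
  have : 0 < d / M := by positivity
  linarith

/-- An identity for polynomial test functions becomes an identity of image measures, since
polynomials determine finite measures on [-1,1]. Arbitrary integrable test functions can then be
used. -/
lemma map_dot_withDensity (q : ℕ) [Fact (1 ≤ q)] (m : Sphere q) (d : Sphere q → ℝ) (hd : Continuous d)
    (hd0 : ∀ y, 0 ≤ d y) (r : ℝ[X]) (hr0 : ∀ t ∈ Set.Icc (-1 : ℝ) 1, 0 ≤ r.eval t)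
    (h : ∀ f : ℝ[X], ∫ y, d y * f.eval (dot m y) ∂(surface q) = area (q - 1) * wInt q (f * r)) :
    ((surface q).withDensity fun y => ENNReal.ofReal (d y)).map (fun y => dot m y) =
      (weightMeasure q).withDensity fun t => ENNReal.ofReal (area (q - 1) * r.eval t) := by
  have hA := area_pos (q - 1)
  have hm : Measurable fun y => dot m y := (continuous_dot_right m).measurable
  have i1 : IsFiniteMeasure ((surface q).withDensity fun y => ENNReal.ofReal (d y)) :=
    isFiniteMeasure_withDensity_ofReal (integrable_surface_of_continuous hd).2
  have i2 : IsFiniteMeasure ((weightMeasure q).withDensity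
      fun t => ENNReal.ofReal (area (q - 1) * r.eval t)) :=
    isFiniteMeasure_withDensity_ofReal
      (integrable_of_continuous q (by fun_prop : Continuous fun t => area (q - 1) * r.eval t)).2
  have i3 := Measure.isFiniteMeasure_map ((surface q).withDensity fun y => ENNReal.ofReal (d y))
    (fun y => dot m y)
  refine measure_ext_of_polynomial ?_ ?_ fun f => ?_
  · exact (ae_map_iff hm.aemeasurable measurableSet_Icc).2 (.of_forall fun y => dot_mem_Icc m y)
  · exact (withDensity_absolutelyContinuous _ _).ae_le (ae_mem_Icc_weightMeasure q)
  · rw [integral_map hm.aemeasurable f.continuous.aestronglyMeasurable,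
      integral_withDensity_eq_integral_toReal_smul (by fun_prop) (by simp),
      integral_withDensity_eq_integral_toReal_smul (by fun_prop) (by simp)]
    simp only [ENNReal.toReal_ofReal (hd0 _), smul_eq_mul]
    rw [h f, wInt_apply, ← integral_const_mul]
    refine integral_congr_ae ?_
    filter_upwards [ae_mem_Icc_weightMeasure q] with t ht
    rw [ENNReal.toReal_ofReal (mul_nonneg hA.le (hr0 t ht)), eval_mul]
    ring

/-- Zonal functions are integrated through the weight (for the law of the cosine). -/
lemma map_dot_surface (q : ℕ) [Fact (1 ≤ q)] (m : Sphere q) :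
    (surface q).map (fun y => dot m y) = ENNReal.ofReal (area (q - 1)) • weightMeasure q := by
  have h := map_dot_withDensity q m (fun _ => 1) continuous_const (fun _ => zero_le_one) 1
    (by simp) (fun f => by
      have h := integral_poly_mul_poly q m m f 1
      rw [sliceMean_one] at h
      simpa [mul_comm] using h)
  simp only [ENNReal.ofReal_one, eval_one, mul_one] at h
  rw [withDensity_const, withDensity_const, one_smul] at h
  exact h

lemma integrable_mul_of_continuous {q : ℕ} {g : ℝ → ℝ} (hg : Integrable g (weightMeasure q)) {f : ℝ → ℝ}
    (hf : Continuous f) : Integrable (fun t => f t * g t) (weightMeasure q) := by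
  obtain ⟨D, hD⟩ := isCompact_Icc.exists_bound_of_continuousOn (s := Set.Icc (-1 : ℝ) 1)
    hf.continuousOn
  exact hg.bdd_mul hf.aestronglyMeasurable ((ae_mem_Icc_weightMeasure q).mono hD)

section Zonal

variable {q : ℕ} [Fact (1 ≤ q)] (m : Sphere q) {g : ℝ → ℝ}

lemma ae_dot_of_ae_weightMeasure {p : ℝ → Prop} (h : ∀ᵐ t ∂(weightMeasure q), p t) :
    ∀ᵐ y ∂(surface q), p (dot m y) := by
  refine ae_of_ae_map (continuous_dot_right m).measurable.aemeasurable ?_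
  rw [map_dot_surface]
  exact Measure.ae_smul_measure h _

lemma aestronglyMeasurable_comp_dot (hg : AEStronglyMeasurable g (weightMeasure q)) :
    AEStronglyMeasurable (fun y => g (dot m y)) (surface q) := by
  refine AEStronglyMeasurable.comp_measurable (f := fun y => dot m y) ?_
    (continuous_dot_right m).measurable
  rw [map_dot_surface]
  exact hg.smul_measure _

lemma integrable_comp_dot (hg : Integrable g (weightMeasure q)) :
    Integrable (fun y => g (dot m y)) (surface q) := by
  refine Integrable.comp_measurable (f := fun y => dot m y) ?_
    (continuous_dot_right m).measurable
  rw [map_dot_surface]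
  exact hg.smul_measure (by simp)

lemma integral_comp_dot (hg : Integrable g (weightMeasure q)) :
    ∫ y, g (dot m y) ∂(surface q) = area (q - 1) * ∫ t, g t ∂(weightMeasure q) := by
  rw [← integral_map (φ := fun y => dot m y) (f := g)
    (continuous_dot_right m).measurable.aemeasurable
    (by rw [map_dot_surface]; exact hg.aestronglyMeasurable.smul_measure _),
    map_dot_surface, integral_smul_measure, ENNReal.toReal_ofReal (area_pos _).le, smul_eq_mul]

/-- The Funk–Hecke formula. -/
lemma funk_hecke (hg : Integrable g (weightMeasure q)) (x : Sphere q) (k : ℕ) :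
    ∫ y, (basisPoly q k).eval (dot x y) * g (dot m y) ∂(surface q) =
      area (q - 1) / (basisPoly q k).eval 1 * (basisPoly q k).eval (dot x m) *
        ∫ t, (basisPoly q k).eval t * g t ∂(weightMeasure q) := by
  have h1 := basisPoly_eval_one_pos q k
  have hA := area_pos (q - 1)
  set B := (basisPoly q k).eval 1 with hB
  set s := (basisPoly q k).eval (dot x m) with hs
  have hs1 : |s| ≤ B := abs_eval_basisPoly_le q k (dot_mem_Icc x m)
  -- P_k(x'y) changes sign and is no density; adding its bound B = P_k(1) makes it nonnegative. On
  -- the line the corresponding density is B + (s/B) P_k(t), and the known constant part is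
  -- subtracted at the end.
  have hr : ∀ t, (C B + C (s / B) * basisPoly q k).eval t = B + s / B * (basisPoly q k).eval t := by
    intro t; simp
  have hsB : |s / B| ≤ 1 := by rw [abs_div, abs_of_pos h1, div_le_one h1]; exact hs1
  have hd0 : ∀ y, 0 ≤ B + (basisPoly q k).eval (dot x y) := fun y => by
    have := abs_le.1 (abs_eval_basisPoly_le q k (dot_mem_Icc x y))
    linarith [this.1]
  have hr0 : ∀ t ∈ Set.Icc (-1 : ℝ) 1, 0 ≤ (C B + C (s / B) * basisPoly q k).eval t := by
    intro t ht
    rw [hr]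
    have h2 : |s / B * (basisPoly q k).eval t| ≤ 1 * B := by
      rw [abs_mul]
      exact mul_le_mul hsB (abs_eval_basisPoly_le q k ht) (abs_nonneg _) zero_le_one
    linarith [(abs_le.1 h2).1]
  have hc : Continuous fun y => B + (basisPoly q k).eval (dot x y) := by fun_prop
  have key := map_dot_withDensity q m (fun y => B + (basisPoly q k).eval (dot x y)) hc hd0
    (C B + C (s / B) * basisPoly q k) hr0 (fun f => by
      have e1 := integral_comp_dot m (integrable_of_continuous q f.continuous)
      have e2 := funk_hecke_poly q x m k f
      simp only [add_mul]
      rw [integral_add (integrable_surface_of_continuous (by fun_prop))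
        (integrable_surface_of_continuous (by fun_prop)), integral_const_mul, e1, e2, mul_add,
        map_add, mul_comm f (C B), ← smul_eq_C_mul, map_smul, mul_left_comm f, ← smul_eq_C_mul,
        map_smul, wInt_apply q f, ← hB, ← hs]
      simp only [smul_eq_mul]
      ring)
  have hgm : AEStronglyMeasurable g ((weightMeasure q).withDensity
      fun t => ENNReal.ofReal (area (q - 1) * (C B + C (s / B) * basisPoly q k).eval t)) :=
    hg.aestronglyMeasurable.mono_ac (withDensity_absolutelyContinuous _ _)
  have e3 := integral_map (μ := (surface q).withDensity
    fun y => ENNReal.ofReal (B + (basisPoly q k).eval (dot x y))) (φ := fun y => dot m y) (f := g)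
    (continuous_dot_right m).measurable.aemeasurable (by rw [key]; exact hgm)
  rw [key, integral_withDensity_eq_integral_toReal_smul (by fun_prop) (by simp),
    integral_withDensity_eq_integral_toReal_smul (by fun_prop) (by simp)] at e3
  have e4 : ∫ t, (ENNReal.ofReal (area (q - 1) * (C B + C (s / B) * basisPoly q k).eval t)).toReal • g t
      ∂(weightMeasure q) = area (q - 1) * (B * ∫ t, g t ∂(weightMeasure q) +
        s / B * ∫ t, (basisPoly q k).eval t * g t ∂(weightMeasure q)) := by
    rw [← integral_const_mul, ← integral_const_mul, ← integral_add (hg.const_mul _)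
      ((integrable_mul_of_continuous hg (basisPoly q k).continuous).const_mul _),
      ← integral_const_mul]
    refine integral_congr_ae ?_
    filter_upwards [ae_mem_Icc_weightMeasure q] with t ht
    rw [ENNReal.toReal_ofReal (mul_nonneg hA.le (hr0 t ht)), hr, smul_eq_mul]
    ring
  have hi : Integrable (fun y => (basisPoly q k).eval (dot x y) * g (dot m y)) (surface q) := by
    refine (integrable_comp_dot m hg).bdd_mul (c := B) ?_ (.of_forall fun y => ?_)
    · exact (Continuous.aestronglyMeasurable (by fun_prop))
    · exact abs_eval_basisPoly_le q k (dot_mem_Icc x y)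
  simp only [ENNReal.toReal_ofReal (hd0 _), smul_eq_mul, add_mul] at e3
  rw [integral_add ((integrable_comp_dot m hg).const_mul _) hi, integral_const_mul,
    integral_comp_dot m hg] at e3
  simp only [smul_eq_mul] at e4
  rw [e4] at e3
  field_simp at e3 ⊢
  linarith

end Zonal

/-! ### Analytic kernels and convergence of their series -/

/-- A function on `[-1, 1]` that extends holomorphically to a disc of radius larger than `1`. -/
def ExtendsAnalytically (F : ℝ → ℝ) : Prop :=
  ∃ R : ℝ, 1 < R ∧ ∃ f : ℂ → ℂ, DifferentiableOn ℂ f (Metric.closedBall 0 R) ∧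
    ∀ x ∈ Set.Icc (-1 : ℝ) 1, f x = F x

lemma ExtendsAnalytically.sq {F : ℝ → ℝ} (hF : ExtendsAnalytically F) :
    ExtendsAnalytically fun x => F x ^ 2 := by
  obtain ⟨R, hR, f, hf, h⟩ := hF
  exact ⟨R, hR, fun z => f z ^ 2, hf.pow 2, fun x hx => by simp [h x hx]⟩

lemma ExtendsAnalytically.continuousOn {F : ℝ → ℝ} (hF : ExtendsAnalytically F) :
    ContinuousOn F (Set.Icc (-1) 1) := by
  obtain ⟨R, hR, f, hf, h⟩ := hF
  have h1 : ContinuousOn (fun x : ℝ => (f x).re) (Set.Icc (-1) 1) := by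
    refine Complex.continuous_re.comp_continuousOn
      (hf.continuousOn.comp Complex.continuous_ofReal.continuousOn fun x hx => ?_)
    rw [mem_closedBall_zero_iff, Complex.norm_real, Real.norm_eq_abs]
    exact (abs_le.2 hx).trans hR.le
  exact h1.congr fun x hx => by simp [h x hx]

lemma extendsAnalytically_smoothMaxKernel (κ : ℝ) :
    ExtendsAnalytically fun x => smoothMaxKernel κ (Real.arccos x) := by
  refine ⟨2, by norm_num, fun z => Complex.exp (κ * (z - 1)), by fun_prop, fun x hx => ?_⟩
  simp [smoothMaxKernel, Real.cos_arccos hx.1 hx.2]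

lemma extendsAnalytically_poissonKernel (q : ℕ) {ρ : ℝ} (h0 : 0 < ρ) (h1 : ρ < 1) :
    ExtendsAnalytically fun x => poissonKernel q ρ (Real.arccos x) := by
  -- The base of the power vanishes at z = (1+ρ²)/(2ρ) > 1. R is the midpoint between 1 and this
  -- point; on the disc the base has positive real part, so the principal power is holomorphic.
  set R : ℝ := (1 + (1 + ρ ^ 2) / (2 * ρ)) / 2 with hR
  have h2 : 1 < (1 + ρ ^ 2) / (2 * ρ) := by
    rw [lt_div_iff₀ (by positivity)]; nlinarith [sq_pos_of_pos (sub_pos.2 h1)]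
  have h3 : 2 * ρ * R < 1 + ρ ^ 2 := by
    have : R < (1 + ρ ^ 2) / (2 * ρ) := by rw [hR]; linarith
    rw [lt_div_iff₀ (by positivity)] at this
    linarith
  have hre : ∀ z ∈ Metric.closedBall (0 : ℂ) R, 0 < (1 - 2 * ρ * z + ρ ^ 2 : ℂ).re := by
    intro z hz
    rw [mem_closedBall_zero_iff] at hz
    have h4 : (1 - 2 * ρ * z + ρ ^ 2 : ℂ).re = 1 + ρ ^ 2 - 2 * ρ * z.re := by
      have e : (1 - 2 * ρ * z + ρ ^ 2 : ℂ) = ((1 + ρ ^ 2 : ℝ) : ℂ) - ((2 * ρ : ℝ) : ℂ) * z := by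
        push_cast; ring
      rw [e, Complex.sub_re, Complex.re_ofReal_mul, Complex.ofReal_re]
    have h5 := (Complex.re_le_norm z).trans hz
    rw [h4]
    nlinarith
  refine ⟨R, by rw [hR]; linarith, fun z => (1 - ρ ^ 2) / (1 - 2 * ρ * z + ρ ^ 2) ^
    ((((q : ℝ) + 1) / 2 : ℝ) : ℂ), ?_, fun x hx => ?_⟩
  · refine DifferentiableOn.div (by fun_prop) ?_ fun z hz => ?_
    · exact DifferentiableOn.cpow (by fun_prop) (by fun_prop) fun z hz => Or.inl (hre z hz)
    · have h6 : (1 - 2 * ρ * z + ρ ^ 2 : ℂ) ≠ 0 := fun h => by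
        have := hre z hz
        rw [h] at this
        simp at this
      simp [Complex.cpow_eq_zero_iff, h6]
  · have h7 : 0 ≤ 1 - 2 * ρ * x + ρ ^ 2 := by nlinarith [hx.1, hx.2, sq_nonneg (1 - ρ)]
    simp only [poissonKernel, Real.cos_arccos hx.1 hx.2]
    push_cast [Complex.ofReal_cpow h7]
    rfl

lemma IsTestKernel.extendsAnalytically {q : ℕ} {ψ : ℝ → ℝ} (h : IsTestKernel q ψ) :
    ExtendsAnalytically fun x => ψ (Real.arccos x) := by
  rcases h with ⟨κ, -, rfl⟩ | ⟨ρ, h0, h1, rfl⟩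
  · exact extendsAnalytically_smoothMaxKernel κ
  · exact extendsAnalytically_poissonKernel q h0 h1

/-- Geometric approximation by polynomials. -/
lemma ExtendsAnalytically.exists_approx {F : ℝ → ℝ} (hF : ExtendsAnalytically F) :
    ∃ a : ℝ, 0 < a ∧ a < 1 ∧ ∃ D : ℝ, 0 ≤ D ∧ ∀ n : ℕ, ∃ p : ℝ[X], p.degree < n ∧
      ∀ x ∈ Set.Icc (-1 : ℝ) 1, |F x - p.eval x| ≤ D * a ^ n := by
  obtain ⟨R, hR, f, hf, h⟩ := hF
  lift R to NNReal using by linarith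
  have hps := DifferentiableOn.hasFPowerSeriesOnBall (R := R) (c := 0) (f := f) hf
    (by exact_mod_cast (by linarith : (0 : ℝ) < R))
  -- The radius (1+R)/2 lies strictly between 1 and R, so the open ball still contains [-1,1].
  obtain ⟨a, ha, D, hD, key⟩ := hps.uniform_geometric_approx (r' := (1 + R) / 2)
    (ENNReal.coe_lt_coe.2 (by
      rw [← NNReal.coe_lt_coe]
      push_cast
      linarith))
  refine ⟨a, ha.1, ha.2, D, hD.le, fun n => ?_⟩
  set s := cauchyPowerSeries f 0 R with hs
  -- F is real on [-1,1], so taking real parts of the Taylor coefficients does not enlarge the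
  -- error.
  refine ⟨∑ k ∈ Finset.range n, C (s.coeff k).re * X ^ k, ?_, fun x hx => ?_⟩
  · refine (degree_sum_le _ _).trans_lt ?_
    refine (Finset.sup_lt_iff (WithBot.bot_lt_coe n)).2 fun k hk => ?_
    refine (degree_C_mul_X_pow_le _ _).trans_lt ?_
    exact WithBot.coe_lt_coe.2 (Finset.mem_range.1 hk)
  · have hx' : (x : ℂ) ∈ Metric.ball (0 : ℂ) ((1 + R) / 2 : NNReal) := by
      push_cast
      rw [mem_ball_zero_iff, Complex.norm_real, Real.norm_eq_abs]
      exact (abs_le.2 hx).trans_lt (by linarith)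
    have h1 := key x hx' n
    refine le_trans ?_ h1
    rw [zero_add, h x hx, FormalMultilinearSeries.partialSum]
    refine le_trans (le_of_eq ?_) (Complex.abs_re_le_norm _)
    congr 1
    rw [Complex.sub_re, Complex.ofReal_re, Complex.re_sum, eval_finsetSum]
    congr 1
    refine Finset.sum_congr rfl fun k _ => ?_
    rw [FormalMultilinearSeries.apply_eq_pow_smul_coeff, smul_eq_mul, ← Complex.ofReal_pow,
      Complex.re_ofReal_mul]
    rw [eval_mul, eval_C, eval_pow, eval_X, mul_comm]

lemma coeff_eq (q : ℕ) (h : ℝ → ℝ) (k : ℕ) :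
    coeff q h k = (normConst q k)⁻¹ * ∫ t, h t * (basisPoly q k).eval t ∂(weightMeasure q) := by
  rw [coeff, intervalIntegral_mul_weight q fun x => h x * (basisPoly q k).eval x]

lemma integrable_of_continuousOn (q : ℕ) [Fact (1 ≤ q)] {F : ℝ → ℝ}
    (hF : ContinuousOn F (Set.Icc (-1) 1)) : Integrable F (weightMeasure q) := by
  obtain ⟨C, hC⟩ := isCompact_Icc.exists_bound_of_continuousOn hF
  exact Integrable.of_bound ((hF.aestronglyMeasurable measurableSet_Icc).mono_ac
    (withDensity_absolutelyContinuous _ _)) C ((ae_mem_Icc_weightMeasure q).mono hC)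

lemma coeff_sub_polynomial (q : ℕ) [Fact (1 ≤ q)] {F : ℝ → ℝ}
    (hF : ContinuousOn F (Set.Icc (-1) 1)) (p : ℝ[X]) (k : ℕ) {ε : ℝ}
    (h : ∀ x ∈ Set.Icc (-1 : ℝ) 1, |F x - p.eval x| ≤ ε) :
    |coeff q F k - wInt q (p * basisPoly q k) / normConst q k| ≤
      (basisPoly q k).eval 1 / normConst q k * (ε * wInt q 1) := by
  have hc := normConst_pos q k
  have hP := basisPoly_eval_one_pos q k
  have e : coeff q F k - wInt q (p * basisPoly q k) / normConst q k = (normConst q k)⁻¹ *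
      ∫ t, (F t - p.eval t) * (basisPoly q k).eval t ∂(weightMeasure q) := by
    have hi : Integrable (fun t => F t * (basisPoly q k).eval t) (weightMeasure q) :=
      integrable_of_continuousOn q (hF.mul (basisPoly q k).continuous.continuousOn)
    rw [coeff_eq, wInt_apply, div_eq_inv_mul, ← mul_sub, ← integral_sub hi
      (integrable_of_continuous q (p * basisPoly q k).continuous)]
    congr 2
    funext t
    rw [eval_mul]; ring
  have h1 : |∫ t, (F t - p.eval t) * (basisPoly q k).eval t ∂(weightMeasure q)| ≤
      ε * (basisPoly q k).eval 1 * (weightMeasure q).real Set.univ := by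
    rw [← Real.norm_eq_abs]
    refine norm_integral_le_of_norm_le_const ?_
    filter_upwards [ae_mem_Icc_weightMeasure q] with t ht
    rw [norm_mul]
    exact mul_le_mul (h t ht) (abs_eval_basisPoly_le q k ht) (norm_nonneg _)
      ((abs_nonneg _).trans (h t ht))
  have h2 : (weightMeasure q).real Set.univ = wInt q 1 := by simp [wInt_apply]
  rw [h2] at h1
  rw [e, abs_mul, abs_of_pos (inv_pos.2 hc)]
  calc _ ≤ (normConst q k)⁻¹ * (ε * (basisPoly q k).eval 1 * wInt q 1) := by gcongr
    _ = _ := by ring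

lemma summable_pow_mul_geometric (N : ℕ) {a : ℝ} (h0 : 0 < a) (h1 : a < 1) :
    Summable fun k : ℕ => ((k : ℝ) + 1) ^ N * a ^ k := by
  have h := (summable_nat_add_iff 1).2 (summable_pow_mul_geometric_of_norm_lt_one (R := ℝ) N (r := a)
    (by rwa [Real.norm_eq_abs, abs_of_pos h0]))
  refine (h.mul_left a⁻¹).congr fun k => ?_
  push_cast
  rw [pow_succ]
  field_simp

/-- The coefficients of a function with an analytic extension decay geometrically. -/
lemma ExtendsAnalytically.coeff_decay (q : ℕ) [Fact (1 ≤ q)] {F : ℝ → ℝ}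
    (hF : ExtendsAnalytically F) :
    ∃ a : ℝ, 0 < a ∧ a < 1 ∧ ∃ D : ℝ, 0 ≤ D ∧ ∀ k : ℕ, |coeff q F k| ≤ D * ((k : ℝ) + 1) * a ^ k := by
  obtain ⟨a, ha0, ha1, D, hD, h⟩ := hF.exists_approx
  obtain ⟨A, hA, hA'⟩ := exists_eval_one_div_normConst_le q
  have hV := wInt_one_pos q
  refine ⟨a, ha0, ha1, A * D * wInt q 1, by positivity, fun k => ?_⟩
  obtain ⟨p, hp, hpF⟩ := h k
  -- The approximant has degree below k, hence no component along P_k; the coefficient of F is that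
  -- of the error alone.
  have h0 : wInt q (p * basisPoly q k) = 0 := by
    by_cases hp0 : p = 0
    · simp [hp0]
    · exact wInt_mul_basisPoly_of_lt q ((natDegree_lt_iff_degree_lt hp0).2 hp)
  have h1 := coeff_sub_polynomial q hF.continuousOn p k hpF
  rw [h0, zero_div, sub_zero] at h1
  refine h1.trans ?_
  calc _ ≤ A * ((k : ℝ) + 1) * (D * a ^ k * wInt q 1) := by
        gcongr
        exact hA' k
    _ = _ := by ring

lemma ExtendsAnalytically.summable_coeff (q : ℕ) [Fact (1 ≤ q)] {F : ℝ → ℝ}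
    (hF : ExtendsAnalytically F) :
    Summable fun k => |coeff q F k| * (basisPoly q k).eval 1 := by
  obtain ⟨a, ha0, ha1, D, hD, h⟩ := hF.coeff_decay q
  refine Summable.of_nonneg_of_le
    (fun k => mul_nonneg (abs_nonneg _) (basisPoly_eval_one_pos q k).le) (fun k => ?_)
    ((summable_pow_mul_geometric (q + 1) ha0 ha1).mul_left D)
  calc _ ≤ D * ((k : ℝ) + 1) * a ^ k * ((k : ℝ) + 1) ^ q :=
        mul_le_mul (h k) (basisPoly_eval_one_le q k) (basisPoly_eval_one_pos q k).le (by positivity)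
    _ = _ := by ring

/-- Pointwise convergence of the Gegenbauer series. -/
lemma ExtendsAnalytically.hasSum (q : ℕ) [Fact (1 ≤ q)] {F : ℝ → ℝ}
    (hF : ExtendsAnalytically F) {t : ℝ} (ht : t ∈ Set.Icc (-1 : ℝ) 1) :
    HasSum (fun k => coeff q F k * (basisPoly q k).eval t) (F t) := by
  have hs : Summable fun k => ‖coeff q F k * (basisPoly q k).eval t‖ := by
    refine Summable.of_nonneg_of_le (fun _ => norm_nonneg _) (fun k => ?_) (hF.summable_coeff q)
    rw [norm_mul]
    exact mul_le_mul_of_nonneg_left (abs_eval_basisPoly_le q k ht) (abs_nonneg _)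
  rw [hasSum_iff_tendsto_nat_of_summable_norm hs]
  obtain ⟨a, ha0, ha1, D, hD, h⟩ := hF.exists_approx
  obtain ⟨A, hA, hA'⟩ := exists_eval_one_div_normConst_le q
  have hV := wInt_one_pos q
  -- The first term bounds F - p. The second bounds n coefficient errors, each of size n · aⁿ times
  -- a polynomial value at most n^q; hence the exponent q + 2.
  have hlim : Filter.Tendsto (fun n : ℕ => D * a ^ n + A * D * wInt q 1 * ((n : ℝ) ^ (q + 2) * a ^ n))
      Filter.atTop (nhds 0) := by
    have h1 := (tendsto_pow_atTop_nhds_zero_of_lt_one ha0.le ha1).const_mul D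
    have h2 := (tendsto_pow_const_mul_const_pow_of_abs_lt_one (q + 2) (r := a)
      (by rwa [abs_of_pos ha0])).const_mul (A * D * wInt q 1)
    simpa using h1.add h2
  rw [tendsto_iff_norm_sub_tendsto_zero]
  refine squeeze_zero (fun _ => norm_nonneg _) (fun n => ?_) hlim
  rw [norm_sub_rev, Real.norm_eq_abs]
  obtain ⟨p, hp, hpF⟩ := h n
  have hpe : p.eval t = ∑ k ∈ Finset.range n,
      wInt q (p * basisPoly q k) / normConst q k * (basisPoly q k).eval t := by
    by_cases hp0 : p = 0
    · simp [hp0]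
    · have hd := (natDegree_lt_iff_degree_lt hp0).2 hp
      cases n with
      | zero => omega
      | succ n =>
        have := congrArg (eval t) (eq_sum_basisPoly q (Nat.lt_succ_iff.1 hd))
        simpa [eval_finsetSum] using this
  -- The n-th partial sum reproduces p, so the remainder of F equals the remainder of F - p.
  have e : F t - ∑ k ∈ Finset.range n, coeff q F k * (basisPoly q k).eval t = (F t - p.eval t) -
      ∑ k ∈ Finset.range n, (coeff q F k - wInt q (p * basisPoly q k) / normConst q k) *
        (basisPoly q k).eval t := by
    rw [hpe, sub_sub, ← Finset.sum_add_distrib]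
    congr 1
    exact Finset.sum_congr rfl fun k _ => by ring
  rw [e]
  refine (abs_sub _ _).trans (add_le_add (hpF t ht) ((Finset.abs_sum_le_sum_abs _ _).trans ?_))
  have hterm : ∀ k ∈ Finset.range n,
      |(coeff q F k - wInt q (p * basisPoly q k) / normConst q k) * (basisPoly q k).eval t| ≤
        A * D * wInt q 1 * ((n : ℝ) ^ (q + 1) * a ^ n) := by
    intro k hk
    have hk : (k : ℝ) + 1 ≤ n := by exact_mod_cast Finset.mem_range.1 hk
    rw [abs_mul]
    calc _ ≤ (A * ((k : ℝ) + 1) * (D * a ^ n * wInt q 1)) * ((k : ℝ) + 1) ^ q := by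
          refine mul_le_mul ((coeff_sub_polynomial q hF.continuousOn p k hpF).trans ?_)
            ((abs_eval_basisPoly_le q k ht).trans (basisPoly_eval_one_le q k)) (abs_nonneg _)
            (by positivity)
          gcongr
          exact hA' k
      _ ≤ (A * n * (D * a ^ n * wInt q 1)) * (n : ℝ) ^ q := by gcongr
      _ = _ := by ring
  refine (Finset.sum_le_card_nsmul _ _ _ hterm).trans (le_of_eq ?_)
  rw [Finset.card_range, nsmul_eq_mul]
  ring

/-! ### Integration against the rotationally symmetric law -/

section Law

variable {q : ℕ} [Fact (1 ≤ q)] {m : Sphere q} {g : ℝ → ℝ}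

lemma integral_rotSymLaw (hg : Integrable g (weightMeasure q))
    (hg0 : ∀ᵐ t ∂(weightMeasure q), 0 ≤ g t) (φ : Sphere q → ℝ) :
    ∫ x, φ x ∂(rotSymLaw m g) = ∫ x, φ x * g (dot m x) ∂(surface q) := by
  have hm := aestronglyMeasurable_comp_dot m hg.aestronglyMeasurable
  have h0 := ae_dot_of_ae_weightMeasure m hg0
  simp only [rotSymLaw, dot_comm _ m]
  rw [integral_withDensity_eq_integral_toReal_smul₀ hm.aemeasurable.ennreal_ofReal (by simp)]
  refine integral_congr_ae ?_
  filter_upwards [h0] with x hx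
  rw [ENNReal.toReal_ofReal hx, smul_eq_mul, mul_comm]

lemma integral_mul_eq_normConst_mul_coeff (q : ℕ) [Fact (1 ≤ q)] (g : ℝ → ℝ) (k : ℕ) :
    ∫ t, (basisPoly q k).eval t * g t ∂(weightMeasure q) = normConst q k * coeff q g k := by
  rw [coeff_eq, mul_inv_cancel_left₀ (normConst_pos q k).ne']
  simp_rw [mul_comm]

lemma integral_basisPoly_rotSymLaw (hg : Integrable g (weightMeasure q))
    (hg0 : ∀ᵐ t ∂(weightMeasure q), 0 ≤ g t) (x : Sphere q) (k : ℕ) :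
    ∫ y, (basisPoly q k).eval (dot x y) ∂(rotSymLaw m g) =
      hecke q k * coeff q g k * (basisPoly q k).eval (dot x m) := by
  rw [integral_rotSymLaw hg hg0, funk_hecke m hg, integral_mul_eq_normConst_mul_coeff, hecke]
  ring

lemma integral_zonal_rotSymLaw (hg : Integrable g (weightMeasure q))
    (hg0 : ∀ᵐ t ∂(weightMeasure q), 0 ≤ g t) {f : ℝ → ℝ} (hf : Continuous f) :
    ∫ x, f (dot x m) ∂(rotSymLaw m g) =
      area (q - 1) * ∫ t, f t * g t ∂(weightMeasure q) := by
  rw [integral_rotSymLaw hg hg0]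
  simp_rw [dot_comm _ m]
  exact integral_comp_dot m (integrable_mul_of_continuous hg hf)

variable [IsProbabilityMeasure (rotSymLaw m g)]

/-- This number is the mean of P_k(y'μ)/P_k(1) under a probability law, and the ratio has modulus at
most 1. It is the uniform bound on e_k that dominates the series below. -/
lemma abs_hecke_mul_coeff_le (m : Sphere q) [IsProbabilityMeasure (rotSymLaw m g)]
    (hg : Integrable g (weightMeasure q))
    (hg0 : ∀ᵐ t ∂(weightMeasure q), 0 ≤ g t) (k : ℕ) : |hecke q k * coeff q g k| ≤ 1 := by
  have h := integral_basisPoly_rotSymLaw (m := m) hg hg0 m k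
  have hP := basisPoly_eval_one_pos q k
  have h1 : ‖∫ y, (basisPoly q k).eval (dot m y) ∂(rotSymLaw m g)‖ ≤ (basisPoly q k).eval 1 := by
    refine (norm_integral_le_of_norm_le_const (C := (basisPoly q k).eval 1)
      (.of_forall fun y => ?_)).trans (by simp)
    exact abs_eval_basisPoly_le q k (dot_mem_Icc m y)
  rw [h, dot_self, Real.norm_eq_abs, abs_mul, abs_of_pos hP] at h1
  exact (mul_le_iff_le_one_left hP).1 h1

/-- The projection `∫ F(x'y) dμ(y)` of the kernel as a zonal series. -/
lemma hasSum_integral_kernel {F : ℝ → ℝ} (hF : ExtendsAnalytically F)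
    (hg : Integrable g (weightMeasure q))
    (hg0 : ∀ᵐ t ∂(weightMeasure q), 0 ≤ g t) (x : Sphere q) :
    HasSum (fun k => coeff q F k * (hecke q k * coeff q g k) * (basisPoly q k).eval (dot x m))
      (∫ y, F (dot x y) ∂(rotSymLaw m g)) := by
  have hb : ∀ k (y : Sphere q), ‖coeff q F k * (basisPoly q k).eval (dot x y)‖ ≤
      |coeff q F k| * (basisPoly q k).eval 1 := fun k y => by
    rw [norm_mul]
    exact mul_le_mul_of_nonneg_left (abs_eval_basisPoly_le q k (dot_mem_Icc x y)) (abs_nonneg _)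
  have hi : ∀ k, Integrable (fun y => coeff q F k * (basisPoly q k).eval (dot x y))
      (rotSymLaw m g) := fun k =>
    Integrable.of_bound (Continuous.aestronglyMeasurable (by fun_prop)) _ (.of_forall (hb k))
  have h := hasSum_integral_of_summable_integral_norm hi (by
    refine Summable.of_nonneg_of_le (fun k => integral_nonneg fun _ => norm_nonneg _) (fun k => ?_)
      (hF.summable_coeff q)
    calc _ ≤ ∫ _, |coeff q F k| * (basisPoly q k).eval 1 ∂(rotSymLaw m g) :=
          integral_mono (hi k).norm (integrable_const _) (hb k)
      _ = _ := by simp)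
  have e1 : ∀ y, ∑' k, coeff q F k * (basisPoly q k).eval (dot x y) = F (dot x y) := fun y =>
    (hF.hasSum q (dot_mem_Icc x y)).tsum_eq
  simp only [e1, integral_const_mul, integral_basisPoly_rotSymLaw hg hg0] at h
  simpa only [mul_assoc] using h

/-- The series for `β`. -/
lemma hasSum_beta {F : ℝ → ℝ} (hF : ExtendsAnalytically F) (hg : Integrable g (weightMeasure q))
    (hg0 : ∀ᵐ t ∂(weightMeasure q), 0 ≤ g t) :
    HasSum (fun k => area q ^ 2 * (tau q k * coeff q F k * coeff q g k ^ 2))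
      (∫ x, ∫ y, F (dot x y) ∂(rotSymLaw m g) ∂(rotSymLaw m g)) := by
  have hb : ∀ k (x : Sphere q),
      ‖coeff q F k * (hecke q k * coeff q g k) * (basisPoly q k).eval (dot x m)‖ ≤
      |coeff q F k| * (basisPoly q k).eval 1 := fun k x => by
    rw [norm_mul, norm_mul]
    have h1 := abs_hecke_mul_coeff_le m hg hg0 k
    exact mul_le_mul (mul_le_of_le_one_right (abs_nonneg _) h1)
      (abs_eval_basisPoly_le q k (dot_mem_Icc x m)) (norm_nonneg _) (abs_nonneg _)
  have hi : ∀ k, Integrable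
      (fun x => coeff q F k * (hecke q k * coeff q g k) * (basisPoly q k).eval (dot x m))
      (rotSymLaw m g) := fun k =>
    Integrable.of_bound (by
      simp only [dot_comm _ m]
      exact Continuous.aestronglyMeasurable (by fun_prop)) _ (.of_forall (hb k))
  have h := hasSum_integral_of_summable_integral_norm hi (by
    refine Summable.of_nonneg_of_le (fun k => integral_nonneg fun _ => norm_nonneg _) (fun k => ?_)
      (hF.summable_coeff q)
    calc _ ≤ ∫ _, |coeff q F k| * (basisPoly q k).eval 1 ∂(rotSymLaw m g) :=
          integral_mono (hi k).norm (integrable_const _) (hb k)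
      _ = _ := by simp)
  simp only [(hasSum_integral_kernel hF hg hg0 _).tsum_eq, integral_const_mul,
    integral_zonal_rotSymLaw hg hg0 (basisPoly q _).continuous,
    integral_mul_eq_normConst_mul_coeff] at h
  refine h.congr_fun ?_
  intro k
  have := area_sq_mul_tau q k
  linear_combination (coeff q F k * coeff q g k ^ 2) * this

/-- The square of the projection of the kernel as a double series. -/
lemma hasSum_integral_sq {F : ℝ → ℝ} (hF : ExtendsAnalytically F)
    (hg : Integrable g (weightMeasure q)) (hg0 : ∀ᵐ t ∂(weightMeasure q), 0 ≤ g t) :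
    HasSum (fun k : ℕ × ℕ => (coeff q F k.1 * (hecke q k.1 * coeff q g k.1)) *
        (coeff q F k.2 * (hecke q k.2 * coeff q g k.2)) * (area (q - 1) *
          ∫ t, ((basisPoly q k.1).eval t * (basisPoly q k.2).eval t) * g t ∂(weightMeasure q)))
      (∫ x, (∫ y, F (dot x y) ∂(rotSymLaw m g)) ^ 2 ∂(rotSymLaw m g)) := by
  set H : ℕ → ℝ := fun k => coeff q F k * (hecke q k * coeff q g k) with hH
  set B : ℕ → ℝ := fun k => |coeff q F k| * (basisPoly q k).eval 1 with hB
  have hB0 : ∀ k, 0 ≤ B k := fun k => mul_nonneg (abs_nonneg _) (basisPoly_eval_one_pos q k).le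
  have hb1 : ∀ k (x : Sphere q), ‖H k * (basisPoly q k).eval (dot x m)‖ ≤ B k := fun k x => by
    rw [norm_mul, hH, norm_mul]
    have h1 := abs_hecke_mul_coeff_le m hg hg0 k
    exact mul_le_mul (mul_le_of_le_one_right (abs_nonneg _) h1)
      (abs_eval_basisPoly_le q k (dot_mem_Icc x m)) (norm_nonneg _) (abs_nonneg _)
  have hs1 : ∀ x : Sphere q, Summable fun k => ‖H k * (basisPoly q k).eval (dot x m)‖ := fun x =>
    Summable.of_nonneg_of_le (fun _ => norm_nonneg _) (fun k => hb1 k x) (hF.summable_coeff q)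
  set G : ℕ × ℕ → Sphere q → ℝ := fun k x =>
    (H k.1 * (basisPoly q k.1).eval (dot x m)) * (H k.2 * (basisPoly q k.2).eval (dot x m)) with hG
  have hsum : ∀ x, HasSum (fun k => G k x) ((∫ y, F (dot x y) ∂(rotSymLaw m g)) ^ 2) := by
    intro x
    have h1 : HasSum (fun k => H k * (basisPoly q k).eval (dot x m))
      (∫ y, F (dot x y) ∂(rotSymLaw m g)) := hasSum_integral_kernel hF hg hg0 x
    have h2 : Summable fun k : ℕ × ℕ => (H k.1 * (basisPoly q k.1).eval (dot x m)) *
        (H k.2 * (basisPoly q k.2).eval (dot x m)) :=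
      summable_mul_of_summable_norm (f := fun k => H k * (basisPoly q k).eval (dot x m))
        (g := fun k => H k * (basisPoly q k).eval (dot x m)) (hs1 x) (hs1 x)
    rw [sq]
    exact HasSum.mul h1 h1 h2
  have hb : ∀ k x, ‖G k x‖ ≤ B k.1 * B k.2 := fun k x => by
    rw [hG, norm_mul]
    exact mul_le_mul (hb1 _ _) (hb1 _ _) (norm_nonneg _) (hB0 _)
  have hi : ∀ k, Integrable (G k) (rotSymLaw m g) := fun k =>
    Integrable.of_bound (by
      simp only [hG, dot_comm _ m]
      exact Continuous.aestronglyMeasurable (by fun_prop)) _ (.of_forall (hb k))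
  have h := hasSum_integral_of_summable_integral_norm hi (by
    refine Summable.of_nonneg_of_le (fun k => integral_nonneg fun _ => norm_nonneg _) (fun k => ?_)
      ((hF.summable_coeff q).mul_of_nonneg (hF.summable_coeff q) hB0 hB0)
    calc _ ≤ ∫ _, B k.1 * B k.2 ∂(rotSymLaw m g) :=
          integral_mono (hi k).norm (integrable_const _) (hb k)
      _ = _ := by simp [hB])
  simp only [(hsum _).tsum_eq] at h
  refine h.congr_fun fun k => ?_
  have h2 := integral_zonal_rotSymLaw (m := m) hg hg0
    (f := fun t => (basisPoly q k.1).eval t * (basisPoly q k.2).eval t) (by fun_prop)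
  rw [← h2, ← integral_const_mul]
  congr 1
  funext x
  simp only [hG, hH]
  ring

end Law

/-! ### The series for α₁, α₂ and β -/

lemma triple_eq_zero_of_lt (q : ℕ) [Fact (1 ≤ q)] {k₁ k₂ k₃ : ℕ} (h : k₁ + k₂ < k₃) :
    triple q k₁ k₂ k₃ = 0 := by
  rw [triple_eq_wInt]
  refine wInt_mul_basisPoly_of_lt q (lt_of_le_of_lt natDegree_mul_le ?_)
  have := natDegree_basisPoly_le q k₁
  have := natDegree_basisPoly_le q k₂
  omega

/-- The product P_{k₁}P_{k₂} is a finite combination of the P_j with coefficients t_{k₁,k₂,j}/c_j.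
The sum over k₃ is therefore finite, and no convergence of the expansion of g is involved. -/
lemma integral_basisPoly_mul_mul (q : ℕ) [Fact (1 ≤ q)] {g : ℝ → ℝ}
    (hg : Integrable g (weightMeasure q)) (k₁ k₂ : ℕ) :
    HasSum (fun k₃ => coeff q g k₃ * triple q k₁ k₂ k₃)
      (∫ t, ((basisPoly q k₁).eval t * (basisPoly q k₂).eval t) * g t ∂(weightMeasure q)) := by
  have hd : (basisPoly q k₁ * basisPoly q k₂).natDegree ≤ k₁ + k₂ :=
    natDegree_mul_le.trans (add_le_add (natDegree_basisPoly_le q k₁) (natDegree_basisPoly_le q k₂))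
  have h := eq_sum_basisPoly q hd
  have e : ∫ t, ((basisPoly q k₁).eval t * (basisPoly q k₂).eval t) * g t ∂(weightMeasure q) =
      ∑ k₃ ∈ Finset.range (k₁ + k₂ + 1), coeff q g k₃ * triple q k₁ k₂ k₃ := by
    have e1 : ∀ t, ((basisPoly q k₁).eval t * (basisPoly q k₂).eval t) * g t =
        ∑ j ∈ Finset.range (k₁ + k₂ + 1), (triple q k₁ k₂ j / normConst q j) *
          ((basisPoly q j).eval t * g t) := by
      intro t
      rw [← eval_mul]
      conv_lhs => rw [h]
      rw [eval_finsetSum, Finset.sum_mul]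
      refine Finset.sum_congr rfl fun j _ => ?_
      rw [eval_smul, smul_eq_mul, triple_eq_wInt, mul_assoc]
    simp_rw [e1]
    rw [integral_finsetSum _ fun j _ =>
      (integrable_mul_of_continuous hg (basisPoly q j).continuous).const_mul _]
    refine Finset.sum_congr rfl fun j _ => ?_
    rw [integral_const_mul, integral_mul_eq_normConst_mul_coeff]
    have := (normConst_pos q j).ne'
    field_simp
  rw [e]
  refine hasSum_sum_of_ne_finset_zero fun j hj => ?_
  rw [triple_eq_zero_of_lt q (by simpa using hj), mul_zero]

lemma abs_triple_le (q : ℕ) [Fact (1 ≤ q)] (k₁ k₂ k₃ : ℕ) :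
    |triple q k₁ k₂ k₃| ≤ (basisPoly q k₁).eval 1 * (basisPoly q k₂).eval 1 *
      (basisPoly q k₃).eval 1 * wInt q 1 := by
  have h2 : (weightMeasure q).real Set.univ = wInt q 1 := by simp [wInt_apply]
  rw [triple_eq_wInt, wInt_apply, ← h2, ← Real.norm_eq_abs]
  refine norm_integral_le_of_norm_le_const ?_
  filter_upwards [ae_mem_Icc_weightMeasure q] with t ht
  rw [eval_mul, eval_mul, norm_mul, norm_mul]
  have h1 := abs_eval_basisPoly_le q k₁ ht
  have h2 := abs_eval_basisPoly_le q k₂ ht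
  have h3 := abs_eval_basisPoly_le q k₃ ht
  simp only [Real.norm_eq_abs]
  have p1 := basisPoly_eval_one_pos q k₁
  have p2 := basisPoly_eval_one_pos q k₂
  gcongr

lemma abs_coeff_le (q : ℕ) [Fact (1 ≤ q)] {g : ℝ → ℝ}
    (hg : Integrable g (weightMeasure q)) (k : ℕ) :
    |coeff q g k| ≤ (basisPoly q k).eval 1 / normConst q k * ∫ t, |g t| ∂(weightMeasure q) := by
  have hc := normConst_pos q k
  rw [coeff_eq, abs_mul, abs_of_pos (inv_pos.2 hc), div_eq_inv_mul, mul_assoc]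
  gcongr
  refine abs_integral_le_integral_abs.trans ?_
  rw [← integral_const_mul]
  refine integral_mono_ae ?_ (hg.abs.const_mul _) ?_
  · have := (integrable_mul_of_continuous hg (basisPoly q k).continuous).abs
    simpa only [mul_comm] using this
  · filter_upwards [ae_mem_Icc_weightMeasure q] with t ht
    rw [abs_mul, mul_comm]
    exact mul_le_mul_of_nonneg_right (abs_eval_basisPoly_le q k ht) (abs_nonneg _)

section Alpha

variable {q : ℕ} [Fact (1 ≤ q)] {m : Sphere q} {g : ℝ → ℝ} [IsProbabilityMeasure (rotSymLaw m g)]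

/-- The series for `α₁` converges absolutely. -/
lemma summable_alpha {F : ℝ → ℝ} (hF : ExtendsAnalytically F)
    (hg : Integrable g (weightMeasure q)) :
    Summable fun k : ℕ × ℕ × ℕ => coeff q F k.1 * coeff q F k.2.1 * coeff q g k.2.2 *
      triple q k.1 k.2.1 k.2.2 := by
  obtain ⟨a, ha0, ha1, D, hD, hdec⟩ := hF.coeff_decay q
  obtain ⟨A, hA, hA'⟩ := exists_eval_one_div_normConst_le q
  -- Only the kernel coefficients decay, in k₁ and k₂. On the support k₃ ≤ k₁ + k₂ of the triple
  -- integrals, half of that decay is traded for decay in k₃: a^(k₁+k₂) ≤ s^(k₁+k₂+k₃).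
  set s := √a with hs
  have hs0 : 0 < s := Real.sqrt_pos.2 ha0
  have hs1 : s < 1 := by rw [hs, Real.sqrt_lt' one_pos]; simpa using ha1
  have hsa : a = s * s := (Real.mul_self_sqrt ha0.le).symm
  set G := ∫ t, |g t| ∂(weightMeasure q) with hG
  have hG0 : 0 ≤ G := integral_nonneg fun _ => abs_nonneg _
  have hV := wInt_one_pos q
  set u : ℕ → ℝ := fun k => ((k : ℝ) + 1) ^ (q + 1) * s ^ k with hu
  have hu0 : ∀ k, 0 ≤ u k := fun k => by positivity
  have hsu : Summable u := summable_pow_mul_geometric (q + 1) hs0 hs1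
  have h3 : Summable fun k : ℕ × ℕ × ℕ => u k.1 * (u k.2.1 * u k.2.2) :=
    hsu.mul_of_nonneg (hsu.mul_of_nonneg hsu hu0 hu0) hu0 (fun k => mul_nonneg (hu0 _) (hu0 _))
  refine Summable.of_norm_bounded (h3.mul_left (D * D * (A * G) * wInt q 1)) ?_
  rintro ⟨k₁, k₂, k₃⟩
  by_cases hk : k₁ + k₂ < k₃
  · simp only [triple_eq_zero_of_lt q hk, mul_zero, norm_zero]
    have := hu0 k₁
    have := hu0 k₂
    have := hu0 k₃
    positivity
  · simp only [norm_mul, Real.norm_eq_abs]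
    have p1 := basisPoly_eval_one_pos q k₁
    have p2 := basisPoly_eval_one_pos q k₂
    have p3 := basisPoly_eval_one_pos q k₃
    have c3 : |coeff q g k₃| ≤ A * ((k₃ : ℝ) + 1) * G :=
      (abs_coeff_le q hg k₃).trans (mul_le_mul_of_nonneg_right (hA' k₃) hG0)
    have t3 : |triple q k₁ k₂ k₃| ≤ ((k₁ : ℝ) + 1) ^ q * ((k₂ : ℝ) + 1) ^ q * ((k₃ : ℝ) + 1) ^ q *
        wInt q 1 := by
      refine (abs_triple_le q k₁ k₂ k₃).trans ?_
      gcongr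
      · exact basisPoly_eval_one_le q k₁
      · exact basisPoly_eval_one_le q k₂
      · exact basisPoly_eval_one_le q k₃
    have hpow : a ^ k₁ * a ^ k₂ ≤ s ^ k₁ * s ^ k₂ * s ^ k₃ := by
      rw [hsa, mul_pow, mul_pow]
      have : s ^ k₁ * s ^ k₂ ≤ s ^ k₃ := by
        rw [← pow_add]
        exact pow_le_pow_of_le_one hs0.le hs1.le (not_lt.1 hk)
      calc _ = (s ^ k₁ * s ^ k₂) * (s ^ k₁ * s ^ k₂) := by ring
        _ ≤ _ := by gcongr
    calc _ ≤ (D * ((k₁ : ℝ) + 1) * a ^ k₁) * (D * ((k₂ : ℝ) + 1) * a ^ k₂) *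
          (A * ((k₃ : ℝ) + 1) * G) * (((k₁ : ℝ) + 1) ^ q * ((k₂ : ℝ) + 1) ^ q *
            ((k₃ : ℝ) + 1) ^ q * wInt q 1) := by
          gcongr
          · exact hdec k₁
          · exact hdec k₂
      _ = (D * D * (A * G) * wInt q 1 * (((k₁ : ℝ) + 1) ^ (q + 1) * ((k₂ : ℝ) + 1) ^ (q + 1) *
            ((k₃ : ℝ) + 1) ^ (q + 1))) * (a ^ k₁ * a ^ k₂) := by ring
      _ ≤ (D * D * (A * G) * wInt q 1 * (((k₁ : ℝ) + 1) ^ (q + 1) * ((k₂ : ℝ) + 1) ^ (q + 1) *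
            ((k₃ : ℝ) + 1) ^ (q + 1))) * (s ^ k₁ * s ^ k₂ * s ^ k₃) := by gcongr
      _ = _ := by simp only [hu]; ring

lemma summable_alphaOneTerm {ψ : ℝ → ℝ} (hF : ExtendsAnalytically fun x => ψ (Real.arccos x))
    (hg : Integrable g (weightMeasure q)) (hg0 : ∀ᵐ t ∂(weightMeasure q), 0 ≤ g t)
    (m : Sphere q) [IsProbabilityMeasure (rotSymLaw m g)] :
    Summable (alphaOneTerm q ψ g) := by
  have h := (summable_alpha hF hg).norm.mul_left (area (q - 1) / area q ^ 2)
  refine Summable.of_norm_bounded h fun k => ?_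
  have hA := area_pos q
  have hA' := area_pos (q - 1)
  have e : alphaOneTerm q ψ g k = (hecke q k.1 * coeff q g k.1) * (hecke q k.2.1 * coeff q g k.2.1) *
      (area (q - 1) / area q ^ 2 * (kernelCoeff q ψ k.1 * kernelCoeff q ψ k.2.1 * coeff q g k.2.2 *
      triple q k.1 k.2.1 k.2.2)) := by
    have hz := area_sq_mul_zeta q k.1 k.2.1
    have : zeta q k.1 k.2.1 = hecke q k.1 * hecke q k.2.1 * (area (q - 1) / area q ^ 2) := by
      field_simp
      linarith
    rw [alphaOneTerm, this]
    ring
  rw [e, norm_mul, norm_mul]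
  have h1 := abs_hecke_mul_coeff_le m hg hg0 k.1
  have h2 := abs_hecke_mul_coeff_le m hg hg0 k.2.1
  have h3 : ‖hecke q k.1 * coeff q g k.1‖ * ‖hecke q k.2.1 * coeff q g k.2.1‖ ≤ 1 :=
    mul_le_one₀ h1 (abs_nonneg _) h2
  refine (mul_le_of_le_one_left (norm_nonneg _) h3).trans (le_of_eq ?_)
  rw [norm_mul, Real.norm_of_nonneg (by positivity)]
  rfl

/-- Absolute convergence allows the sum over k₃ to be taken first. This yields the double series of
the squared projection, and a series has only one sum. -/
lemma alphaOne_eq {ψ : ℝ → ℝ} (hF : ExtendsAnalytically fun x => ψ (Real.arccos x))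
    (hg : Integrable g (weightMeasure q)) (hg0 : ∀ᵐ t ∂(weightMeasure q), 0 ≤ g t) :
    alphaOne q ψ g = ∫ x, (∫ y, ψ (angle x y) ∂(rotSymLaw m g)) ^ 2 ∂(rotSymLaw m g) := by
  have h1 := ((summable_alphaOneTerm hF hg hg0 m).mul_left (area q ^ 2)).hasSum
  rw [tsum_mul_left] at h1
  have h2 := hasSum_integral_sq (m := m) hF hg hg0
  have h3 := (Equiv.prodAssoc ℕ ℕ ℕ).hasSum_iff.2 h1
  have h4 := h3.prod_fiberwise (g := fun k : ℕ × ℕ =>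
      (kernelCoeff q ψ k.1 * (hecke q k.1 * coeff q g k.1)) *
        (kernelCoeff q ψ k.2 * (hecke q k.2 * coeff q g k.2)) * (area (q - 1) *
          ∫ t, ((basisPoly q k.1).eval t * (basisPoly q k.2).eval t) * g t ∂(weightMeasure q)))
    (fun k => by
      have h5 := (integral_basisPoly_mul_mul q hg k.1 k.2).mul_left
        ((kernelCoeff q ψ k.1 * (hecke q k.1 * coeff q g k.1)) *
          (kernelCoeff q ψ k.2 * (hecke q k.2 * coeff q g k.2)) * area (q - 1))
      rw [mul_assoc (_ * _) (area (q - 1))] at h5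
      refine h5.congr_fun fun j => ?_
      have hz := area_sq_mul_zeta q k.1 k.2
      simp only [Function.comp, Equiv.prodAssoc_apply, alphaOneTerm]
      linear_combination (kernelCoeff q ψ k.1 * kernelCoeff q ψ k.2 * coeff q g k.1 *
        coeff q g k.2 * coeff q g j * triple q k.1 k.2 j) * hz)
  exact h4.unique h2

lemma hasSum_betaTerm {ψ : ℝ → ℝ} (hF : ExtendsAnalytically fun x => ψ (Real.arccos x))
    (hg : Integrable g (weightMeasure q)) (hg0 : ∀ᵐ t ∂(weightMeasure q), 0 ≤ g t) :
    HasSum (fun k => area q ^ 2 * betaTerm q ψ g k)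
      (∫ x, ∫ y, ψ (angle x y) ∂(rotSymLaw m g) ∂(rotSymLaw m g)) :=
  hasSum_beta hF hg hg0

lemma summable_betaTerm {ψ : ℝ → ℝ} (hF : ExtendsAnalytically fun x => ψ (Real.arccos x))
    (hg : Integrable g (weightMeasure q)) (hg0 : ∀ᵐ t ∂(weightMeasure q), 0 ≤ g t)
    (m : Sphere q) [IsProbabilityMeasure (rotSymLaw m g)] :
    Summable (betaTerm q ψ g) :=
  (summable_mul_left_iff (pow_pos (area_pos q) 2).ne').1 (hasSum_betaTerm (m := m) hF hg hg0).summable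

lemma betaConst_eq {ψ : ℝ → ℝ} (hF : ExtendsAnalytically fun x => ψ (Real.arccos x))
    (hg : Integrable g (weightMeasure q)) (hg0 : ∀ᵐ t ∂(weightMeasure q), 0 ≤ g t) :
    betaConst q ψ g = ∫ x, ∫ y, ψ (angle x y) ∂(rotSymLaw m g) ∂(rotSymLaw m g) := by
  rw [← (hasSum_betaTerm (m := m) hF hg hg0).tsum_eq, tsum_mul_left, betaConst]

end Alpha

/-! ### Variance of a U-statistic of order two -/

section UStatistic

variable {Ω S : Type*} [MeasurableSpace Ω] [MeasurableSpace S] {P : Measure Ω}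
  [IsProbabilityMeasure P] {μ : Measure S} [IsProbabilityMeasure μ] {n : ℕ}
  {X : Fin n → Ω → S} {h : S → S → ℝ} {B : ℝ}

lemma map_pair (hXm : ∀ i, Measurable (X i)) (hXi : iIndepFun X P) (hX : ∀ i, P.map (X i) = μ)
    {i j : Fin n} (hij : i ≠ j) : P.map (fun ω => (X i ω, X j ω)) = μ.prod μ := by
  rw [(indepFun_iff_map_prod_eq_prod_map_map (hXm i).aemeasurable (hXm j).aemeasurable).1
    (hXi.indepFun hij), hX, hX]

lemma map_triple (hXm : ∀ i, Measurable (X i)) (hXi : iIndepFun X P) (hX : ∀ i, P.map (X i) = μ)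
    {i j k : Fin n} (hij : i ≠ j) (hik : i ≠ k) (hjk : j ≠ k) :
    P.map (fun ω => (X i ω, X j ω, X k ω)) = μ.prod (μ.prod μ) := by
  have h1 := (hXi.indepFun_prodMk hXm j k i hij.symm hik.symm).symm
  rw [(indepFun_iff_map_prod_eq_prod_map_map (hXm i).aemeasurable
    ((hXm j).prodMk (hXm k)).aemeasurable).1 h1, hX, map_pair hXm hXi hX hjk]

lemma integral_pair (hXm : ∀ i, Measurable (X i)) (hXi : iIndepFun X P)
    (hX : ∀ i, P.map (X i) = μ) {f : S → S → ℝ} (hf : Measurable (Function.uncurry f))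
    (hB : ∀ x y, |f x y| ≤ B) {i j : Fin n} (hij : i ≠ j) :
    ∫ ω, f (X i ω) (X j ω) ∂P = ∫ x, ∫ y, f x y ∂μ ∂μ := by
  have h1 := integral_map (μ := P) (φ := fun ω => (X i ω, X j ω)) (f := Function.uncurry f)
    ((hXm i).prodMk (hXm j)).aemeasurable hf.aestronglyMeasurable
  rw [map_pair hXm hXi hX hij, integral_prod _ (Integrable.of_bound hf.aestronglyMeasurable B
    (.of_forall fun p => hB p.1 p.2))] at h1
  exact h1.symm

lemma integral_shared (hXm : ∀ i, Measurable (X i)) (hXi : iIndepFun X P)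
    (hX : ∀ i, P.map (X i) = μ) (hh : Measurable (Function.uncurry h))
    (hB : ∀ x y, |h x y| ≤ B) {i j k : Fin n} (hij : i ≠ j) (hik : i ≠ k) (hjk : j ≠ k) :
    ∫ ω, h (X i ω) (X j ω) * h (X i ω) (X k ω) ∂P = ∫ x, (∫ y, h x y ∂μ) ^ 2 ∂μ := by
  have hm : Measurable fun p : S × S × S => h p.1 p.2.1 * h p.1 p.2.2 :=
    (hh.comp (measurable_fst.prodMk (measurable_fst.comp measurable_snd))).mul
      (hh.comp (measurable_fst.prodMk (measurable_snd.comp measurable_snd)))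
  have h1 := integral_map (μ := P) (φ := fun ω => (X i ω, X j ω, X k ω))
    (f := fun p : S × S × S => h p.1 p.2.1 * h p.1 p.2.2)
    ((hXm i).prodMk ((hXm j).prodMk (hXm k))).aemeasurable hm.aestronglyMeasurable
  rw [map_triple hXm hXi hX hij hik hjk, integral_prod _ (Integrable.of_bound
    hm.aestronglyMeasurable (B * B) (.of_forall fun p => by
      rw [norm_mul]
      exact mul_le_mul (hB _ _) (hB _ _) (norm_nonneg _) ((abs_nonneg _).trans (hB p.1 p.2.1))))] at h1
  rw [← h1]
  congr 1
  funext x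
  rw [sq, ← integral_prod_mul]

/-- The off-diagonal kernel evaluations. -/
def offDiag (h : S → S → ℝ) (X : Fin n → Ω → S) (p : Fin n × Fin n) (ω : Ω) : ℝ :=
  if p.1 = p.2 then 0 else h (X p.1 ω) (X p.2 ω)

lemma measurable_pair (hXm : ∀ i, Measurable (X i)) (hh : Measurable (Function.uncurry h))
    (i j : Fin n) : Measurable fun ω => h (X i ω) (X j ω) :=
  hh.comp ((hXm i).prodMk (hXm j))

lemma memLp_pair (hXm : ∀ i, Measurable (X i)) (hh : Measurable (Function.uncurry h))
    (hB : ∀ x y, |h x y| ≤ B) (i j : Fin n) : MemLp (fun ω => h (X i ω) (X j ω)) 2 P :=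
  MemLp.of_bound (measurable_pair hXm hh i j).aestronglyMeasurable B (.of_forall fun _ => hB _ _)

lemma memLp_offDiag (hXm : ∀ i, Measurable (X i)) (hh : Measurable (Function.uncurry h))
    (hB : ∀ x y, |h x y| ≤ B) (p : Fin n × Fin n) : MemLp (offDiag h X p) 2 P := by
  unfold offDiag
  split_ifs
  · exact MemLp.zero'
  · exact memLp_pair hXm hh hB _ _

/-- The linear indicator part counts coincidences of indices and the quadratic part detects equal
unordered pairs. Equal pairs have two coincidences, so the correction η₂ - 2η₁ restores η₂. Symmetry
of h brings a shared index to the first place. -/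
lemma covariance_offDiag (hXm : ∀ i, Measurable (X i)) (hXi : iIndepFun X P)
    (hX : ∀ i, P.map (X i) = μ) (hh : Measurable (Function.uncurry h))
    (hs : ∀ x y, h x y = h y x) (hB : ∀ x y, |h x y| ≤ B) {η₁ η₂ : ℝ}
    (h1 : η₁ = ∫ x, (∫ y, h x y ∂μ) ^ 2 ∂μ - (∫ x, ∫ y, h x y ∂μ ∂μ) ^ 2)
    (h2 : η₂ = ∫ x, ∫ y, h x y ^ 2 ∂μ ∂μ - (∫ x, ∫ y, h x y ∂μ ∂μ) ^ 2)
    {i j k l : Fin n} (hij : i ≠ j) (hkl : k ≠ l) :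
    cov[offDiag h X (i, j), offDiag h X (k, l); P] =
      η₁ * ((if i = k then 1 else 0) + (if i = l then 1 else 0) + (if j = k then 1 else 0) +
        (if j = l then 1 else 0)) + (η₂ - 2 * η₁) * ((if i = k then 1 else 0) *
          (if j = l then 1 else 0) + (if i = l then 1 else 0) * (if j = k then 1 else 0)) := by
  have same : ∀ i j : Fin n, i ≠ j →
      cov[fun ω => h (X i ω) (X j ω), fun ω => h (X i ω) (X j ω); P] = η₂ := by
    intro i j hij
    have := integral_pair hXm hXi hX (f := fun x y => h x y ^ 2) (hh.pow_const 2) (B := B ^ 2)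
      (fun x y => by
        rw [abs_pow]
        exact pow_le_pow_left₀ (abs_nonneg _) (hB x y) 2) hij
    have e : P[(fun ω => h (X i ω) (X j ω)) * fun ω => h (X i ω) (X j ω)] =
        ∫ ω, h (X i ω) (X j ω) ^ 2 ∂P := by
      congr 1
      funext ω
      simp [sq]
    rw [covariance_eq_sub (memLp_pair hXm hh hB i j) (memLp_pair hXm hh hB i j),
      integral_pair hXm hXi hX hh hB hij, h2, e, this]
    ring
  have shared : ∀ i j k : Fin n, i ≠ j → i ≠ k → j ≠ k →
      cov[fun ω => h (X i ω) (X j ω), fun ω => h (X i ω) (X k ω); P] = η₁ := by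
    intro i j k hij hik hjk
    rw [covariance_eq_sub (memLp_pair hXm hh hB i j) (memLp_pair hXm hh hB i k),
      integral_pair hXm hXi hX hh hB hij, integral_pair hXm hXi hX hh hB hik, h1, ← sq,
      ← integral_shared hXm hXi hX hh hB hij hik hjk]
    rfl
  have disjoint : ∀ i j k l : Fin n, i ≠ k → i ≠ l → j ≠ k → j ≠ l →
      cov[fun ω => h (X i ω) (X j ω), fun ω => h (X k ω) (X l ω); P] = 0 := by
    intro i j k l hik hil hjk hjl
    have := (hXi.indepFun_prodMk_prodMk hXm i j k l hik hil hjk hjl).comp hh hh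
    exact this.covariance_eq_zero (memLp_pair hXm hh hB i j) (memLp_pair hXm hh hB k l)
  have hsym : ∀ i j : Fin n, (fun ω => h (X i ω) (X j ω)) = fun ω => h (X j ω) (X i ω) :=
    fun i j => funext fun ω => hs _ _
  have e1 : offDiag h X (i, j) = fun ω => h (X i ω) (X j ω) := by
    funext ω; simp [offDiag, hij]
  have e2 : offDiag h X (k, l) = fun ω => h (X k ω) (X l ω) := by
    funext ω; simp [offDiag, hkl]
  rw [e1, e2]
  by_cases hik : i = k
  · subst hik
    by_cases hjl : j = l
    · subst hjl
      rw [same i j hij]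
      simp [hij, hij.symm]
      ring
    · rw [shared i j l hij hkl hjl]
      simp [hij.symm, hkl, hjl]
  · by_cases hil : i = l
    · subst hil
      rw [hsym k i]
      by_cases hjk : j = k
      · subst hjk
        rw [same i j hij]
        simp [hij, hij.symm]
        ring
      · rw [shared i j k hij hik hjk]
        simp [hij.symm, hik, hjk]
    · rw [hsym i j]
      by_cases hjk : j = k
      · subst hjk
        rw [shared j i l hij.symm hkl hil]
        simp [hik, hil, hkl]
      · by_cases hjl : j = l
        · subst hjl
          rw [hsym k j, shared j i k hij.symm hjk hik]
          simp [hik, hil, hjk]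
        · rw [disjoint j i k l hjk hjl hik hil]
          simp [hik, hil, hjk, hjl]

/-- Each of the four coincidences occurs for n - 1 ordered pairs (k,l), and the unordered pair {i,j}
occurs in two orders. -/
lemma sum_offDiag_indicators (A D : ℝ) {i j : Fin n} (hij : i ≠ j) :
    ∑ k : Fin n, ∑ l : Fin n, (if k = l then 0 else
      A * ((if i = k then 1 else 0) + (if i = l then 1 else 0) + (if j = k then 1 else 0) +
        (if j = l then 1 else 0)) + D * ((if i = k then 1 else 0) *
          (if j = l then 1 else 0) + (if i = l then 1 else 0) * (if j = k then 1 else 0))) =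
      4 * ((n : ℝ) - 1) * A + 2 * D := by
  have e : ∀ (k l : Fin n) (f : ℝ), (if k = l then 0 else f) = f - if k = l then f else 0 := by
    intro k l f
    split_ifs <;> simp
  simp_rw [e]
  simp [Finset.sum_add_distrib, Finset.sum_sub_distrib, ← Finset.mul_sum, hij]
  ring

lemma variance_sum_offDiag (hXm : ∀ i, Measurable (X i)) (hXi : iIndepFun X P)
    (hX : ∀ i, P.map (X i) = μ) (hh : Measurable (Function.uncurry h))
    (hs : ∀ x y, h x y = h y x) (hB : ∀ x y, |h x y| ≤ B) {η₁ η₂ : ℝ}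
    (h1 : η₁ = ∫ x, (∫ y, h x y ∂μ) ^ 2 ∂μ - (∫ x, ∫ y, h x y ∂μ ∂μ) ^ 2)
    (h2 : η₂ = ∫ x, ∫ y, h x y ^ 2 ∂μ ∂μ - (∫ x, ∫ y, h x y ∂μ ∂μ) ^ 2) :
    variance (fun ω => ∑ p, offDiag h X p ω) P =
      n * ((n : ℝ) - 1) * (4 * ((n : ℝ) - 2) * η₁ + 2 * η₂) := by
  rw [variance_fun_sum fun p => memLp_offDiag hXm hh hB p]
  have e : ∀ p r : Fin n × Fin n, cov[offDiag h X p, offDiag h X r; P] = if p.1 = p.2 then 0 else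
      if r.1 = r.2 then 0 else
        η₁ * ((if p.1 = r.1 then 1 else 0) + (if p.1 = r.2 then 1 else 0) +
          (if p.2 = r.1 then 1 else 0) + (if p.2 = r.2 then 1 else 0)) +
          (η₂ - 2 * η₁) * ((if p.1 = r.1 then 1 else 0) * (if p.2 = r.2 then 1 else 0) +
            (if p.1 = r.2 then 1 else 0) * (if p.2 = r.1 then 1 else 0)) := by
    rintro ⟨i, j⟩ ⟨k, l⟩
    by_cases hij : i = j
    · have : offDiag h X (i, j) = 0 := by funext ω; simp [offDiag, hij]
      rw [this]; simp [hij]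
    · by_cases hkl : k = l
      · have : offDiag h X (k, l) = 0 := by funext ω; simp [offDiag, hkl]
        rw [this]; simp [hkl]
      · rw [covariance_offDiag hXm hXi hX hh hs hB h1 h2 hij hkl]
        simp [hij, hkl]
  simp_rw [e, Fintype.sum_prod_type]
  have inner : ∀ i j : Fin n, (∑ k : Fin n, ∑ l : Fin n, if i = j then 0 else
      if k = l then 0 else
        η₁ * ((if i = k then 1 else 0) + (if i = l then 1 else 0) +
          (if j = k then 1 else 0) + (if j = l then 1 else 0)) +
          (η₂ - 2 * η₁) * ((if i = k then 1 else 0) * (if j = l then 1 else 0) +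
            (if i = l then 1 else 0) * (if j = k then 1 else 0))) =
      (4 * ((n : ℝ) - 2) * η₁ + 2 * η₂) - if i = j then (4 * ((n : ℝ) - 2) * η₁ + 2 * η₂) else 0 := by
    intro i j
    by_cases hij : i = j
    · simp [hij]
    · simp only [hij, if_false]
      rw [sum_offDiag_indicators _ _ hij]
      ring
  simp_rw [inner]
  simp [Finset.sum_sub_distrib]
  ring

lemma sum_offDiag_eq (hs : ∀ x y, h x y = h y x) (ω : Ω) :
    ∑ p, offDiag h X p ω = 2 * ∑ i : Fin n, ∑ j ∈ Finset.Ioi i, h (X i ω) (X j ω) := by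
  have e : ∀ i j : Fin n, offDiag h X (i, j) ω =
      (if i < j then h (X i ω) (X j ω) else 0) + if j < i then h (X j ω) (X i ω) else 0 := by
    intro i j
    rcases lt_trichotomy i j with hlt | rfl | hlt
    · simp [offDiag, hlt, hlt.ne, hlt.not_gt]
    · simp [offDiag]
    · simp [offDiag, hlt, hlt.ne', hlt.not_gt, hs]
  have e2 : ∀ i : Fin n, ∑ j ∈ Finset.Ioi i, h (X i ω) (X j ω) =
      ∑ j : Fin n, if i < j then h (X i ω) (X j ω) else 0 := by
    intro i
    rw [← Finset.sum_filter]
    congr 1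
    ext j
    simp
  rw [Fintype.sum_prod_type]
  simp_rw [e, e2, Finset.sum_add_distrib]
  rw [Finset.sum_comm (f := fun i j : Fin n => if j < i then h (X j ω) (X i ω) else 0), two_mul]

end UStatistic

/-! ### The variance of the test statistic -/

lemma statistic_eq {q n : ℕ} (ψ : ℝ → ℝ) (x : Fin n → Sphere q) :
    statistic ψ x = 2 / (n : ℝ) * (∑ i : Fin n, ∑ j ∈ Finset.Ioi i, ψ (angle (x i) (x j)) -
      ∑ i : Fin n, ∑ _j ∈ Finset.Ioi i, nullMean q ψ) := by
  simp only [statistic, Finset.sum_sub_distrib]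

lemma measurable_kernel {q : ℕ} {ψ : ℝ → ℝ}
    (hψ : ContinuousOn (fun x => ψ (Real.arccos x)) (Set.Icc (-1) 1)) :
    Measurable (Function.uncurry fun x y : Sphere q => ψ (angle x y)) :=
  (hψ.comp_continuous continuous_dot fun p => dot_mem_Icc p.1 p.2).measurable

lemma exists_kernel_bound (q : ℕ) {ψ : ℝ → ℝ}
    (hψ : ContinuousOn (fun x => ψ (Real.arccos x)) (Set.Icc (-1) 1)) :
    ∃ B, ∀ x y : Sphere q, |ψ (angle x y)| ≤ B := by
  obtain ⟨B, hB⟩ := isCompact_Icc.exists_bound_of_continuousOn hψ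
  exact ⟨B, fun x y => hB _ (dot_mem_Icc x y)⟩

lemma memLp_statistic {q n : ℕ} {ψ : ℝ → ℝ}
    (hψ : ContinuousOn (fun x => ψ (Real.arccos x)) (Set.Icc (-1) 1))
    {Ω : Type*} [MeasurableSpace Ω] (P : Measure Ω) [IsProbabilityMeasure P]
    {X : Fin n → Ω → Sphere q} (hXm : ∀ i, Measurable (X i)) :
    MemLp (fun ω => statistic ψ fun i => X i ω) 2 P := by
  obtain ⟨B, hB⟩ := exists_kernel_bound q hψ
  unfold statistic
  exact (memLp_finsetSum _ fun i _ => memLp_finsetSum _ fun j _ =>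
    (memLp_pair hXm (measurable_kernel hψ) hB i j).sub (memLp_const _)).const_mul _

lemma variance_statistic {q n : ℕ} (hn : 1 ≤ n) {ψ : ℝ → ℝ}
    (hψ : ContinuousOn (fun x => ψ (Real.arccos x)) (Set.Icc (-1) 1))
    {Ω : Type*} [MeasurableSpace Ω] (P : Measure Ω) [IsProbabilityMeasure P]
    {μ : Measure (Sphere q)} [IsProbabilityMeasure μ]
    {X : Fin n → Ω → Sphere q} (hXm : ∀ i, Measurable (X i)) (hXi : iIndepFun X P)
    (hX : ∀ i, P.map (X i) = μ) :
    variance (fun ω => statistic ψ fun i => X i ω) P =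
      2 * ((n : ℝ) - 1) / n * (2 * ((n : ℝ) - 2) *
        (∫ x, (∫ y, ψ (angle x y) ∂μ) ^ 2 ∂μ - (∫ x, ∫ y, ψ (angle x y) ∂μ ∂μ) ^ 2) +
        (∫ x, ∫ y, ψ (angle x y) ^ 2 ∂μ ∂μ - (∫ x, ∫ y, ψ (angle x y) ∂μ ∂μ) ^ 2)) := by
  obtain ⟨B, hB⟩ := exists_kernel_bound q hψ
  have hs : ∀ x y : Sphere q, ψ (angle x y) = ψ (angle y x) := fun x y => by
    simp only [angle, dot_comm]
  have hh := measurable_kernel (q := q) hψ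
  have hv := variance_sum_offDiag hXm hXi hX hh hs hB rfl rfl
  have hm : MemLp (fun ω => ∑ p, offDiag (fun x y => ψ (angle x y)) X p ω) 2 P :=
    memLp_finsetSum _ fun p _ => memLp_offDiag hXm hh hB p
  -- Each unordered pair occurs twice in the sum over ordered pairs, so 2/n becomes 1/n. The
  -- centring is a constant and does not affect the variance.
  have e : (fun ω => statistic ψ fun i => X i ω) = fun ω => 1 / (n : ℝ) *
      (∑ p, offDiag (fun x y => ψ (angle x y)) X p ω -
        2 * ∑ i : Fin n, ∑ _j ∈ Finset.Ioi i, nullMean q ψ) := by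
    funext ω
    rw [statistic_eq, sum_offDiag_eq hs]
    ring
  have hn0 : (n : ℝ) ≠ 0 := by positivity
  rw [e, variance_const_mul, variance_sub_const hm.aestronglyMeasurable, hv]
  field_simp
  ring

end SphereUniformity

end

theorem proposition6 (q : ℕ) (hq : 1 ≤ q) (n : ℕ) (hn : 1 ≤ n)
    (ψ : ℝ → ℝ) (hψ : SphereUniformity.IsTestKernel q ψ)
    (m : SphereUniformity.Sphere q) (g : ℝ → ℝ)
    (hg : MemLp g 2 (SphereUniformity.weightMeasure q))
    (hg0 : ∀ᵐ t ∂(SphereUniformity.weightMeasure q), 0 ≤ g t)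
    {Ω : Type*} [MeasurableSpace Ω] (P : Measure Ω) [IsProbabilityMeasure P]
    (X : Fin n → Ω → SphereUniformity.Sphere q)
    (hXm : ∀ i, Measurable (X i)) (hXi : iIndepFun X P)
    (hXlaw : ∀ i, P.map (X i) = SphereUniformity.rotSymLaw m g) :
    -- the statistic has a finite second moment and the three series converge (absolutely)
    MemLp (fun ω => SphereUniformity.statistic ψ (fun i => X i ω)) 2 P ∧
    Summable (SphereUniformity.alphaOneTerm q ψ g) ∧
    Summable (SphereUniformity.betaTerm q (fun θ => ψ θ ^ 2) g) ∧
    Summable (SphereUniformity.betaTerm q ψ g) ∧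
    -- the variance
    variance (fun ω => SphereUniformity.statistic ψ (fun i => X i ω)) P =
      2 * ((n : ℝ) - 1) / n *
        (2 * ((n : ℝ) - 2) * SphereUniformity.etaOne q ψ g + SphereUniformity.etaTwo q ψ g) ∧
    -- the values of the triple-product integrals
    (∀ k₁ k₂ k₃ : ℕ, k₁ ≤ k₂ → k₂ ≤ k₃ →
      SphereUniformity.triple q k₁ k₂ k₃ =
        if q = 1 then
          (if k₃ = k₂ + k₁ ∨ k₃ = k₂ - k₁ then
            (1 + if k₁ = 0 then 1 else 0) / 2 * SphereUniformity.normConst 1 k₃ else 0)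
        else
          (if Odd (k₁ + k₂ + k₃) ∨ k₁ + k₂ < k₃ then 0 else
            SphereUniformity.linCoeff ((k₁ + k₂ - k₃) / 2) k₁ k₂ (((q : ℝ) - 1) / 2) *
              SphereUniformity.normConst q k₃)) := by
  have : Fact (1 ≤ q) := ⟨hq⟩
  have : IsProbabilityMeasure (SphereUniformity.rotSymLaw m g) := by
    -- The law has total mass 1 because it is the distribution of the first observation, which
    -- exists since n ≥ 1.
    rw [← hXlaw ⟨0, hn⟩]
    exact Measure.isProbabilityMeasure_map (hXm _).aemeasurable
  have hF := hψ.extendsAnalytically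
  have hgi : Integrable g (SphereUniformity.weightMeasure q) := hg.integrable one_le_two
  have hα := SphereUniformity.alphaOne_eq (m := m) hF hgi hg0
  have hβ := SphereUniformity.betaConst_eq (m := m) hF hgi hg0
  -- By definition α₂ is β for the kernel ψ², which inherits the analytic extension.
  have hγ : SphereUniformity.alphaTwo q ψ g = _ :=
    SphereUniformity.betaConst_eq (ψ := fun θ => ψ θ ^ 2) (m := m) hF.sq hgi hg0
  refine ⟨SphereUniformity.memLp_statistic hF.continuousOn P hXm,
    SphereUniformity.summable_alphaOneTerm hF hgi hg0 m,
    SphereUniformity.summable_betaTerm (ψ := fun θ => ψ θ ^ 2) hF.sq hgi hg0 m,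
    SphereUniformity.summable_betaTerm hF hgi hg0 m, ?_,
    fun k₁ k₂ k₃ h h' => SphereUniformity.triple_eq q k₁ k₂ k₃ h h'⟩
  rw [SphereUniformity.etaOne, SphereUniformity.etaTwo, hα, hβ, hγ]
  exact SphereUniformity.variance_statistic hn hF.continuousOn P hXm hXi hXlaw
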